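/- **Setting.** Let $L,a>0$ and $\Omega=(\mathbb R/L\mathbb Z)^2\times[0,a]$, with points $(r,z)$, $r=(x,y)$. Let $H_0(\mathrm{curl})$ be the closure, in the norm $(\|E\|_{L^2}^2+\|\nabla\times E\|_{L^2}^2)^{1/2}$, of the smooth vector fields $E:\Omega\to\mathbb C^3$ with $E_x=E_y=0$ at $z=0,a$. Put $$V=\{E\in H_0(\mathrm{curl}):\nabla\cdot E=0\text{ in the sense of distributions}\},\qquad h_0=(L^2a)^{-1/2}e_z,$$ let $\mathcal H=\overline{V}^{\,L^2}\ominus\operatorname{span}\{h_0\}$, and let $\mathcal L_{\mathrm{Mx}}$ be the nonnegative self-adjoint operator in $\mathcal H$ associated with the closed form $q[E,F]=\int_\Omega(\nabla\times E)\cdot\overline{(\nabla\times F)}\,dx$ on $V\cap\mathcal H$. Let $L_D$ and $L_N$ be the positive Dirichlet and Neumann Laplacians in $L^2(\Omega)$ (periodic in $r$, Dirichlet respectively Neumann conditions at $z=0,a$), associated with the form $\int_\Omega\nabla u\cdot\overline{\nabla v}\,dx$ on $H^1_0$ and on $H^1$ respectively. For $m\in\mathbb Z^2$ and $n\ge0$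 let $k_m=\frac{2\pi}{L}m$, $\nu_n=\frac{\pi n}{a}$, $\lambda_{m,n}=|k_m|^2+\nu_n^2$, $\phi_m(r)=L^{-1}e^{ik_m\cdot r}$, $s_n(z)=\sqrt{2/a}\,\sin(\nu_nz)$, $c_0=a^{-1/2}$, and $c_n(z)=\sqrt{2/a}\,\cos(\nu_nz)$ for $n\ge1$. Put $d_{m,n}=\phi_ms_n$ $(n\ge1)$ and $u_{m,n}=\phi_mc_n$ $(n\ge0)$. Let $L_N'$ be the restriction of $L_N$ to $u_{0,0}^\perp$, and write $\operatorname{Tr}'f(L_N):=\operatorname{Tr}f(L_N')$. **Theorem.** (1) There is exactly one unitary operator $U:L^2(\Omega)\oplus u_{0,0}^\perp\to\mathcal H$ such that, for $m\ne0$ and $n\ge1$, with $\hat k=k_m/|k_m|$ and $\hat k^\perp=|k_m|^{-1}(-k_{m,2},k_{m,1})$, $$U(d_{m,n},0)=\phi_ms_n\,\hat k^\perp,\qquad U(0,u_{m,n})=\phi_m\Big[-i\frac{\nu_n}{\sqrt{\lambda_{m,n}}}\,\hat k\,s_n+\frac{|k_m|}{\sqrt{\lambda_{m,n}}}\,e_z\,c_n\Big]$$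 (TE and TM modes); for $n\ge1$, $U(d_{0,n},0)=\phi_0s_ne_x$ and $U(0,u_{0,n})=\phi_0s_ne_y$; and for $m\ne0$, $U(0,u_{m,0})=\phi_mc_0e_z$. This $U$ maps the domain of $L_D\oplus L_N'$ onto the domain of $\mathcal L_{\mathrm{Mx}}$, and $\mathcal L_{\mathrm{Mx}}U=U(L_D\oplus L_N')$ there; so $\mathcal L_{\mathrm{Mx}}$ is unitarily equivalent to $L_D\oplus L_N'$. (2) Let $f:[0,\infty)\to\mathbb C$ be a Borel function such that the sums $$S_1=\sum_{m\in\mathbb Z^2}\sum_{n\ge1}f(|k_m|^2+\nu_n^2),\qquad S_2=\sum_{m\in\mathbb Z^2\setminus\{0\}}f(|k_m|^2)$$ converge absolutely. Then $f(\mathcal L_{\mathrm{Mx}})$, $f(L_D)$ and $f(L_N')$, defined by the Borel functional calculus, are bounded operators of trace class, $\operatorname{Tr}f(L_D)=S_1$, $\operatorname{Tr}'f(L_N)=S_1+S_2$, and $$\operatorname{Tr}f(\mathcal L_{\mathrm{Mx}})=\operatorname{Tr}f(L_D)+\operatorname{Tr}'f(L_N)=2\sum_{m\in\mathbb Z^2}\sum_{n\ge1}f(|k_m|^2+\nu_n^2)+\sum_{m\in\mathbb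 Z^2\setminus\{0\}}f(|k_m|^2).$$ -/

import Mathlib

open MeasureTheory Set
open scoped NNReal InnerProductSpace ContDiff

noncomputable section

namespace Slab

/-! ### Abstract operator theory

Unbounded operators are Mathlib's `LinearPMap`s `H →ₗ.[ℂ] H`.  Mathlib's inner product `⟪x, y⟫_ℂ`
is conjugate-linear in `x` and linear in `y`. -/

section Abstract

universe u v

variable {H : Type u} [NormedAddCommGroup H] [InnerProductSpace ℂ H]
variable {K : Type v} [NormedAddCommGroup K] [InnerProductSpace ℂ K]

/-- The graph of the operator associated with the quadratic form `q[x, z] = ⟨D x, D z⟩`, where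
the (in general unbounded) linear operator `D : H → K` is given by its graph `Γ`: the pair `(x, y)`
belongs to it when `x` is in the form domain and `q[x, z] = ⟨y, z⟩` for all `z` in the form
domain. -/
def formOperatorGraph (Γ : Submodule ℂ (H × K)) : Submodule ℂ (H × H) where
  carrier := {p | ∃ d : K, (p.1, d) ∈ Γ ∧ ∀ q ∈ Γ, ⟪q.2, d⟫_ℂ = ⟪q.1, p.2⟫_ℂ}
  zero_mem' := ⟨0, Γ.zero_mem, fun q _ => by simp⟩
  add_mem' := by
    rintro p p' ⟨d, hd, h⟩ ⟨d', hd', h'⟩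
    exact ⟨d + d', Γ.add_mem hd hd', fun q hq => by
      simp [h q hq, h' q hq]⟩
  smul_mem' := by
    rintro c p ⟨d, hd, h⟩
    exact ⟨c • d, Γ.smul_mem c hd, fun q hq => by simp [h q hq]⟩

/-- The operator associated with the quadratic form `q[x, z] = ⟨D x, D z⟩`, `Γ` being the graph
of `D`.  (For densely defined closed forms the graph above is single-valued, and this is the
nonnegative self-adjoint operator of the representation theorem for closed forms.) -/
def formOperator (Γ : Submodule ℂ (H × K)) : H →ₗ.[ℂ] H :=
  (formOperatorGraph Γ).toLinearPMap

/-- The part of the operator `A` in the subspace `M`: it is defined at those `x ∈ M ∩ dom A` for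
which `A x ∈ M`. -/
def partOf (A : H →ₗ.[ℂ] H) (M : Submodule ℂ H) : M →ₗ.[ℂ] M :=
  (A.graph.comap (M.subtype.prodMap M.subtype)).toLinearPMap

/-- The orthogonal direct sum `A ⊕ B` on the Hilbert sum, with domain `dom A ⊕ dom B`. -/
def directSum (A : H →ₗ.[ℂ] H) (B : K →ₗ.[ℂ] K) :
    WithLp 2 (H × K) →ₗ.[ℂ] WithLp 2 (H × K) where
  domain :=
    { carrier := {x | x.fst ∈ A.domain ∧ x.snd ∈ B.domain}
      zero_mem' := ⟨A.domain.zero_mem, B.domain.zero_mem⟩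
      add_mem' := fun hx hy => ⟨A.domain.add_mem hx.1 hy.1, B.domain.add_mem hx.2 hy.2⟩
      smul_mem' := fun c _ hx => ⟨A.domain.smul_mem c hx.1, B.domain.smul_mem c hx.2⟩ }
  toFun :=
    { toFun := fun x => WithLp.toLp 2 (A ⟨x.1.fst, x.2.1⟩, B ⟨x.1.snd, x.2.2⟩)
      map_add' := fun x y => by
        rw [← WithLp.toLp_add, Prod.mk_add_mk, ← A.map_add, ← B.map_add]
        rfl
      map_smul' := fun c x => by
        rw [RingHom.id_apply, ← WithLp.toLp_smul, Prod.smul_mk, ← A.map_smul, ← B.map_smul]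
        rfl }

/-- The unitary `U` carries `A` to `B`: `U (dom A) = dom B` and `B U = U A` on `dom A`. -/
def Intertwines (U : H ≃ₗᵢ[ℂ] K) (A : H →ₗ.[ℂ] H) (B : K →ₗ.[ℂ] K) : Prop :=
  (∀ x : H, x ∈ A.domain ↔ U x ∈ B.domain) ∧
    ∀ (x : A.domain) (y : B.domain), (y : K) = U x → B y = U (A x)

variable (H) in
/-- Projection-valued measures on the Borel sets of `ℝ` (with value `0` on non-measurable sets):
orthogonal projections, normalized, multiplicative and strongly countably additive. -/
structure ProjMeasure where
  proj : Set ℝ → (H →L[ℂ] H)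
  isProj : ∀ s, (proj s : H →ₗ[ℂ] H).IsSymmetricProjection
  not_measurable : ∀ s, ¬ MeasurableSet s → proj s = 0
  empty : proj ∅ = 0
  univ : proj Set.univ = 1
  inter : ∀ s t, MeasurableSet s → MeasurableSet t → proj (s ∩ t) = proj s * proj t
  iUnion : ∀ s : ℕ → Set ℝ, (∀ i, MeasurableSet (s i)) → Pairwise (Function.onFun Disjoint s) →
    ∀ x : H, HasSum (fun i => proj (s i) x) (proj (⋃ i, s i) x)

namespace ProjMeasure

lemma inner_proj (P : ProjMeasure H) (s : Set ℝ) (x : H) :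
    ⟪x, P.proj s x⟫_ℂ = ((‖P.proj s x‖ ^ 2 : ℝ) : ℂ) := by
  have h1 : P.proj s (P.proj s x) = P.proj s x := by
    have := (P.isProj s).isIdempotentElem
    exact congrArg (fun T : H →ₗ[ℂ] H => T x) this
  have h2 := (P.isProj s).isSymmetric x (P.proj s x)
  simp only [ContinuousLinearMap.coe_coe] at h2
  rw [h1] at h2
  rw [← h2, inner_self_eq_norm_sq_to_K]
  norm_cast

/-- The finite Borel measure `B ↦ ⟨P(B) x, x⟩ = ‖P(B) x‖²`. -/
def measure (P : ProjMeasure H) (x : H) : Measure ℝ :=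
  Measure.ofMeasurable (fun s _ => ENNReal.ofReal (‖P.proj s x‖ ^ 2))
    (by simp [P.empty])
    (by
      intro s hs hd
      have h := (P.iUnion s hs hd x).mapL (innerSL ℂ x)
      simp only [innerSL_apply_apply, inner_proj] at h
      have h' : HasSum (fun i => ‖P.proj (s i) x‖ ^ 2) (‖P.proj (⋃ i, s i) x‖ ^ 2) := by
        exact_mod_cast h
      rw [← h'.tsum_eq, ENNReal.ofReal_tsum_of_nonneg (fun _ => by positivity) h'.summable])

/-- `T = ∫ g dP` for a Borel function `g`: the domain of `T` is `{x : ∫ |g|² dμ_x < ∞}`, where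
`μ_x = ⟨P(·) x, x⟩`, and there `⟨T x, x⟩ = ∫ g dμ_x` and `‖T x‖² = ∫ |g|² dμ_x`. -/
def IsIntegral (P : ProjMeasure H) (g : ℝ → ℂ) (T : H →ₗ.[ℂ] H) : Prop :=
  (∀ x : H, x ∈ T.domain ↔ MemLp g 2 (P.measure x)) ∧
    ∀ x : T.domain, ⟪(x : H), T x⟫_ℂ = ∫ t, g t ∂(P.measure (x : H)) ∧
      ‖T x‖ ^ 2 = ∫ t, ‖g t‖ ^ 2 ∂(P.measure (x : H))

/-- `P` is the spectral measure of `A`, i.e. `A = ∫ t dP(t)`. -/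
def IsSpectralMeasure (P : ProjMeasure H) (A : H →ₗ.[ℂ] H) : Prop :=
  P.IsIntegral (fun t => (t : ℂ)) A

end ProjMeasure

/-- A bounded operator is of trace class: it is an absolutely convergent sum of operators of
rank one. -/
def IsTraceClass (T : H →L[ℂ] H) : Prop :=
  ∃ v w : ℕ → H, Summable (fun j => ‖v j‖ * ‖w j‖) ∧
    ∀ x, HasSum (fun j => ⟪v j, x⟫_ℂ • w j) (T x)

/-- `T` is of trace class and `Tr T = t`, computed in any orthonormal basis. -/
def HasTrace (T : H →L[ℂ] H) (t : ℂ) : Prop :=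
  IsTraceClass T ∧
    ∀ (ι : Type u) (b : HilbertBasis ι ℂ H), HasSum (fun i => ⟪b i, T (b i)⟫_ℂ) t

/-- For a nonnegative self-adjoint operator `A` and a Borel function `f` on `[0, ∞)`: `A` has a
unique spectral measure `P`, and `f(A) = ∫ f dP` is an everywhere defined bounded operator of
trace class, with trace `t`.  (`P` is carried by `[0, ∞)`, so the extension of `f` to `ℝ` is
immaterial.) -/
def HasFunctionTrace (A : H →ₗ.[ℂ] H) (f : ℝ≥0 → ℂ) (t : ℂ) : Prop :=
  (∃! P : ProjMeasure H, P.IsSpectralMeasure A) ∧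
    ∀ P : ProjMeasure H, P.IsSpectralMeasure A →
      ∃ T : H →L[ℂ] H,
        P.IsIntegral (fun s => f s.toNNReal) ((T : H →ₗ[ℂ] H).toPMap ⊤) ∧ HasTrace T t

end Abstract

/-! ### Function spaces on the slab `(ℝ/Lℤ)² × [0, a]`

Points are `(x, y, z)`.  Functions on the slab are functions on the period cell
`(0, L) × (0, L) × (0, a)` with Lebesgue measure; smooth functions on the slab are restrictions of
smooth functions on `ℝ³` that are `L`-periodic in `x` and `y`. -/

abbrev R3 : Type := ℝ × ℝ × ℝ

def cell (L a : ℝ) : Set R3 := Ioo 0 L ×ˢ (Ioo 0 L ×ˢ Ioo 0 a)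

abbrev slabMeasure (L a : ℝ) : Measure R3 := volume.restrict (cell L a)

/-- `L²(Ω)` -/
abbrev L2 (L a : ℝ) : Type := Lp ℂ 2 (slabMeasure L a)

/-- `L²(Ω; ℂ³)` -/
abbrev L2V (L a : ℝ) : Type := PiLp 2 (fun _ : Fin 3 => L2 L a)

/-- Smooth functions, `L`-periodic in the lateral variables. -/
def Smooth (L : ℝ) : Submodule ℂ (R3 → ℂ) where
  carrier := {u | ContDiff ℝ ∞ u ∧ (∀ p, u (p + (L, 0, 0)) = u p) ∧ ∀ p, u (p + (0, L, 0)) = u p}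
  zero_mem' := ⟨contDiff_const, fun _ => rfl, fun _ => rfl⟩
  add_mem' := by
    rintro u v ⟨hu, hu1, hu2⟩ ⟨hv, hv1, hv2⟩
    exact ⟨hu.add hv, fun p => by simp only [Pi.add_apply, hu1, hv1],
      fun p => by simp only [Pi.add_apply, hu2, hv2]⟩
  smul_mem' := by
    rintro c u ⟨hu, hu1, hu2⟩
    exact ⟨contDiff_const.smul hu, fun p => by simp only [Pi.smul_apply, hu1],
      fun p => by simp only [Pi.smul_apply, hu2]⟩

/-- The coordinate directions. -/
def dir : Fin 3 → R3 := ![(1, 0, 0), (0, 1, 0), (0, 0, 1)]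

/-- The partial derivatives `∂_x, ∂_y, ∂_z` (indices `0, 1, 2`). -/
def pd {L : ℝ} (i : Fin 3) : Smooth L →ₗ[ℂ] Smooth L where
  toFun u := ⟨fun p => fderiv ℝ (u : R3 → ℂ) p (dir i), by
    obtain ⟨hu, h1, h2⟩ := u.2
    refine ⟨(hu.fderiv_right (m := ∞) (by simp)).clm_apply contDiff_const, fun p => ?_, fun p => ?_⟩
    · beta_reduce
      rw [← fderiv_comp_add_right]
      simp only [h1]
    · beta_reduce
      rw [← fderiv_comp_add_right]
      simp only [h2]⟩
  map_add' u v := by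
    ext p
    have hu : DifferentiableAt ℝ (u : R3 → ℂ) p := (u.2.1.differentiable (by simp)) p
    have hv : DifferentiableAt ℝ (v : R3 → ℂ) p := (v.2.1.differentiable (by simp)) p
    simp [fderiv_add hu hv]
  map_smul' c u := by
    ext p
    have hu : DifferentiableAt ℝ (u : R3 → ℂ) p := (u.2.1.differentiable (by simp)) p
    simp [fderiv_const_smul hu c]

lemma memLp_smooth {L : ℝ} (a : ℝ) (u : Smooth L) :
    MemLp (u : R3 → ℂ) 2 (slabMeasure L a) := by
  have hc : Continuous (u : R3 → ℂ) := u.2.1.continuous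
  have hK : IsCompact (Icc (0 : ℝ) L ×ˢ (Icc (0 : ℝ) L ×ˢ Icc (0 : ℝ) a)) :=
    isCompact_Icc.prod (isCompact_Icc.prod isCompact_Icc)
  have hsub : cell L a ⊆ Icc (0 : ℝ) L ×ˢ (Icc (0 : ℝ) L ×ˢ Icc (0 : ℝ) a) :=
    prod_mono Ioo_subset_Icc_self (prod_mono Ioo_subset_Icc_self Ioo_subset_Icc_self)
  obtain ⟨C, hC⟩ := hK.exists_bound_of_continuousOn hc.continuousOn
  have hfin : IsFiniteMeasure (slabMeasure L a) :=
    ⟨by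
      rw [Measure.restrict_apply_univ]
      exact (measure_mono hsub).trans_lt hK.measure_lt_top⟩
  have hm : MeasurableSet (cell L a) :=
    measurableSet_Ioo.prod (measurableSet_Ioo.prod measurableSet_Ioo)
  exact MemLp.of_bound hc.aestronglyMeasurable C
    ((ae_restrict_iff' hm).2 (Filter.Eventually.of_forall fun p hp => hC p (hsub hp)))

/-- The class in `L²(Ω)` of a smooth function. -/
def toL2 {L : ℝ} (a : ℝ) : Smooth L →ₗ[ℂ] L2 L a where
  toFun u := (memLp_smooth a u).toLp _
  map_add' _ _ := rfl
  map_smul' _ _ := rfl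

/-- Test functions on `(ℝ/Lℤ)² × (0, a)`: lateral-periodic, smooth, with support compact in the
open interval `(0, a)` in the variable `z`. -/
def Test (L a : ℝ) : Submodule ℂ (Smooth L) where
  carrier := {u | ∃ δ > 0, ∀ p : R3, (p.2.2 < δ ∨ a - δ < p.2.2) → (u : R3 → ℂ) p = 0}
  zero_mem' := ⟨1, one_pos, fun _ _ => rfl⟩
  add_mem' := by
    rintro u v ⟨δ, hδ, hu⟩ ⟨ε, hε, hv⟩
    refine ⟨min δ ε, lt_min hδ hε, fun p hp => ?_⟩
    have h1 : p.2.2 < δ ∨ a - δ < p.2.2 :=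
      hp.imp (fun h => h.trans_le (min_le_left _ _)) fun h => by
        linarith [min_le_left δ ε]
    have h2 : p.2.2 < ε ∨ a - ε < p.2.2 :=
      hp.imp (fun h => h.trans_le (min_le_right _ _)) fun h => by
        linarith [min_le_right δ ε]
    simp [hu p h1, hv p h2]
  smul_mem' := by
    rintro c u ⟨δ, hδ, hu⟩
    exact ⟨δ, hδ, fun p hp => by simp [hu p hp]⟩

/-! ### The Maxwell operator -/

/-- The class in `L²(Ω; ℂ³)` of a smooth vector field. -/
def toL2V {L : ℝ} (a : ℝ) : (Fin 3 → Smooth L) →ₗ[ℂ] L2V L a where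
  toFun F := WithLp.toLp 2 fun i => toL2 a (F i)
  map_add' F G := by ext1 i; simp
  map_smul' c F := by ext1 i; simp

/-- The curl of a smooth vector field, `(∇ × F)_i = ∂_{i+1} F_{i+2} - ∂_{i+2} F_{i+1}` with
cyclic indices. -/
def smoothCurl {L : ℝ} : (Fin 3 → Smooth L) →ₗ[ℂ] (Fin 3 → Smooth L) where
  toFun F := fun i => pd (i + 1) (F (i + 2)) - pd (i + 2) (F (i + 1))
  map_add' F G := by
    funext i
    simp only [Pi.add_apply, map_add]
    abel
  map_smul' c F := by
    funext i
    simp only [Pi.smul_apply, map_smul, RingHom.id_apply, smul_sub]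

/-- `C = ∇ × E` in the sense of distributions. -/
def IsWeakCurl {L a : ℝ} (E C : L2V L a) : Prop :=
  ∀ φ ∈ Test L a, ∀ i : Fin 3,
    ⟪toL2 a φ, C i⟫_ℂ =
      -(⟪toL2 a (pd (i + 1) φ), E (i + 2)⟫_ℂ - ⟪toL2 a (pd (i + 2) φ), E (i + 1)⟫_ℂ)

/-- `∇ · E = 0` in the sense of distributions. -/
def IsDivFree {L a : ℝ} (E : L2V L a) : Prop :=
  ∀ φ ∈ Test L a, -∑ i : Fin 3, ⟪toL2 a (pd i φ), E i⟫_ℂ = 0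

/-- Smooth lateral-periodic vector fields whose tangential components vanish on both plates. -/
def smoothPEC (L a : ℝ) : Submodule ℂ (Fin 3 → Smooth L) where
  carrier := {F | ∀ p : R3, (p.2.2 = 0 ∨ p.2.2 = a) →
    (F 0 : R3 → ℂ) p = 0 ∧ (F 1 : R3 → ℂ) p = 0}
  zero_mem' := fun _ _ => ⟨rfl, rfl⟩
  add_mem' := fun hF hG p hp => by simp [hF p hp, hG p hp]
  smul_mem' := fun c F hF p hp => by simp [hF p hp]

/-- The graph of the weak curl on `H₀(curl)`: the pairs `(E, ∇ × E)` with `E, ∇ × E` in `L²`, in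
the closure, for the graph norm, of the pairs `(F, ∇ × F)` with `F` a smooth field satisfying the
perfect-conductor condition. -/
def curlGraph (L a : ℝ) : Submodule ℂ (L2V L a × L2V L a) where
  carrier := {p | IsWeakCurl p.1 p.2 ∧
    p ∈ ((smoothPEC L a).map ((toL2V a).prod (toL2V a ∘ₗ smoothCurl))).topologicalClosure}
  zero_mem' := ⟨fun φ _ i => by simp, Submodule.zero_mem _⟩
  add_mem' := by
    rintro p q ⟨hp, hp'⟩ ⟨hq, hq'⟩
    refine ⟨fun φ hφ i => ?_, Submodule.add_mem _ hp' hq'⟩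
    simp only [Prod.fst_add, Prod.snd_add, PiLp.add_apply, inner_add_right, hp φ hφ i, hq φ hφ i]
    ring
  smul_mem' := by
    rintro c p ⟨hp, hp'⟩
    refine ⟨fun φ hφ i => ?_, Submodule.smul_mem _ c hp'⟩
    simp only [Prod.smul_fst, Prod.smul_snd, PiLp.smul_apply, inner_smul_right, hp φ hφ i]
    ring

/-- `H₀(curl, Ω)`. -/
def H0curl (L a : ℝ) : Submodule ℂ (L2V L a) := (curlGraph L a).map (LinearMap.fst ℂ _ _)

/-- The form domain `V_PEC = {E ∈ H₀(curl) : ∇ · E = 0}`. -/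
def VPEC (L a : ℝ) : Submodule ℂ (L2V L a) where
  carrier := {E | E ∈ H0curl L a ∧ IsDivFree E}
  zero_mem' := ⟨Submodule.zero_mem _, fun φ _ => by simp⟩
  add_mem' := by
    rintro E F ⟨hE, hE'⟩ ⟨hF, hF'⟩
    refine ⟨Submodule.add_mem _ hE hF, fun φ hφ => ?_⟩
    have h1 := hE' φ hφ
    have h2 := hF' φ hφ
    simp only [PiLp.add_apply, inner_add_right, Finset.sum_add_distrib, neg_add, h1, h2, add_zero]
  smul_mem' := by
    rintro c E ⟨hE, hE'⟩
    refine ⟨Submodule.smul_mem _ c hE, fun φ hφ => ?_⟩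
    have h1 := hE' φ hφ
    simp only [PiLp.smul_apply, inner_smul_right, ← Finset.mul_sum, ← mul_neg, h1, mul_zero]

/-- `H_PEC`, the `L²`-closure of `V_PEC`. -/
def HPEC (L a : ℝ) : Submodule ℂ (L2V L a) := (VPEC L a).topologicalClosure

/-- Constant functions. -/
def constS (L : ℝ) (c : ℂ) : Smooth L := ⟨fun _ => c, contDiff_const, fun _ => rfl, fun _ => rfl⟩

/-- The normalized static normal mode `h₀ = (L² a)^{-1/2} e_z`. -/
def staticMode (L a : ℝ) : L2V L a :=
  toL2V a ![0, 0, constS L (((Real.sqrt (L ^ 2 * a))⁻¹ : ℝ) : ℂ)]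

/-- The reduced physical space `H_phys = H_PEC ⊖ span {h₀}`. -/
def Hphys (L a : ℝ) : Submodule ℂ (L2V L a) := HPEC L a ⊓ (ℂ ∙ staticMode L a)ᗮ

/-- The graph of the curl on the form domain `V_phys = V_PEC ∩ H_phys` of the Maxwell form. -/
def maxwellGraph (L a : ℝ) : Submodule ℂ (Hphys L a × L2V L a) :=
  ((curlGraph L a) ⊓ (VPEC L a).comap (LinearMap.fst ℂ _ _)).comap
    ((Hphys L a).subtype.prodMap LinearMap.id)

/-- The reduced perfect-conductor Maxwell operator: the operator in `H_phys` associated with the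
form `∫ (∇ × E) · conj (∇ × F)` on `V_phys`. -/
def maxwell (L a : ℝ) : Hphys L a →ₗ.[ℂ] Hphys L a := formOperator (maxwellGraph L a)

/-! ### The scalar Laplacians -/

/-- The gradient of a smooth function. -/
def smoothGrad {L : ℝ} : Smooth L →ₗ[ℂ] (Fin 3 → Smooth L) := LinearMap.pi fun i => pd i

/-- The graph of the gradient on `H¹₀`: the closure of the set of pairs `(φ, ∇φ)`, `φ` a test
function.  -/
def dirichletGraph (L a : ℝ) : Submodule ℂ (L2 L a × L2V L a) :=
  ((Test L a).map ((toL2 a).prod (toL2V a ∘ₗ smoothGrad))).topologicalClosure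

/-- The graph of the weak gradient on `H¹`. -/
def neumannGraph (L a : ℝ) : Submodule ℂ (L2 L a × L2V L a) where
  carrier := {p | ∀ φ ∈ Test L a, ∀ i : Fin 3, ⟪toL2 a φ, p.2 i⟫_ℂ = -⟪toL2 a (pd i φ), p.1⟫_ℂ}
  zero_mem' := fun φ _ i => by simp
  add_mem' := by
    intro p q hp hq φ hφ i
    simp only [Prod.fst_add, Prod.snd_add, PiLp.add_apply, inner_add_right, hp φ hφ i, hq φ hφ i]
    ring
  smul_mem' := by
    intro c p hp φ hφ i
    simp only [Prod.smul_fst, Prod.smul_snd, PiLp.smul_apply, inner_smul_right, hp φ hφ i]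
    ring

/-- The positive Dirichlet Laplacian `L_D`, with form `∫ ∇u · conj ∇v` on `H¹₀`. -/
def dirichletLaplacian (L a : ℝ) : L2 L a →ₗ.[ℂ] L2 L a := formOperator (dirichletGraph L a)

/-- The positive Neumann Laplacian `L_N`, with form `∫ ∇u · conj ∇v` on `H¹`. -/
def neumannLaplacian (L a : ℝ) : L2 L a →ₗ.[ℂ] L2 L a := formOperator (neumannGraph L a)

/-! ### Separated modes -/

/-- `k_m = (2π/L) m`, first component. -/
def kx (L : ℝ) (m : ℤ × ℤ) : ℝ := 2 * Real.pi / L * m.1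

/-- `k_m = (2π/L) m`, second component. -/
def ky (L : ℝ) (m : ℤ × ℤ) : ℝ := 2 * Real.pi / L * m.2

/-- `ν_n = π n / a` -/
def nu (a : ℝ) (n : ℕ) : ℝ := Real.pi * n / a

/-- `|k_m|²`, as a point of `[0, ∞)`. -/
def kSq (L : ℝ) (m : ℤ × ℤ) : ℝ≥0 := ⟨kx L m ^ 2 + ky L m ^ 2, by positivity⟩

/-- `ν_n²`, as a point of `[0, ∞)`. -/
def nuSq (a : ℝ) (n : ℕ) : ℝ≥0 := ⟨nu a n ^ 2, by positivity⟩

/-- `|k_m|` -/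
def kAbs (L : ℝ) (m : ℤ × ℤ) : ℝ := Real.sqrt (kSq L m)

/-- `√λ_{m,n}`, where `λ_{m,n} = |k_m|² + ν_n²`. -/
def sqrtLam (L a : ℝ) (m : ℤ × ℤ) (n : ℕ) : ℝ := Real.sqrt (kSq L m + nuSq a n)

/-- `φ_m(x, y) = L⁻¹ exp(i k_m · (x, y))` -/
def phi (L : ℝ) (m : ℤ × ℤ) (x y : ℝ) : ℂ :=
  (1 / L : ℂ) * Complex.exp (Complex.I * (kx L m * x + ky L m * y))

/-- `s_n(z) = √(2/a) sin(ν_n z)` -/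
def sinMode (a : ℝ) (n : ℕ) (z : ℝ) : ℝ := Real.sqrt (2 / a) * Real.sin (nu a n * z)

/-- `c_0(z) = a^{-1/2}` and `c_n(z) = √(2/a) cos(ν_n z)` for `n ≥ 1`. -/
def cosMode (a : ℝ) (n : ℕ) (z : ℝ) : ℝ :=
  if n = 0 then (Real.sqrt a)⁻¹ else Real.sqrt (2 / a) * Real.cos (nu a n * z)

lemma exp_period (L : ℝ) (j : ℤ) (t w : ℂ) :
    Complex.exp (Complex.I * ((2 * Real.pi / L * j : ℝ) * (t + L) + w)) =
      Complex.exp (Complex.I * ((2 * Real.pi / L * j : ℝ) * t + w)) := by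
  by_cases hL : L = 0
  · simp [hL]
  · have hL' : (L : ℂ) ≠ 0 := by exact_mod_cast hL
    rw [Complex.exp_eq_exp_iff_exists_int]
    refine ⟨j, ?_⟩
    push_cast
    field_simp
    ring

lemma separated_mem (L : ℝ) (m : ℤ × ℤ) (g : ℝ → ℝ) (hg : ContDiff ℝ ∞ g) :
    (fun p : R3 => phi L m p.1 p.2.1 * (g p.2.2 : ℂ)) ∈ Smooth L := by
  refine ⟨?_, fun p => ?_, fun p => ?_⟩
  · have h1 : ContDiff ℝ ∞ (fun p : R3 => ((p.1 : ℝ) : ℂ)) :=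
      Complex.ofRealCLM.contDiff.comp contDiff_fst
    have h2 : ContDiff ℝ ∞ (fun p : R3 => ((p.2.1 : ℝ) : ℂ)) :=
      Complex.ofRealCLM.contDiff.comp (contDiff_fst.comp contDiff_snd)
    have h3 : ContDiff ℝ ∞ (fun p : R3 => ((g p.2.2 : ℝ) : ℂ)) :=
      Complex.ofRealCLM.contDiff.comp (hg.comp (contDiff_snd.comp contDiff_snd))
    exact (contDiff_const.mul ((contDiff_const.mul
      ((contDiff_const.mul h1).add (contDiff_const.mul h2))).cexp)).mul h3
  · have := exp_period L m.1 p.1 (ky L m * p.2.1)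
    simp only [phi, kx, Prod.fst_add, Prod.snd_add, add_zero, Complex.ofReal_add]
    rw [this]
  · have := exp_period L m.2 p.2.1 (kx L m * p.1)
    simp only [phi, ky, Prod.fst_add, Prod.snd_add, add_zero, Complex.ofReal_add]
    rw [add_comm, this, add_comm]

lemma contDiff_sinMode (a : ℝ) (n : ℕ) : ContDiff ℝ ∞ (sinMode a n) :=
  contDiff_const.mul (Real.contDiff_sin.comp (contDiff_const.mul contDiff_id))

lemma contDiff_cosMode (a : ℝ) (n : ℕ) : ContDiff ℝ ∞ (cosMode a n) := by
  unfold cosMode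
  split_ifs
  · exact contDiff_const
  · exact contDiff_const.mul (Real.contDiff_cos.comp (contDiff_const.mul contDiff_id))

/-- `d_{m,n} = φ_m s_n` -/
def dirichletMode (L : ℝ) (a : ℝ) (m : ℤ × ℤ) (n : ℕ) : Smooth L :=
  ⟨fun p => phi L m p.1 p.2.1 * (sinMode a n p.2.2 : ℂ),
    separated_mem L m _ (contDiff_sinMode a n)⟩

/-- `u_{m,n} = φ_m c_n` -/
def neumannMode (L : ℝ) (a : ℝ) (m : ℤ × ℤ) (n : ℕ) : Smooth L :=
  ⟨fun p => phi L m p.1 p.2.1 * (cosMode a n p.2.2 : ℂ),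
    separated_mem L m _ (contDiff_cosMode a n)⟩

/-- `E^TE_{m,n} = φ_m s_n k̂^⊥`, with `k̂^⊥ = |k_m|⁻¹ (-k_{m,2}, k_{m,1})`. -/
def modeTE (L a : ℝ) (m : ℤ × ℤ) (n : ℕ) : L2V L a :=
  toL2V a ![((-(ky L m) / kAbs L m : ℝ) : ℂ) • dirichletMode L a m n,
    ((kx L m / kAbs L m : ℝ) : ℂ) • dirichletMode L a m n, 0]

/-- `E^TM_{m,n} = φ_m [-i (ν_n / √λ_{m,n}) k̂ s_n + (|k_m| / √λ_{m,n}) e_z c_n]`, with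
`k̂ = k_m / |k_m|`. -/
def modeTM (L a : ℝ) (m : ℤ × ℤ) (n : ℕ) : L2V L a :=
  toL2V a
    ![(-Complex.I * ((nu a n / sqrtLam L a m n * (kx L m / kAbs L m) : ℝ) : ℂ)) •
        dirichletMode L a m n,
      (-Complex.I * ((nu a n / sqrtLam L a m n * (ky L m / kAbs L m) : ℝ) : ℂ)) •
        dirichletMode L a m n,
      ((kAbs L m / sqrtLam L a m n : ℝ) : ℂ) • neumannMode L a m n]

/-- `E^x_{0,n} = φ_0 s_n e_x` -/
def modeX (L a : ℝ) (n : ℕ) : L2V L a := toL2V a ![dirichletMode L a 0 n, 0, 0]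

/-- `E^y_{0,n} = φ_0 s_n e_y` -/
def modeY (L a : ℝ) (n : ℕ) : L2V L a := toL2V a ![0, dirichletMode L a 0 n, 0]

/-- `E^0_m = φ_m c_0 e_z` -/
def modeNormal (L a : ℝ) (m : ℤ × ℤ) : L2V L a := toL2V a ![0, 0, neumannMode L a m 0]

/-- The reduced Neumann space `H_N' = u_{0,0}^⊥`. -/
def HN' (L a : ℝ) : Submodule ℂ (L2 L a) := (ℂ ∙ toL2 a (neumannMode L a 0 0))ᗮ

/-- `L_N'`, the restriction of `L_N` to `u_{0,0}^⊥`. -/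
def reducedNeumann (L a : ℝ) : HN' L a →ₗ.[ℂ] HN' L a := partOf (neumannLaplacian L a) (HN' L a)

/-- `U (d, 0) = E` -/
def SendsD {L a : ℝ} (U : WithLp 2 (L2 L a × HN' L a) ≃ₗᵢ[ℂ] Hphys L a)
    (d : Smooth L) (E : L2V L a) : Prop :=
  ((U (WithLp.toLp 2 (toL2 a d, 0)) : Hphys L a) : L2V L a) = E

/-- `u ∈ H_N'` and `U (0, u) = E` -/
def SendsN {L a : ℝ} (U : WithLp 2 (L2 L a × HN' L a) ≃ₗᵢ[ℂ] Hphys L a)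
    (u : Smooth L) (E : L2V L a) : Prop :=
  ∃ w : HN' L a, (w : L2 L a) = toL2 a u ∧
    ((U (WithLp.toLp 2 (0, w)) : Hphys L a) : L2V L a) = E

/-- The rules for the unitary on the separated scalar modes: TE/TM modes for `m ≠ 0`, `n ≥ 1`; the
transverse modes for `m = 0`, `n ≥ 1`; the normal branch for `n = 0`, `m ≠ 0`. -/
structure ModeRules {L a : ℝ} (U : WithLp 2 (L2 L a × HN' L a) ≃ₗᵢ[ℂ] Hphys L a) : Prop where
  te : ∀ m n, m ≠ 0 → 1 ≤ n → SendsD U (dirichletMode L a m n) (modeTE L a m n)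
  tm : ∀ m n, m ≠ 0 → 1 ≤ n → SendsN U (neumannMode L a m n) (modeTM L a m n)
  zeroX : ∀ n, 1 ≤ n → SendsD U (dirichletMode L a 0 n) (modeX L a n)
  zeroY : ∀ n, 1 ≤ n → SendsN U (neumannMode L a 0 n) (modeY L a n)
  normal : ∀ m, m ≠ 0 → SendsN U (neumannMode L a m 0) (modeNormal L a m)

end Slab

end

/-! All three operators come from closed forms, and each space has an explicit orthonormal basis of
weak eigenvectors, the separated modes, with eigenvalues `|k_m|² + ν_n²`. By
`formOperator_isDiagonal` this already determines the operator together with its maximal domain: it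
is multiplication by the eigenvalues on the coefficients. Operators with the same eigenvalues under
the same labels are then carried into each other by the unitary that matches the bases
(`basisEquiv_intertwines`).

The labels match for the following reason. For `n ≥ 1` a field with Fourier label `(m, n)` has three
amplitudes, on `d e_x`, `d e_y` and `u e_z`. The divergence constraint is one linear relation, so
two polarizations remain: one is paired with `d_{m,n}`, the other with `u_{m,n}`. For `n = 0` the
sines vanish and only `u_{m,0} e_z` is left, which is automatically solenoidal and is paired with
`u_{m,0}`; at `m = 0` it is the static mode, removed from one side exactly as `u_{0,0}` is removed
from the other. On solenoidal fields curl curl is `-Δ`, so the eigenvalues agree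
(`smoothCurl_smoothCurl_sepField`).

Analysis enters at two points. Completeness of the modes comes from uniqueness of Fourier
coefficients, after odd or even reflection in `z` (`ae_eq_zero_of_fourier`). The weak identities are
given only for test functions, and are extended to the modes by cutting off near the plates; when
the normal derivative is involved this works for sine modes because they vanish there
(`tendsto_pd_two_cutSep`).

For the traces, a diagonal operator has an atomic spectral measure, which is unique because
eigenvectors have zero spectral variance (`proj_compl_eigenvector`). Hence `f(A)` is the bounded
multiplier `f(λ)`, and its trace is the absolutely convergent sum of its eigenvalues, in every
orthonormal basis (`hasTrace_of_diagonal`). The identity of traces is then the splitting of the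
label set. -/

noncomputable section

namespace Slab

/-! ### Operators that are diagonal in a Hilbert basis -/

section Diagonal

universe u v w

variable {H : Type u} [NormedAddCommGroup H] [InnerProductSpace ℂ H]
variable {K : Type v} [NormedAddCommGroup K] [InnerProductSpace ℂ K]
variable {ι : Type w}

/-- The operator `A` is diagonal in the Hilbert basis `b` with eigenvalues `c i`, on its maximal
domain. -/
def IsDiagonal (A : H →ₗ.[ℂ] H) (b : HilbertBasis ι ℂ H) (c : ι → ℂ) : Prop :=
  ∀ x y, (x, y) ∈ A.graph ↔ ∀ i, ⟪b i, y⟫_ℂ = c i * ⟪b i, x⟫_ℂ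

lemma basis_ext (b : HilbertBasis ι ℂ H) {x y : H} (h : ∀ i, ⟪b i, x⟫_ℂ = ⟪b i, y⟫_ℂ) : x = y := by
  apply b.repr.injective
  ext i
  rw [b.repr_apply_apply, b.repr_apply_apply, h i]

lemma inner_self_eq_ofReal (x : H) : ⟪x, x⟫_ℂ = ((‖x‖ ^ 2 : ℝ) : ℂ) := by
  rw [inner_self_eq_norm_sq_to_K]
  norm_cast

lemma hasSum_normSq_inner (b : HilbertBasis ι ℂ H) (x : H) :
    HasSum (fun i => ‖⟪b i, x⟫_ℂ‖ ^ 2) (‖x‖ ^ 2) := by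
  have h := b.hasSum_inner_mul_inner x x
  have h2 : ∀ i, ⟪x, b i⟫_ℂ * ⟪b i, x⟫_ℂ = ((‖⟪b i, x⟫_ℂ‖ ^ 2 : ℝ) : ℂ) := fun i => by
    rw [← inner_conj_symm, Complex.conj_mul']
    norm_cast
  simp only [h2, inner_self_eq_ofReal] at h
  exact_mod_cast h

lemma exists_inner_eq (b : HilbertBasis ι ℂ H) (c : ι → ℂ) (hc : Summable fun i => ‖c i‖ ^ 2) :
    ∃ y : H, ∀ i, ⟪b i, y⟫_ℂ = c i := by
  have hm : Memℓp c 2 := by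
    rw [memℓp_gen_iff (by norm_num)]
    simpa using hc
  exact ⟨b.repr.symm ⟨c, hm⟩, fun i => by rw [← b.repr_apply_apply]; simp⟩

lemma exists_diagonal (b : HilbertBasis ι ℂ H) (c : ι → ℂ) (C : ℝ) (hc : ∀ i, ‖c i‖ ≤ C) :
    ∃ T : H →L[ℂ] H, ∀ x i, ⟪b i, T x⟫_ℂ = c i * ⟪b i, x⟫_ℂ := by
  have hb : ∀ x i, ‖c i * ⟪b i, x⟫_ℂ‖ ^ 2 ≤ C ^ 2 * ‖⟪b i, x⟫_ℂ‖ ^ 2 := fun x i => by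
    rw [norm_mul, mul_pow]
    gcongr
    exact hc i
  have hs : ∀ x, ∃ y : H, ∀ i, ⟪b i, y⟫_ℂ = c i * ⟪b i, x⟫_ℂ := fun x =>
    exists_inner_eq b _ (((hasSum_normSq_inner b x).summable.mul_left (C ^ 2)).of_nonneg_of_le
      (fun _ => by positivity) (hb x))
  choose T hT using hs
  refine ⟨LinearMap.mkContinuous ⟨⟨T, fun x y => ?_⟩, fun r x => ?_⟩ |C| fun x => ?_, hT⟩
  · exact basis_ext b fun i => by simp only [inner_add_right, hT]; ring
  · exact basis_ext b fun i => by
      simp only [inner_smul_right, hT, RingHom.id_apply]; ring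
  · refine abs_le_of_sq_le_sq' ?_ (by positivity) |>.2
    rw [mul_pow, sq_abs]
    have h1 := hasSum_normSq_inner b (T x)
    simp only [hT] at h1
    exact hasSum_le (hb x) h1 ((hasSum_normSq_inner b x).mul_left _)

lemma isDiagonal_toPMap (b : HilbertBasis ι ℂ H) (c : ι → ℂ) (T : H →L[ℂ] H)
    (hT : ∀ x i, ⟪b i, T x⟫_ℂ = c i * ⟪b i, x⟫_ℂ) :
    IsDiagonal ((T : H →ₗ[ℂ] H).toPMap ⊤) b c := by
  intro x y
  rw [LinearPMap.mem_graph_iff]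
  constructor
  · rintro ⟨z, hz, hy⟩ i
    simp only at hz hy
    subst hz hy
    exact hT _ _
  · intro h
    exact ⟨⟨x, trivial⟩, rfl, basis_ext b fun i => (hT x i).trans (h i).symm⟩

/-- Some `v i` may vanish, so the Hilbert space criterion is applied to the mutually orthogonal
lines they span rather than to a normalized family. -/
lemma summable_of_pairwise_orthogonal [CompleteSpace K] (v : ι → K)
    (hv : Pairwise fun i j => ⟪v i, v j⟫_ℂ = 0) (hs : Summable fun i => ‖v i‖ ^ 2) :
    Summable v := by
  have ho : OrthogonalFamily ℂ (fun i => (ℂ ∙ v i : Submodule ℂ K)) fun i =>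
      (ℂ ∙ v i : Submodule ℂ K).subtypeₗᵢ := by
    apply OrthogonalFamily.of_pairwise
    intro i j hij
    change (ℂ ∙ v i) ⟂ (ℂ ∙ v j)
    rw [Submodule.isOrtho_span]
    simpa using hv hij
  have := (ho.summable_iff_norm_sq_summable
    (fun i => (⟨v i, Submodule.mem_span_singleton_self _⟩ : (ℂ ∙ v i : Submodule ℂ K)))).2
    (by simpa using hs)
  simpa using this

lemma mem_of_hasSum {E : Type*} [AddCommGroup E] [Module ℂ E] [TopologicalSpace E]
    {Γ : Submodule ℂ E} (hΓ : IsClosed (Γ : Set E)) {f : ι → E} {x : E} (h : HasSum f x)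
    (hf : ∀ i, f i ∈ Γ) : x ∈ Γ :=
  hΓ.mem_of_tendsto h (Filter.Eventually.of_forall fun _ => Γ.sum_mem fun i _ => hf i)

/-- The operator of a closed form is diagonal as soon as a Hilbert basis of the space consists of
weak eigenvectors of the form. -/
theorem formOperator_isDiagonal [CompleteSpace K] (Γ : Submodule ℂ (H × K))
    (hΓ : IsClosed (Γ : Set (H × K))) (b : HilbertBasis ι ℂ H) (lam : ι → ℝ≥0) (d : ι → K)
    (hd : ∀ i, (b i, d i) ∈ Γ)
    (hw : ∀ i, ∀ q ∈ Γ, ⟪d i, q.2⟫_ℂ = ((lam i : ℝ) : ℂ) * ⟪b i, q.1⟫_ℂ) :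
    IsDiagonal (formOperator Γ) b fun i => ((lam i : ℝ) : ℂ) := by
  classical
  have key : ∀ x y, (x, y) ∈ formOperatorGraph Γ ↔
      ∀ i, ⟪b i, y⟫_ℂ = ((lam i : ℝ) : ℂ) * ⟪b i, x⟫_ℂ := by
    intro x y
    constructor
    · rintro ⟨e, he, h⟩ i
      exact (h _ (hd i)).symm.trans (hw i _ he)
    · intro h
      -- Testing the weak eigenvector equation of `b i` against `(b j, d j)` itself makes the `d i`
      -- orthogonal, with `‖d i‖² = λ i`.
      have hort : ∀ i j, ⟪d i, d j⟫_ℂ = if i = j then ((lam i : ℝ) : ℂ) else 0 := fun i j => by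
        rw [hw i _ (hd j), orthonormal_iff_ite.1 b.orthonormal]
        simp
      have hnorm : ∀ i, ‖d i‖ ^ 2 = lam i := fun i => by
        have := hort i i
        rw [inner_self_eq_ofReal, if_pos rfl] at this
        exact_mod_cast this
      have hs : Summable fun i => ⟪b i, x⟫_ℂ • d i := by
        apply summable_of_pairwise_orthogonal
        · intro i j hij
          rw [inner_smul_left, inner_smul_right, hort, if_neg hij]
          simp
        · have h1 := (hasSum_normSq_inner b x).summable
          have h2 := (hasSum_normSq_inner b y).summable
          refine (h1.add h2).of_nonneg_of_le (fun _ => by positivity) fun i => ?_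
          rw [norm_smul, mul_pow, hnorm, h i, norm_mul, mul_pow, Complex.norm_real,
            Real.norm_eq_abs, sq_abs]
          -- The terms have squared norm `λ |x_i|²`, at most `|x_i|² + λ² |x_i|² = |x_i|² + |y_i|²`,
          -- which is summable because `x` and `y` both lie in `H`.
          have : (lam i : ℝ) ≤ 1 + (lam i : ℝ) ^ 2 := by nlinarith [sq_nonneg ((lam i : ℝ) - 1)]
          nlinarith [mul_le_mul_of_nonneg_left this (sq_nonneg ‖⟪b i, x⟫_ℂ‖)]
      obtain ⟨e, he⟩ := hs
      have hx : HasSum (fun i => ⟪b i, x⟫_ℂ • b i) x := by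
        simpa only [b.repr_apply_apply] using b.hasSum_repr x
      -- Closedness of the form puts `(x, e)` in `Γ`; the form identity for `e` is then Parseval's
      -- formula, coefficient by coefficient.
      refine ⟨e, mem_of_hasSum hΓ (hx.prodMk he) fun i => Γ.smul_mem _ (hd i), fun q hq => ?_⟩
      have h1 := he.mapL (innerSL ℂ q.2)
      simp only [innerSL_apply_apply, inner_smul_right] at h1
      have h2 := b.hasSum_inner_mul_inner q.1 y
      refine h1.unique (h2.congr_fun ?_)
      intro i
      rw [h i, ← inner_conj_symm q.2, hw i q hq, ← inner_conj_symm q.1 (b i), map_mul,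
        Complex.conj_ofReal]
      ring
  intro x y
  rw [formOperator, Submodule.toLinearPMap_graph_eq, key]
  -- Single-valuedness of the graph, without which `toLinearPMap` would not have it as its graph:
  -- for `x = 0` all coefficients of `y` vanish.
  rintro ⟨x, y⟩ hxy hx
  simp only at hx
  subst hx
  exact basis_ext b fun i => by simpa using (key _ _).1 hxy i

/-! ### Spectral measures of diagonal operators -/

namespace ProjMeasure

lemma ext_proj {P Q : ProjMeasure H} (h : ∀ s, MeasurableSet s → ∀ x, P.proj s x = Q.proj s x) :
    P = Q := by
  have h' : P.proj = Q.proj := by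
    funext s
    by_cases hs : MeasurableSet s
    · exact ContinuousLinearMap.ext (h s hs)
    · rw [P.not_measurable s hs, Q.not_measurable s hs]
  cases P
  cases Q
  simpa using h'

lemma measure_apply (P : ProjMeasure H) (x : H) {s : Set ℝ} (hs : MeasurableSet s) :
    P.measure x s = ENNReal.ofReal (‖P.proj s x‖ ^ 2) :=
  Measure.ofMeasurable_apply s hs

instance isFiniteMeasure_measure (P : ProjMeasure H) (x : H) : IsFiniteMeasure (P.measure x) :=
  ⟨by rw [P.measure_apply x .univ]; exact ENNReal.ofReal_lt_top⟩

/-- The first two moments of the spectral measure of an eigenvector are those of a point mass at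
`r`, so its variance about `r` is zero and it is carried by `{r}`. -/
lemma proj_compl_eigenvector {P : ProjMeasure H} {A : H →ₗ.[ℂ] H} (hP : P.IsSpectralMeasure A)
    {x : H} {r : ℝ} (hx : (x, (r : ℂ) • x) ∈ A.graph) : P.proj {r}ᶜ x = 0 := by
  rw [LinearPMap.mem_graph_iff] at hx
  obtain ⟨y, rfl, hy⟩ := hx
  simp only at hy
  have hL := (hP.1 y).1 y.2
  obtain ⟨h1, h2⟩ := hP.2 y
  rw [hy] at h1 h2
  set μ := P.measure (y : H) with hμ
  have htot : μ.real Set.univ = ‖(y : H)‖ ^ 2 := by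
    rw [Measure.real, hμ, P.measure_apply _ .univ, P.univ, ENNReal.toReal_ofReal (by positivity)]
    simp
  have hint1 : Integrable (fun t : ℝ => t) μ := by
    have := (hL.integrable (by norm_num)).re
    simpa using this
  have hint2 : Integrable (fun t : ℝ => t ^ 2) μ := by
    have := hL.integrable_norm_pow (by norm_num)
    simpa using this
  have e1 : ∫ t, t ∂μ = r * ‖(y : H)‖ ^ 2 := by
    rw [inner_smul_right, inner_self_eq_ofReal] at h1
    have h1' := h1.trans (integral_complex_ofReal (f := fun t : ℝ => t))
    rw [eq_comm]
    exact_mod_cast h1'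
  have e2 : ∫ t, t ^ 2 ∂μ = r ^ 2 * ‖(y : H)‖ ^ 2 := by
    simp only [norm_smul, mul_pow, Complex.norm_real, Real.norm_eq_abs, sq_abs] at h2
    exact h2.symm
  have e3 : ∫ t, (t - r) ^ 2 ∂μ = 0 := by
    have : ∀ t : ℝ, (t - r) ^ 2 = t ^ 2 - (2 * r) * t + r ^ 2 := fun t => by ring
    simp only [this]
    rw [integral_add (f := fun t => t ^ 2 - 2 * r * t) (hint2.sub (hint1.const_mul _))
      (integrable_const _), integral_sub hint2 (hint1.const_mul _), integral_const_mul, integral_const, e1, e2, htot]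
    simp only [smul_eq_mul]
    ring
  have hint3 : Integrable (fun t : ℝ => (t - r) ^ 2) μ := by
    have : (fun t : ℝ => (t - r) ^ 2) = fun t => t ^ 2 - (2 * r) * t + r ^ 2 := by
      funext t
      ring
    rw [this]
    exact (hint2.sub (hint1.const_mul _)).add (integrable_const _)
  rw [integral_eq_zero_iff_of_nonneg (fun t => sq_nonneg _) hint3] at e3
  have hz : μ {r}ᶜ = 0 := by
    refine measure_mono_null (fun t ht => ?_) (ae_iff.1 e3)
    simpa [sub_eq_zero] using ht
  rw [hμ, P.measure_apply _ (measurableSet_singleton r).compl, ENNReal.ofReal_eq_zero] at hz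
  exact norm_eq_zero.1 (pow_eq_zero_iff two_ne_zero |>.1 (le_antisymm hz (by positivity)))

lemma proj_eigenvector {P : ProjMeasure H} {A : H →ₗ.[ℂ] H} (hP : P.IsSpectralMeasure A)
    {x : H} {r : ℝ} (hx : (x, (r : ℂ) • x) ∈ A.graph) {s : Set ℝ} (hs : MeasurableSet s) :
    P.proj s x = s.indicator (fun _ => x) r := by
  have h0 := proj_compl_eigenvector hP hx
  have hsub : ∀ t, MeasurableSet t → r ∉ t → P.proj t x = 0 := fun t ht hr => by
    have : t = t ∩ {r}ᶜ := by
      ext z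
      simp only [mem_inter_iff, mem_compl_iff, mem_singleton_iff]
      exact ⟨fun h => ⟨h, fun h' => hr (h' ▸ h)⟩, fun h => h.1⟩
    rw [this, P.inter _ _ ht (measurableSet_singleton r).compl, mul_apply_eq_comp, h0,
      map_zero]
  by_cases hr : r ∈ s
  · rw [indicator_of_mem hr]
    -- Finite additivity is extracted from countable additivity by padding `s`, `sᶜ` with empty
    -- sets; `P(sᶜ) x = 0` because `r ∉ sᶜ`.
    have hd : Pairwise (Function.onFun Disjoint fun i : ℕ => if i = 0 then s else if i = 1 then
        sᶜ else ∅) := by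
      intro i j hij
      simp only [Function.onFun]
      split_ifs <;> simp_all [disjoint_compl_right, disjoint_compl_left]
    have hm : ∀ i : ℕ, MeasurableSet (if i = 0 then s else if i = 1 then sᶜ else ∅) := fun i => by
      split_ifs
      exacts [hs, hs.compl, .empty]
    have h := P.iUnion _ hm hd x
    have hU : (⋃ i : ℕ, if i = 0 then s else if i = 1 then sᶜ else ∅) = Set.univ := by
      refine eq_univ_of_forall fun z => mem_iUnion.2 ?_
      by_cases hz : z ∈ s
      · exact ⟨0, by simpa using hz⟩
      · exact ⟨1, by simpa using hz⟩
    rw [hU, P.univ] at h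
    have h' : HasSum (fun i : ℕ => P.proj (if i = 0 then s else if i = 1 then sᶜ else ∅) x)
        (P.proj s x) := by
      have := hasSum_single (f := fun i : ℕ =>
        P.proj (if i = 0 then s else if i = 1 then sᶜ else ∅) x) 0 (fun i hi => by
          by_cases hi1 : i = 1
          · simpa [hi, hi1] using hsub _ hs.compl (by simpa using hr)
          · simp [hi, hi1, P.empty])
      simpa using this
    exact h'.unique h
  · rw [indicator_of_notMem hr, hsub s hs hr]

/-- Any spectral measure is forced on the eigenvectors `b i`, and these are total. -/
lemma eq_of_isDiagonal {A : H →ₗ.[ℂ] H} {b : HilbertBasis ι ℂ H} {lam : ι → ℝ}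
    (hA : IsDiagonal A b fun i => (lam i : ℂ)) {P Q : ProjMeasure H}
    (hP : P.IsSpectralMeasure A) (hQ : Q.IsSpectralMeasure A) : P = Q := by
  classical
  have hb : ∀ i, (b i, (lam i : ℂ) • b i) ∈ A.graph := fun i => by
    rw [hA]
    intro j
    rw [inner_smul_right, orthonormal_iff_ite.1 b.orthonormal]
    by_cases h : j = i <;> simp [h]
  refine ext_proj fun s hs x => ?_
  have hx : HasSum (fun i => ⟪b i, x⟫_ℂ • b i) x := by
    simpa only [b.repr_apply_apply] using b.hasSum_repr x
  have h1 := hx.mapL (P.proj s)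
  have h2 := hx.mapL (Q.proj s)
  simp only [map_smul, proj_eigenvector hP (hb _) hs] at h1
  simp only [map_smul, proj_eigenvector hQ (hb _) hs] at h2
  exact h1.unique h2

end ProjMeasure

end Diagonal

/-! ### Spectral measure, Borel calculus and trace of a diagonal operator -/

section DiagonalCalculus

universe u v w

variable {H : Type u} [NormedAddCommGroup H] [InnerProductSpace ℂ H]
variable {K : Type v} [NormedAddCommGroup K] [InnerProductSpace ℂ K]
variable {ι : Type w}

lemma indicator_norm_le (s : Set ℝ) (t : ℝ) : ‖s.indicator (1 : ℝ → ℂ) t‖ ≤ 1 := by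
  by_cases h : t ∈ s <;> simp [h]

/-- The orthogonal projection onto the closed span of the basis vectors with `lam i ∈ s`. -/
def diagProj (b : HilbertBasis ι ℂ H) (lam : ι → ℝ) (s : Set ℝ) : H →L[ℂ] H :=
  (exists_diagonal b (fun i => s.indicator 1 (lam i)) 1 fun _ => indicator_norm_le s _).choose

lemma inner_diagProj (b : HilbertBasis ι ℂ H) (lam : ι → ℝ) (s : Set ℝ) (x : H) (i : ι) :
    ⟪b i, diagProj b lam s x⟫_ℂ = s.indicator 1 (lam i) * ⟪b i, x⟫_ℂ :=
  (exists_diagonal b (fun i => s.indicator 1 (lam i)) 1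
    fun _ => indicator_norm_le s _).choose_spec x i

lemma inner_diagProj_comm (b : HilbertBasis ι ℂ H) (lam : ι → ℝ) (s : Set ℝ) (x y : H) :
    ⟪diagProj b lam s x, y⟫_ℂ = ⟪x, diagProj b lam s y⟫_ℂ := by
  refine (b.hasSum_inner_mul_inner _ _).unique ((b.hasSum_inner_mul_inner _ _).congr_fun ?_)
  intro i
  rw [← inner_conj_symm _ (b i), inner_diagProj, inner_diagProj, ← inner_conj_symm x (b i)]
  by_cases h : lam i ∈ s <;> simp [h]

lemma hasSum_diagProj (b : HilbertBasis ι ℂ H) (lam : ι → ℝ) (s : Set ℝ) (x : H) :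
    HasSum (fun i : {i // lam i ∈ s} => ⟪b i, x⟫_ℂ • b i) (diagProj b lam s x) := by
  have h := b.hasSum_repr (diagProj b lam s x)
  simp only [b.repr_apply_apply, inner_diagProj] at h
  have h2 := (hasSum_subtype_iff_indicator (f := fun i => ⟪b i, x⟫_ℂ • b i)
    (s := {i | lam i ∈ s}) (a := diagProj b lam s x)).2 (h.congr_fun fun i => by
      by_cases hi : lam i ∈ s <;> simp [hi])
  exact h2

/-- Both sides are the same unconditionally convergent expansion: disjointness lets the labels with
eigenvalue in the union be regrouped according to the set that contains the eigenvalue. -/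
lemma hasSum_diagProj_iUnion (b : HilbertBasis ι ℂ H) (lam : ι → ℝ) (s : ℕ → Set ℝ)
    (hs : Pairwise (Function.onFun Disjoint s)) (x : H) :
    HasSum (fun n => diagProj b lam (s n) x) (diagProj b lam (⋃ n, s n) x) := by
  have h := hasSum_diagProj b lam (⋃ n, s n) x
  let e : (Σ n, {i // lam i ∈ s n}) ≃ {i // lam i ∈ ⋃ n, s n} :=
    Equiv.ofBijective (fun p => ⟨p.2.1, mem_iUnion.2 ⟨p.1, p.2.2⟩⟩) (by
      constructor
      · rintro ⟨n, i, hi⟩ ⟨n', i', hi'⟩ hh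
        obtain rfl : i = i' := congrArg Subtype.val hh
        obtain rfl : n = n' := by
          by_contra hne
          exact (hs hne).le_bot ⟨hi, hi'⟩
        rfl
      · rintro ⟨i, hi⟩
        obtain ⟨n, hn⟩ := mem_iUnion.1 hi
        exact ⟨⟨n, i, hn⟩, rfl⟩)
  exact ((e.hasSum_iff (f := fun i : {i // lam i ∈ ⋃ n, s n} => ⟪b i, x⟫_ℂ • b i)).2 h).sigma
    fun n => hasSum_diagProj b lam (s n) x

open Classical in
/-- The spectral measure of the operator with eigenvalues `lam i` in the basis `b`. -/
def diagMeasure (b : HilbertBasis ι ℂ H) (lam : ι → ℝ) : ProjMeasure H where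
  proj s := if MeasurableSet s then diagProj b lam s else 0
  isProj s := by
    split_ifs with hs
    · refine ⟨?_, fun x y => inner_diagProj_comm b lam s x y⟩
      refine LinearMap.ext fun x => basis_ext b fun i => ?_
      change ⟪b i, diagProj b lam s (diagProj b lam s x)⟫_ℂ = ⟪b i, diagProj b lam s x⟫_ℂ
      simp only [inner_diagProj]
      by_cases h : lam i ∈ s <;> simp [h]
    · exact ⟨by simp [IsIdempotentElem], fun x y => by simp⟩
  not_measurable s hs := if_neg hs
  empty := by
    rw [if_pos .empty]
    exact ContinuousLinearMap.ext fun x => basis_ext b fun i => by simp [inner_diagProj]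
  univ := by
    rw [if_pos .univ]
    exact ContinuousLinearMap.ext fun x => basis_ext b fun i => by simp [inner_diagProj]
  inter s t hs ht := by
    rw [if_pos hs, if_pos ht, if_pos (hs.inter ht)]
    refine ContinuousLinearMap.ext fun x => basis_ext b fun i => ?_
    rw [mul_apply_eq_comp]
    simp only [inner_diagProj]
    by_cases h : lam i ∈ s <;> by_cases h' : lam i ∈ t <;> simp [h, h']
  iUnion s hs hd x := by
    rw [if_pos (.iUnion hs)]
    simpa only [if_pos (hs _)] using hasSum_diagProj_iUnion b lam s hd x

/-- This atomic form turns every spectral integral below into a sum over the eigenvalues. -/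
lemma measure_diagMeasure (b : HilbertBasis ι ℂ H) (lam : ι → ℝ) (x : H) :
    (diagMeasure b lam).measure x =
      Measure.sum fun i => ENNReal.ofReal (‖⟪b i, x⟫_ℂ‖ ^ 2) • Measure.dirac (lam i) := by
  ext s hs
  rw [ProjMeasure.measure_apply _ _ hs, Measure.sum_apply _ hs]
  have h := hasSum_normSq_inner b (diagProj b lam s x)
  have hp : (diagMeasure b lam).proj s = diagProj b lam s := if_pos hs
  rw [hp, ← h.tsum_eq, ENNReal.ofReal_tsum_of_nonneg (fun _ => by positivity) h.summable]
  refine tsum_congr fun i => ?_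
  rw [inner_diagProj]
  by_cases hi : lam i ∈ s <;> simp [hi, Measure.dirac_apply' _ hs]

variable [Countable ι]

lemma memLp_diagMeasure_iff (b : HilbertBasis ι ℂ H) (lam : ι → ℝ) {g : ℝ → ℂ}
    (hg : Measurable g) (x : H) :
    MemLp g 2 ((diagMeasure b lam).measure x) ↔
      Summable fun i => ‖g (lam i) * ⟪b i, x⟫_ℂ‖ ^ 2 := by
  rw [memLp_two_iff_integrable_sq_norm hg.aestronglyMeasurable, measure_diagMeasure,
    integrable_sum_dirac_iff fun _ => ENNReal.ofReal_ne_top]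
  refine summable_congr fun i => ?_
  rw [ENNReal.toReal_ofReal (by positivity), norm_mul, mul_pow, norm_pow, norm_norm, mul_comm]

/-- Square integrability of `g` is square summability of the numbers `g(λ i) ⟨b i, x⟩`. By
maximality of the domain in `IsDiagonal` this is equivalent to `x ∈ dom T`; the two integral
identities are Parseval's formula for `⟨x, T x⟩` and `‖T x‖²`. -/
lemma isIntegral_diagMeasure {b : HilbertBasis ι ℂ H} {lam : ι → ℝ} {g : ℝ → ℂ}
    (hg : Measurable g) {T : H →ₗ.[ℂ] H} (hT : IsDiagonal T b fun i => g (lam i)) :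
    (diagMeasure b lam).IsIntegral g T := by
  refine ⟨fun x => ?_, fun x => ?_⟩
  · rw [memLp_diagMeasure_iff b lam hg]
    constructor
    · intro hx
      have := (hT x (T ⟨x, hx⟩)).1 (T.mem_graph ⟨x, hx⟩)
      simpa only [← this] using (hasSum_normSq_inner b (T ⟨x, hx⟩)).summable
    · intro hs
      obtain ⟨y, hy⟩ := exists_inner_eq b _ hs
      exact LinearPMap.mem_domain_of_mem_graph ((hT x y).2 hy)
  · have hx := (hT x (T x)).1 (T.mem_graph x)
    have h2 := hasSum_normSq_inner b (T x)
    have hint : ∀ i, (ENNReal.ofReal (‖⟪b i, (x : H)⟫_ℂ‖ ^ 2)) ≠ ⊤ := fun _ =>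
      ENNReal.ofReal_ne_top
    rw [measure_diagMeasure]
    constructor
    · rw [integral_sum_dirac hint]
      have h := b.hasSum_inner_mul_inner (x : H) (T x)
      refine (h.congr_fun fun i => ?_).tsum_eq.symm
      rw [hx i, ENNReal.toReal_ofReal (by positivity), ← inner_conj_symm (x : H) (b i),
        Complex.real_smul, Complex.ofReal_pow, ← Complex.conj_mul']
      ring
    · rw [integral_sum_dirac hint]
      refine (h2.congr_fun fun i => ?_).tsum_eq.symm
      rw [hx i, ENNReal.toReal_ofReal (by positivity), norm_mul, mul_pow, smul_eq_mul, mul_comm]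

/-- Independence of the basis `e` is Fubini for the double family `c i |⟨e k, b i⟩|²`: summing over
`k` first gives `c i`, since `‖b i‖ = 1`, and summing over `i` first gives `⟨e k, T e k⟩`. -/
lemma hasTrace_of_diagonal [Infinite ι] (b : HilbertBasis ι ℂ H) (c : ι → ℂ)
    (hc : Summable fun i => ‖c i‖) (T : H →L[ℂ] H)
    (hT : ∀ x i, ⟪b i, T x⟫_ℂ = c i * ⟪b i, x⟫_ℂ) : HasTrace T (∑' i, c i) := by
  constructor
  -- The label set is countable and infinite, so the diagonal expansion can be listed along `ℕ` as
  -- the definition of trace class asks.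
  · obtain ⟨e⟩ : Nonempty (ℕ ≃ ι) := by
      obtain ⟨h⟩ := nonempty_denumerable ι
      exact ⟨(Denumerable.eqv ι).symm⟩
    refine ⟨fun j => b (e j), fun j => c (e j) • b (e j), ?_, fun x => ?_⟩
    · have : ∀ i, ‖b i‖ = 1 := b.orthonormal.norm_eq_one
      simpa [norm_smul, this, Function.comp_def] using hc.comp_injective e.injective
    · have h := b.hasSum_repr (T x)
      simp only [b.repr_apply_apply, hT] at h
      refine (e.hasSum_iff.2 h).congr_fun fun j => ?_
      simp only [Function.comp, smul_smul, mul_comm]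
  · intro κ e
    have hbn : ∀ i, HasSum (fun k => ‖⟪e k, b i⟫_ℂ‖ ^ 2) 1 := fun i => by
      simpa [b.orthonormal.norm_eq_one] using hasSum_normSq_inner e (b i)
    let F : ι × κ → ℂ := fun p => c p.1 * ((‖⟪e p.2, b p.1⟫_ℂ‖ ^ 2 : ℝ) : ℂ)
    have hn : ∀ p, ‖F p‖ = ‖c p.1‖ * ‖⟪e p.2, b p.1⟫_ℂ‖ ^ 2 := fun p => by
      simp only [F]
      rw [norm_mul, Complex.norm_real, Real.norm_of_nonneg (by positivity)]
    have hF : Summable F := by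
      refine Summable.of_norm ?_
      rw [summable_prod_of_nonneg fun _ => norm_nonneg _]
      simp only [hn]
      refine ⟨fun i => (hbn i).summable.mul_left _, ?_⟩
      simpa only [tsum_mul_left, (hbn _).tsum_eq, mul_one] using hc
    have h1 : HasSum F (∑' i, c i) := by
      have h := hF.hasSum.prod_fiberwise (f := F) (g := c) fun i => by
        have := (Complex.hasSum_ofReal.2 (hbn i)).mul_left (c i)
        simpa [F] using this
      rw [h.tsum_eq]
      exact hF.hasSum
    have h2 := ((Equiv.prodComm κ ι).hasSum_iff.2 h1).prod_fiberwise
      (g := fun k => ⟪e k, T (e k)⟫_ℂ) fun k => by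
        refine (b.hasSum_inner_mul_inner (e k) (T (e k))).congr_fun fun i => ?_
        simp only [Function.comp, Equiv.prodComm_apply, Prod.swap, F, hT]
        rw [← inner_conj_symm (b i) (e k), Complex.ofReal_pow, ← Complex.mul_conj']
        ring
    exact h2

/-- Spectral measure and traces of functions of a diagonal operator. -/
theorem hasFunctionTrace_of_isDiagonal [Infinite ι] {A : H →ₗ.[ℂ] H} {b : HilbertBasis ι ℂ H}
    {lam : ι → ℝ≥0} (hA : IsDiagonal A b fun i => ((lam i : ℝ) : ℂ)) {f : ℝ≥0 → ℂ}
    (hf : Measurable f) (hs : Summable fun i => ‖f (lam i)‖) :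
    HasFunctionTrace A f (∑' i, f (lam i)) := by
  have hP : (diagMeasure b fun i => (lam i : ℝ)).IsSpectralMeasure A :=
    isIntegral_diagMeasure Complex.measurable_ofReal hA
  refine ⟨⟨_, hP, fun Q hQ => ProjMeasure.eq_of_isDiagonal hA hQ hP⟩, fun Q hQ => ?_⟩
  obtain rfl := ProjMeasure.eq_of_isDiagonal hA hQ hP
  -- The multiplier is bounded since each `‖f(λ i)‖` is at most the total sum; `f` itself need not
  -- be bounded.
  obtain ⟨T, hT⟩ := exists_diagonal b (fun i => f (lam i)) _ fun i =>
    hs.le_tsum i fun _ _ => norm_nonneg _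
  refine ⟨T, isIntegral_diagMeasure (hf.comp measurable_real_toNNReal) ?_,
    hasTrace_of_diagonal b _ hs T hT⟩
  simpa using isDiagonal_toPMap b _ T hT

end DiagonalCalculus

/-! ### Bases of direct sums and the unitary matching two bases -/

section DirectSum

universe u v w

variable {H : Type u} [NormedAddCommGroup H] [InnerProductSpace ℂ H]
variable {K : Type v} [NormedAddCommGroup K] [InnerProductSpace ℂ K]
variable {ι κ : Type w}

/-- The vectors `(b i, 0)` and `(0, c j)`. -/
def sumVectors (b : HilbertBasis ι ℂ H) (c : HilbertBasis κ ℂ K) : ι ⊕ κ → WithLp 2 (H × K) :=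
  Sum.elim (fun i => WithLp.toLp 2 (b i, 0)) fun j => WithLp.toLp 2 (0, c j)

lemma orthonormal_sumVectors (b : HilbertBasis ι ℂ H) (c : HilbertBasis κ ℂ K) :
    Orthonormal ℂ (sumVectors b c) := by
  classical
  rw [orthonormal_iff_ite]
  rintro (i | i) (j | j)
  · simpa [sumVectors, WithLp.prod_inner_apply] using orthonormal_iff_ite.1 b.orthonormal i j
  · simp [sumVectors, WithLp.prod_inner_apply]
  · simp [sumVectors, WithLp.prod_inner_apply]
  · simpa [sumVectors, WithLp.prod_inner_apply] using orthonormal_iff_ite.1 c.orthonormal i j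

/-- The Hilbert basis of an orthogonal direct sum. -/
def sumBasis [CompleteSpace H] [CompleteSpace K] (b : HilbertBasis ι ℂ H)
    (c : HilbertBasis κ ℂ K) : HilbertBasis (ι ⊕ κ) ℂ (WithLp 2 (H × K)) :=
  HilbertBasis.mkOfOrthogonalEqBot (orthonormal_sumVectors b c) (by
    rw [Submodule.eq_bot_iff]
    intro x hx
    have h : ∀ p, ⟪sumVectors b c p, x⟫_ℂ = 0 := fun p =>
      hx _ (Submodule.subset_span (mem_range_self p))
    have h1 : x.fst = 0 := basis_ext b fun i => by
      simpa [sumVectors, WithLp.prod_inner_apply] using h (Sum.inl i)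
    have h2 : x.snd = 0 := basis_ext c fun i => by
      simpa [sumVectors, WithLp.prod_inner_apply] using h (Sum.inr i)
    exact WithLp.ofLp_injective 2 (Prod.ext h1 h2))

lemma sumBasis_inl [CompleteSpace H] [CompleteSpace K] (b : HilbertBasis ι ℂ H)
    (c : HilbertBasis κ ℂ K) (i : ι) : sumBasis b c (Sum.inl i) = WithLp.toLp 2 (b i, 0) := by
  rw [sumBasis, HilbertBasis.coe_mkOfOrthogonalEqBot]
  rfl

lemma sumBasis_inr [CompleteSpace H] [CompleteSpace K] (b : HilbertBasis ι ℂ H)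
    (c : HilbertBasis κ ℂ K) (i : κ) : sumBasis b c (Sum.inr i) = WithLp.toLp 2 (0, c i) := by
  rw [sumBasis, HilbertBasis.coe_mkOfOrthogonalEqBot]
  rfl

lemma mem_graph_directSum (A : H →ₗ.[ℂ] H) (B : K →ₗ.[ℂ] K) (x y : WithLp 2 (H × K)) :
    (x, y) ∈ (directSum A B).graph ↔ (x.fst, y.fst) ∈ A.graph ∧ (x.snd, y.snd) ∈ B.graph := by
  simp only [LinearPMap.mem_graph_iff]
  constructor
  · rintro ⟨z, hz, hy⟩
    subst hz hy
    exact ⟨⟨⟨_, z.2.1⟩, rfl, rfl⟩, ⟨⟨_, z.2.2⟩, rfl, rfl⟩⟩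
  · rintro ⟨⟨z, hz, hy⟩, ⟨w, hw, hv⟩⟩
    refine ⟨⟨x, hz ▸ z.2, hw ▸ w.2⟩, rfl, WithLp.ofLp_injective 2 (Prod.ext ?_ ?_)⟩
    · refine Eq.trans ?_ hy
      exact congrArg A (Subtype.ext hz.symm)
    · refine Eq.trans ?_ hv
      exact congrArg B (Subtype.ext hw.symm)

lemma directSum_isDiagonal [CompleteSpace H] [CompleteSpace K] {A : H →ₗ.[ℂ] H}
    {B : K →ₗ.[ℂ] K} {b : HilbertBasis ι ℂ H} {c : HilbertBasis κ ℂ K} {p : ι → ℂ} {q : κ → ℂ}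
    (hA : IsDiagonal A b p) (hB : IsDiagonal B c q) :
    IsDiagonal (directSum A B) (sumBasis b c) (Sum.elim p q) := by
  intro x y
  rw [mem_graph_directSum, hA, hB, Sum.forall]
  simp [sumBasis_inl, sumBasis_inr, WithLp.prod_inner_apply]

/-- The unitary that carries one Hilbert basis to another. -/
def basisEquiv (b : HilbertBasis ι ℂ H) (c : HilbertBasis ι ℂ K) : H ≃ₗᵢ[ℂ] K :=
  b.repr.trans c.repr.symm

lemma basisEquiv_apply (b : HilbertBasis ι ℂ H) (c : HilbertBasis ι ℂ K) (i : ι) :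
    basisEquiv b c (b i) = c i := by
  classical
  simp [basisEquiv, b.repr_self]

lemma isometryEquiv_ext (b : HilbertBasis ι ℂ H) {U V : H ≃ₗᵢ[ℂ] K} (h : ∀ i, U (b i) = V (b i)) :
    U = V := by
  refine LinearIsometryEquiv.ext fun x => ?_
  have hx := b.hasSum_repr x
  have h1 := hx.mapL (U : H →L[ℂ] K)
  have h2 := hx.mapL (V : H →L[ℂ] K)
  simp only [map_smul, LinearIsometryEquiv.coe_coe'', h] at h1 h2
  exact h1.unique h2

lemma basisEquiv_intertwines {b : HilbertBasis ι ℂ H} {c : HilbertBasis ι ℂ K} {p : ι → ℂ}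
    {A : H →ₗ.[ℂ] H} {B : K →ₗ.[ℂ] K} (hA : IsDiagonal A b p) (hB : IsDiagonal B c p) :
    Intertwines (basisEquiv b c) A B := by
  have hin : ∀ x i, ⟪c i, basisEquiv b c x⟫_ℂ = ⟪b i, x⟫_ℂ := fun x i => by
    rw [← basisEquiv_apply b c, LinearIsometryEquiv.inner_map_map]
  -- Diagonality describes each graph by coefficients alone, and these are preserved by the unitary.
  -- The domain and intertwining statements are both read off from this correspondence of graphs.
  have hgr : ∀ x y, (x, y) ∈ A.graph ↔ (basisEquiv b c x, basisEquiv b c y) ∈ B.graph :=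
    fun x y => by rw [hA, hB]; simp only [hin]
  refine ⟨fun x => ⟨fun hx => ?_, fun hx => ?_⟩, fun x y hxy => ?_⟩
  · exact LinearPMap.mem_domain_of_mem_graph ((hgr _ _).1 (A.mem_graph ⟨x, hx⟩))
  · have h := B.mem_graph ⟨_, hx⟩
    rw [← (basisEquiv b c).apply_symm_apply (B ⟨_, hx⟩)] at h
    exact LinearPMap.mem_domain_of_mem_graph ((hgr _ _).2 h)
  · have h := (hgr _ _).1 (A.mem_graph x)
    rw [← hxy] at h
    exact (LinearPMap.mem_graph_snd_inj B h (B.mem_graph y) rfl).symm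

end DirectSum

/-! ### Total families of functions -/

section Total

variable {X Y ι κ : Type*} [MeasurableSpace X] [MeasurableSpace Y]

/-- An integrable function all of whose moments against the family vanish is zero. -/
def IsTotal (μ : Measure X) (e : ι → X → ℂ) : Prop :=
  ∀ g : X → ℂ, Integrable g μ → (∀ i, ∫ x, e i x * g x ∂μ = 0) → g =ᵐ[μ] 0

/-- By Fubini, for each `j` the partial moment `∫ e' j y g(x, y) dy` has vanishing moments against
the `e i`, hence is zero for almost every `x`. Countability of `κ` gives one null set for all `j`;
then almost every slice of `g` vanishes. -/
lemma IsTotal.prod [Countable κ] {μ : Measure X} {ν : Measure Y} [SFinite μ] [SFinite ν]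
    {e : ι → X → ℂ} {e' : κ → Y → ℂ} (he : IsTotal μ e) (he' : IsTotal ν e')
    (hm : ∀ i, Measurable (e i)) (hm' : ∀ j, Measurable (e' j)) {C C' : ℝ}
    (hC : ∀ i x, ‖e i x‖ ≤ C) (hC' : ∀ j y, ‖e' j y‖ ≤ C') :
    IsTotal (μ.prod ν) fun (p : ι × κ) (z : X × Y) => e p.1 z.1 * e' p.2 z.2 := by
  intro g hg h
  have hI : ∀ j, Integrable (fun z : X × Y => e' j z.2 * g z) (μ.prod ν) := fun j =>
    hg.bdd_mul ((hm' j).comp measurable_snd).aestronglyMeasurable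
      (Filter.Eventually.of_forall fun z => hC' j z.2)
  have h0 : ∀ j, (fun x => ∫ y, e' j y * g (x, y) ∂ν) =ᵐ[μ] 0 := fun j => by
    refine he _ (hI j).integral_prod_left fun i => ?_
    rw [← h (i, j), integral_prod]
    · simp only [← integral_const_mul, mul_assoc]
    · simp only [mul_assoc]
      exact (hI j).bdd_mul ((hm i).comp measurable_fst).aestronglyMeasurable
        (Filter.Eventually.of_forall fun z => hC i z.1)
  have h1 : ∀ᵐ x ∂μ, (fun y => g (x, y)) =ᵐ[ν] 0 := by
    filter_upwards [ae_all_iff.2 h0, hg.prod_right_ae] with x hx hgx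
    exact he' _ hgx hx
  have h2 : ∫ z, ‖g z‖ ∂μ.prod ν = 0 := by
    rw [integral_prod _ hg.norm]
    refine integral_eq_zero_of_ae ?_
    filter_upwards [h1] with x hx
    refine integral_eq_zero_of_ae ?_
    filter_upwards [hx] with y hy
    simpa using hy
  rw [integral_eq_zero_iff_of_nonneg (fun _ => norm_nonneg _) hg.norm] at h2
  filter_upwards [h2] with z hz
  simpa using hz

end Total

/-! ### Totality of the exponentials, sines and cosines -/

/-- The left side is a continuous linear functional of `F` in the uniform norm and vanishes on the
trigonometric polynomials, which are dense. The parameter `ε` treats the plain (`0`), odd (`-1`) and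
even (`1`) cases at once. -/
lemma integral_circle_eq_zero {T : ℝ} [Fact (0 < T)] {μ : Measure ℝ} {g : ℝ → ℂ}
    (hg : Integrable g μ) (ε : ℂ)
    (h : ∀ n : ℤ, ∫ z, (fourier n (z : AddCircle T) + ε * fourier n (-z : AddCircle T)) * g z ∂μ
      = 0) (F : C(AddCircle T, ℂ)) :
    ∫ z, (F (z : AddCircle T) + ε * F (-z : AddCircle T)) * g z ∂μ = 0 := by
  have hcoe : Continuous fun z : ℝ => (z : AddCircle T) := AddCircle.continuous_mk' T
  have hcont : ∀ F : C(AddCircle T, ℂ),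
      Continuous fun z : ℝ => F (z : AddCircle T) + ε * F (-z : AddCircle T) := fun F =>
    (F.continuous.comp hcoe).add (continuous_const.mul (F.continuous.comp hcoe.neg))
  have hbd : ∀ (F : C(AddCircle T, ℂ)) (z : ℝ),
      ‖F (z : AddCircle T) + ε * F (-z : AddCircle T)‖ ≤ (1 + ‖ε‖) * ‖F‖ := fun F z => by
    refine (norm_add_le _ _).trans ?_
    rw [norm_mul, add_mul, one_mul]
    gcongr <;> exact F.norm_coe_le_norm _
  have hint : ∀ F : C(AddCircle T, ℂ),
      Integrable (fun z : ℝ => (F (z : AddCircle T) + ε * F (-z : AddCircle T)) * g z) μ :=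
    fun F => hg.bdd_mul (hcont F).aestronglyMeasurable (Filter.Eventually.of_forall (hbd F))
  let Λ : C(AddCircle T, ℂ) →L[ℂ] ℂ := LinearMap.mkContinuous
    { toFun := fun F => ∫ z, (F (z : AddCircle T) + ε * F (-z : AddCircle T)) * g z ∂μ
      map_add' := fun F G => by
        rw [← integral_add (hint F) (hint G)]
        congr 1
        funext z
        simp only [ContinuousMap.add_apply]
        ring
      map_smul' := fun c F => by
        rw [RingHom.id_apply, smul_eq_mul, ← integral_const_mul]
        congr 1
        funext z
        simp only [ContinuousMap.smul_apply, smul_eq_mul]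
        ring } ((1 + ‖ε‖) * ∫ z, ‖g z‖ ∂μ) fun F => by
    refine (norm_integral_le_integral_norm _).trans ?_
    rw [mul_right_comm, ← integral_const_mul]
    refine integral_mono (hint F).norm (hg.norm.const_mul _) fun z => ?_
    simp only [norm_mul]
    gcongr
    exact hbd F z
  have hΛ : (⊤ : Submodule ℂ C(AddCircle T, ℂ)) ≤ LinearMap.ker (Λ : C(AddCircle T, ℂ) →ₗ[ℂ] ℂ) := by
    rw [← span_fourier_closure_eq_top]
    refine Submodule.topologicalClosure_minimal _ (Submodule.span_le.2 ?_) Λ.isClosed_ker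
    rintro _ ⟨n, rfl⟩
    exact h n
  exact hΛ (Submodule.mem_top (x := F))

/-- Uniqueness for Fourier series of functions on `(0, b)`, extended by `0` (when `ε = 0`) or by
reflection (when `2 b ≤ T`) to a period of length `T`. -/
lemma ae_eq_zero_of_fourier {T b : ℝ} [hT : Fact (0 < T)] (hbT : b ≤ T) {g : ℝ → ℂ}
    (hg : Integrable g (volume.restrict (Ioo 0 b))) (ε : ℂ) (hε : ε = 0 ∨ 2 * b ≤ T)
    (h : ∀ n : ℤ, ∫ z in Ioo 0 b,
      (fourier n (z : AddCircle T) + ε * fourier n (-z : AddCircle T)) * g z = 0) :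
    g =ᵐ[volume.restrict (Ioo 0 b)] 0 := by
  rw [Filter.EventuallyEq, ae_restrict_iff' measurableSet_Ioo]
  refine isOpen_Ioo.ae_eq_zero_of_integral_contDiff_smul_eq_zero
    (IntegrableOn.locallyIntegrableOn hg) fun ψ hψ _ hsupp => ?_
  have hz : ∀ z, z ∉ Ioo 0 b → ψ z = 0 := fun z hz =>
    image_eq_zero_of_notMem_tsupport fun h' => hz (hsupp h')
  -- A bump function supported in `(0, b)` vanishes at `0` and `T`, so it closes up to a continuous
  -- function on the circle.
  have hF : Continuous (AddCircle.liftIco T 0 fun z => (ψ z : ℂ)) := by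
    refine AddCircle.liftIco_zero_continuous ?_
      (Complex.continuous_ofReal.comp hψ.continuous).continuousOn
    rw [hz 0 (by simp), hz T (by simp [hbT])]
  have key := integral_circle_eq_zero hg ε h ⟨_, hF⟩
  rw [← setIntegral_eq_integral_of_forall_compl_eq_zero (s := Ioo 0 b) fun z hz' => by
    rw [hz z hz', zero_smul], ← key]
  refine setIntegral_congr_fun measurableSet_Ioo fun z hzb => ?_
  have h1 : AddCircle.liftIco T 0 (fun z => (ψ z : ℂ)) (z : AddCircle T) = ψ z :=
    AddCircle.liftIco_zero_coe_apply ⟨hzb.1.le, hzb.2.trans_le hbT⟩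
  have h2 : ε * AddCircle.liftIco T 0 (fun z => (ψ z : ℂ)) (-z : AddCircle T) = 0 := by
    rcases hε with rfl | hε
    · simp
    -- The reflected point is represented by `T - z ≥ 2b - z > b`, outside the support of `ψ`; the
    -- reflected term therefore does not contribute.
    · have : (-z : AddCircle T) = ((T - z : ℝ) : AddCircle T) := by
        rw [AddCircle.coe_sub, AddCircle.coe_period, zero_sub]
      rw [this, AddCircle.liftIco_zero_coe_apply
        ⟨by linarith [hzb.2], by linarith [hzb.1]⟩, hz (T - z) fun h' => by
          linarith [h'.2, hzb.2]]
      simp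
  simp only [ContinuousMap.coe_mk, h1, h2, add_zero, Complex.real_smul]

lemma fourier_coe_neg {T : ℝ} (n : ℤ) (z : ℝ) :
    fourier n (-z : AddCircle T) = Complex.exp (-(2 * Real.pi * Complex.I * n * z / T)) := by
  rw [← AddCircle.coe_neg, fourier_coe_apply]
  congr 1
  push_cast
  ring

/-- The lateral exponential `exp (i k_j x)`. -/
def latExp (L : ℝ) (j : ℤ) (x : ℝ) : ℂ := Complex.exp (Complex.I * ((2 * Real.pi / L * j : ℝ) * x))

lemma continuous_latExp (L : ℝ) (j : ℤ) : Continuous (latExp L j) := by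
  unfold latExp
  fun_prop

lemma norm_latExp (L : ℝ) (j : ℤ) (x : ℝ) : ‖latExp L j x‖ = 1 := by
  rw [latExp, mul_comm, ← Complex.ofReal_mul, Complex.norm_exp_ofReal_mul_I]

lemma conj_latExp (L : ℝ) (j : ℤ) (x : ℝ) :
    (starRingEnd ℂ) (latExp L j x) = latExp L (-j) x := by
  rw [latExp, latExp, ← Complex.exp_conj]
  congr 1
  rw [map_mul, map_mul, Complex.conj_I, Complex.conj_ofReal, Complex.conj_ofReal]
  push_cast
  ring

lemma latExp_mul (L : ℝ) (i j : ℤ) (x : ℝ) : latExp L i x * latExp L j x = latExp L (i + j) x := by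
  rw [latExp, latExp, latExp, ← Complex.exp_add]
  congr 1
  push_cast
  ring

lemma isTotal_latExp {L : ℝ} (hL : 0 < L) :
    IsTotal (volume.restrict (Ioo 0 L)) (fun (j : ℤ) x => (starRingEnd ℂ) (latExp L j x)) := by
  intro g hg h
  have : Fact (0 < L) := ⟨hL⟩
  refine ae_eq_zero_of_fourier le_rfl hg 0 (Or.inl rfl) fun n => ?_
  refine Eq.trans ?_ (h (-n))
  refine integral_congr_ae (Filter.Eventually.of_forall fun z => ?_)
  simp only [zero_mul, add_zero, conj_latExp, neg_neg]
  rw [fourier_coe_apply, latExp]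
  congr 2
  push_cast
  ring

/-- On the circle of length `2a` the odd part of an exponential is, up to a constant factor, a sine
of frequency `ν_{|k|}`; this is the case `ε = -1`. -/
lemma isTotal_sinMode {a : ℝ} (ha : 0 < a) :
    IsTotal (volume.restrict (Ioo 0 a)) (fun (n : ℕ+) z => (sinMode a n z : ℂ)) := by
  intro g hg h
  have : Fact (0 < 2 * a) := ⟨by positivity⟩
  have hs : ∀ n : ℕ, ∫ z in Ioo 0 a, Complex.sin (nu a n * z) * g z = 0 := fun n => by
    rcases Nat.eq_zero_or_pos n with rfl | hn
    · simp [nu]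
    · have h1 := h ⟨n, hn⟩
      have h2 : ((Real.sqrt (2 / a) : ℝ) : ℂ) ≠ 0 := by
        rw [Complex.ofReal_ne_zero]
        positivity
      simp only [sinMode, PNat.mk_coe, Complex.ofReal_mul, mul_assoc, integral_const_mul,
        Complex.ofReal_sin, mul_eq_zero, h2, false_or] at h1
      exact h1
  refine ae_eq_zero_of_fourier (T := 2 * a) (by linarith) hg (-1) (Or.inr le_rfl) fun k => ?_
  have hk : ∀ z : ℝ, (fourier k (z : AddCircle (2 * a)) + -1 * fourier k (-z : AddCircle (2 * a)))
      * g z = (2 * Complex.I * k.sign) * (Complex.sin (nu a k.natAbs * z) * g z) := fun z => by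
    have h1 : (k : ℂ) = k.sign * k.natAbs := by
      conv_lhs => rw [← Int.sign_mul_natAbs k]
      rw [Int.cast_mul, Int.cast_natCast]
    have h2 : (k.sign : ℂ) * Complex.sin (nu a k.natAbs * z) =
        Complex.sin (Real.pi * k * z / a) := by
      have h3 : ((nu a k.natAbs : ℝ) : ℂ) = Real.pi * k.natAbs / a := by
        simp only [nu, Complex.ofReal_div, Complex.ofReal_mul, Complex.ofReal_natCast]
      rcases lt_trichotomy k 0 with hk | hk | hk
      · rw [h1, Int.sign_eq_neg_one_of_neg hk, h3]
        push_cast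
        rw [neg_one_mul, ← Complex.sin_neg]
        congr 1
        ring
      · simp [hk]
      · rw [h1, Int.sign_eq_one_of_pos hk, h3]
        push_cast
        rw [one_mul]
        congr 1
        ring
    rw [fourier_coe_apply, fourier_coe_neg]
    have h4 : (2 * Real.pi * Complex.I * k * z / ((2 * a : ℝ) : ℂ)) =
        (Real.pi * k * z / a) * Complex.I := by
      have : (a : ℂ) ≠ 0 := by exact_mod_cast ha.ne'
      push_cast
      field_simp
    rw [h4, show 2 * Complex.I * (k.sign : ℂ) * (Complex.sin (nu a k.natAbs * z) * g z) =
      2 * Complex.I * (k.sign * Complex.sin (nu a k.natAbs * z)) * g z by ring, h2, ← neg_mul,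
      Complex.exp_mul_I, Complex.exp_mul_I, Complex.cos_neg, Complex.sin_neg]
    ring
  simp only [hk, integral_const_mul, hs, mul_zero]

/-- The even counterpart, `ε = 1`; the constant `n = 0` is now needed, for the exponential `k = 0`.
-/
lemma isTotal_cosMode {a : ℝ} (ha : 0 < a) :
    IsTotal (volume.restrict (Ioo 0 a)) (fun (n : ℕ) z => (cosMode a n z : ℂ)) := by
  intro g hg h
  have : Fact (0 < 2 * a) := ⟨by positivity⟩
  have hs : ∀ n : ℕ, ∫ z in Ioo 0 a, Complex.cos (nu a n * z) * g z = 0 := fun n => by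
    have h1 := h n
    rcases eq_or_ne n 0 with rfl | hn
    · have h2 : (((Real.sqrt a)⁻¹ : ℝ) : ℂ) ≠ 0 := by
        rw [Complex.ofReal_ne_zero]
        positivity
      simp only [cosMode, if_true, integral_const_mul, mul_eq_zero, h2, false_or] at h1
      simpa [nu] using h1
    · have h2 : ((Real.sqrt (2 / a) : ℝ) : ℂ) ≠ 0 := by
        rw [Complex.ofReal_ne_zero]
        positivity
      simp only [cosMode, if_neg hn, Complex.ofReal_mul, mul_assoc, integral_const_mul,
        Complex.ofReal_cos, mul_eq_zero, h2, false_or] at h1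
      exact h1
  refine ae_eq_zero_of_fourier (T := 2 * a) (by linarith) hg 1 (Or.inr le_rfl) fun k => ?_
  have hk : ∀ z : ℝ, (fourier k (z : AddCircle (2 * a)) + 1 * fourier k (-z : AddCircle (2 * a)))
      * g z = 2 * (Complex.cos (nu a k.natAbs * z) * g z) := fun z => by
    have h2 : Complex.cos (nu a k.natAbs * z) = Complex.cos (Real.pi * k * z / a) := by
      have h3 : ((nu a k.natAbs : ℝ) : ℂ) = Real.pi * k.natAbs / a := by
        simp only [nu, Complex.ofReal_div, Complex.ofReal_mul, Complex.ofReal_natCast]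
      rcases Int.natAbs_eq k with hk | hk
      · have : (k : ℂ) = k.natAbs := by
          conv_lhs => rw [hk]
          simp
        rw [h3, this]
        congr 1
        ring
      · have : (k : ℂ) = -k.natAbs := by
          conv_lhs => rw [hk]
          simp
        rw [h3, this, ← Complex.cos_neg]
        congr 1
        ring
    rw [fourier_coe_apply, fourier_coe_neg]
    have h4 : (2 * Real.pi * Complex.I * k * z / ((2 * a : ℝ) : ℂ)) =
        (Real.pi * k * z / a) * Complex.I := by
      have : (a : ℂ) ≠ 0 := by exact_mod_cast ha.ne'
      push_cast
      field_simp
    rw [h4, h2, ← neg_mul, Complex.exp_mul_I, Complex.exp_mul_I, Complex.cos_neg, Complex.sin_neg]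
    ring
  simp only [hk, integral_const_mul, hs, mul_zero]

/-! ### Orthogonality relations in one variable -/

lemma integral_latExp {L : ℝ} (hL : 0 < L) (j : ℤ) :
    ∫ x in Ioo 0 L, latExp L j x = if j = 0 then (L : ℂ) else 0 := by
  rw [← integral_Ioc_eq_integral_Ioo, ← intervalIntegral.integral_of_le hL.le]
  split_ifs with hj
  · simp [latExp, hj]
  · have hL' : (L : ℂ) ≠ 0 := by exact_mod_cast hL.ne'
    have hj' : (j : ℂ) ≠ 0 := by exact_mod_cast hj
    have hpi : (Real.pi : ℂ) ≠ 0 := by exact_mod_cast Real.pi_ne_zero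
    have hc : (Complex.I * (2 * Real.pi / L * j)) ≠ 0 := by
      simp [hL', hj', hpi]
    have : ∀ x : ℝ, latExp L j x = Complex.exp ((Complex.I * (2 * Real.pi / L * j)) * x) :=
      fun x => by
        rw [latExp]
        push_cast
        congr 1
        ring
    simp only [this]
    rw [integral_exp_mul_complex hc]
    have h1 : Complex.I * (2 * Real.pi / L * j) * L = j * (2 * Real.pi * Complex.I) := by
      field_simp
    rw [h1, Complex.exp_int_mul_two_pi_mul_I]
    simp

lemma integral_conj_latExp_mul {L : ℝ} (hL : 0 < L) (i j : ℤ) :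
    ∫ x in Ioo 0 L, (starRingEnd ℂ) (latExp L i x) * latExp L j x =
      if i = j then (L : ℂ) else 0 := by
  simp only [conj_latExp, latExp_mul]
  rw [integral_latExp hL]
  congr 1
  rw [eq_iff_iff]
  omega

lemma integral_cos {a : ℝ} (ha : 0 < a) (k : ℤ) :
    ∫ z in Ioo 0 a, Real.cos (Real.pi * k / a * z) = if k = 0 then a else 0 := by
  rw [← integral_Ioc_eq_integral_Ioo, ← intervalIntegral.integral_of_le ha.le]
  split_ifs with hk
  · simp [hk]
  · have hk' : (k : ℝ) ≠ 0 := by exact_mod_cast hk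
    have hc : Real.pi * k / a ≠ 0 := by
      have := Real.pi_ne_zero
      positivity
    rw [intervalIntegral.integral_comp_mul_left _ hc, _root_.integral_cos,
      div_mul_cancel₀ _ ha.ne', mul_comm Real.pi, Real.sin_int_mul_pi]
    simp

lemma integrable_of_continuous {a : ℝ} {g : ℝ → ℝ} (hg : Continuous g) :
    Integrable g (volume.restrict (Ioo 0 a)) :=
  (hg.integrableOn_Icc (a := 0) (b := a)).mono_set Ioo_subset_Icc_self

lemma integral_sinMode_mul {a : ℝ} (ha : 0 < a) {m n : ℕ} (hm : 1 ≤ m) :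
    ∫ z in Ioo 0 a, sinMode a m z * sinMode a n z = if m = n then 1 else 0 := by
  have h : ∀ z, sinMode a m z * sinMode a n z =
      a⁻¹ * (Real.cos (Real.pi * ((m - n : ℤ) : ℝ) / a * z) -
        Real.cos (Real.pi * ((m + n : ℤ) : ℝ) / a * z)) := fun z => by
    rw [show Real.pi * ((m - n : ℤ) : ℝ) / a * z = nu a m * z - nu a n * z by
      rw [nu, nu]; push_cast; ring, show Real.pi * ((m + n : ℤ) : ℝ) / a * z =
      nu a m * z + nu a n * z by rw [nu, nu]; push_cast; ring, Real.cos_sub, Real.cos_add,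
      sinMode, sinMode]
    have := Real.mul_self_sqrt (show 0 ≤ 2 / a by positivity)
    calc _ = (Real.sqrt (2 / a) * Real.sqrt (2 / a)) *
        (Real.sin (nu a m * z) * Real.sin (nu a n * z)) := by ring
      _ = _ := by rw [this]; ring
  simp only [h, integral_const_mul]
  rw [integral_sub (integrable_of_continuous (by fun_prop))
    (integrable_of_continuous (by fun_prop)), integral_cos ha, integral_cos ha]
  -- Here `1 ≤ m` matters: the mode `s_0` is zero and not normalized.
  have h1 : ¬ ((m : ℤ) + n = 0) := by omega
  have h2 : ((m : ℤ) - n = 0) ↔ m = n := by omega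
  simp only [h1, h2, if_false, sub_zero]
  split_ifs
  · exact inv_mul_cancel₀ ha.ne'
  · simp

lemma integral_cosMode_mul {a : ℝ} (ha : 0 < a) (m n : ℕ) :
    ∫ z in Ioo 0 a, cosMode a m z * cosMode a n z = if m = n then 1 else 0 := by
  -- A common shape `d cos(ν_n z)` absorbs the different normalization of `c_0`.
  have hd : ∀ n : ℕ, ∃ d : ℝ, (d * d = if n = 0 then a⁻¹ else 2 / a) ∧
      ∀ z, cosMode a n z = d * Real.cos (nu a n * z) := fun n => by
    by_cases hn : n = 0
    · refine ⟨(Real.sqrt a)⁻¹, ?_, fun z => by simp [cosMode, hn, nu]⟩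
      rw [if_pos hn, ← mul_inv, Real.mul_self_sqrt ha.le]
    · refine ⟨Real.sqrt (2 / a), ?_, fun z => by simp [cosMode, hn]⟩
      rw [if_neg hn, Real.mul_self_sqrt (by positivity)]
  obtain ⟨c, hc, hc'⟩ := hd m
  obtain ⟨d, hd, hd'⟩ := hd n
  have h : ∀ z, cosMode a m z * cosMode a n z =
      (c * d / 2) * (Real.cos (Real.pi * ((m - n : ℤ) : ℝ) / a * z) +
        Real.cos (Real.pi * ((m + n : ℤ) : ℝ) / a * z)) := fun z => by
    rw [show Real.pi * ((m - n : ℤ) : ℝ) / a * z = nu a m * z - nu a n * z by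
      rw [nu, nu]; push_cast; ring, show Real.pi * ((m + n : ℤ) : ℝ) / a * z =
      nu a m * z + nu a n * z by rw [nu, nu]; push_cast; ring, Real.cos_sub, Real.cos_add,
      hc', hd']
    ring
  simp only [h, integral_const_mul]
  rw [integral_add (integrable_of_continuous (by fun_prop))
    (integrable_of_continuous (by fun_prop)), integral_cos ha, integral_cos ha]
  by_cases hmn : m = n
  · subst hmn
    have hcd : c * d = if m = 0 then a⁻¹ else 2 / a := by
      rw [← hc]
      congr 1
      have := (hd' 0).symm.trans (hc' 0)
      simpa using this
    rw [hcd]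
    by_cases hm : m = 0
    · simp only [hm]
      simp
      field_simp
      norm_num
    · have : ¬ ((m : ℤ) + m = 0) := by omega
      simp [hm]
      field_simp
  · have h1 : ¬ ((m : ℤ) + n = 0) := by omega
    have h2 : ¬ ((m : ℤ) - n = 0) := by omega
    simp [h1, h2, hmn]

/-! ### Separated smooth functions -/

/-- `φ_m(x, y) g(z)` -/
def sep (L : ℝ) (m : ℤ × ℤ) (g : ℝ → ℝ) (hg : ContDiff ℝ ∞ g) : Smooth L :=
  ⟨_, separated_mem L m g hg⟩

lemma sep_apply (L : ℝ) (m : ℤ × ℤ) (g : ℝ → ℝ) (hg : ContDiff ℝ ∞ g) (p : R3) :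
    (sep L m g hg : R3 → ℂ) p = phi L m p.1 p.2.1 * (g p.2.2 : ℂ) := rfl

lemma dirichletMode_eq_sep (L a : ℝ) (m : ℤ × ℤ) (n : ℕ) :
    dirichletMode L a m n = sep L m (sinMode a n) (contDiff_sinMode a n) := rfl

lemma neumannMode_eq_sep (L a : ℝ) (m : ℤ × ℤ) (n : ℕ) :
    neumannMode L a m n = sep L m (cosMode a n) (contDiff_cosMode a n) := rfl

lemma phi_eq (L : ℝ) (m : ℤ × ℤ) (x y : ℝ) :
    phi L m x y = (1 / L : ℂ) * (latExp L m.1 x * latExp L m.2 y) := by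
  rw [phi, latExp, latExp, ← Complex.exp_add, mul_add, kx, ky]

lemma norm_phi {L : ℝ} (hL : 0 < L) (m : ℤ × ℤ) (x y : ℝ) : ‖phi L m x y‖ = 1 / L := by
  rw [phi_eq, norm_mul, norm_mul, norm_latExp, norm_latExp, norm_div, Complex.norm_real,
    Real.norm_of_nonneg hL.le]
  simp

/-! ### Inner products as integrals -/

lemma slabMeasure_eq_prod (L a : ℝ) : slabMeasure L a =
    (volume.restrict (Ioo 0 L)).prod
      ((volume.restrict (Ioo 0 L)).prod (volume.restrict (Ioo 0 a))) := by
  rw [Measure.prod_restrict, Measure.prod_restrict]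
  rfl

instance isFiniteMeasure_slabMeasure (L a : ℝ) : IsFiniteMeasure (slabMeasure L a) := by
  rw [slabMeasure_eq_prod]
  infer_instance

lemma measurableSet_cell (L a : ℝ) : MeasurableSet (cell L a) :=
  measurableSet_Ioo.prod (measurableSet_Ioo.prod measurableSet_Ioo)

lemma toL2_coe {L : ℝ} (a : ℝ) (u : Smooth L) :
    (toL2 a u : R3 → ℂ) =ᵐ[slabMeasure L a] (u : R3 → ℂ) := (memLp_smooth a u).coeFn_toLp

lemma inner_toL2_left {L : ℝ} (a : ℝ) (u : Smooth L) (f : L2 L a) :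
    ⟪toL2 a u, f⟫_ℂ = ∫ p, (starRingEnd ℂ) ((u : R3 → ℂ) p) * f p ∂(slabMeasure L a) := by
  rw [L2.inner_def]
  refine integral_congr_ae ?_
  filter_upwards [toL2_coe a u] with p hp
  rw [hp, RCLike.inner_apply']

lemma inner_toL2 {L : ℝ} (a : ℝ) (u v : Smooth L) :
    ⟪toL2 a u, toL2 a v⟫_ℂ =
      ∫ p, (starRingEnd ℂ) ((u : R3 → ℂ) p) * (v : R3 → ℂ) p ∂(slabMeasure L a) := by
  rw [inner_toL2_left]
  refine integral_congr_ae ?_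
  filter_upwards [toL2_coe a v] with p hp
  rw [hp]

lemma inner_sep {L a : ℝ} (hL : 0 < L) (m m' : ℤ × ℤ) (g g' : ℝ → ℝ) (hg : ContDiff ℝ ∞ g)
    (hg' : ContDiff ℝ ∞ g') :
    ⟪toL2 a (sep L m g hg), toL2 a (sep L m' g' hg')⟫_ℂ =
      if m = m' then ((∫ z in Ioo 0 a, g z * g' z : ℝ) : ℂ) else 0 := by
  rw [inner_toL2, slabMeasure_eq_prod]
  have h : ∀ p : R3, (starRingEnd ℂ) ((sep L m g hg : R3 → ℂ) p) * (sep L m' g' hg' : R3 → ℂ) p =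
      (1 / L ^ 2 : ℂ) * (((starRingEnd ℂ) (latExp L m.1 p.1) * latExp L m'.1 p.1) *
        (((starRingEnd ℂ) (latExp L m.2 p.2.1) * latExp L m'.2 p.2.1) *
          ((g p.2.2 * g' p.2.2 : ℝ) : ℂ))) := fun p => by
    simp only [sep_apply, phi_eq, map_mul, map_div₀, map_one, Complex.conj_ofReal]
    push_cast
    ring
  simp only [h, integral_const_mul]
  rw [integral_prod_mul (fun x => (starRingEnd ℂ) (latExp L m.1 x) * latExp L m'.1 x)
    (fun q : ℝ × ℝ => ((starRingEnd ℂ) (latExp L m.2 q.1) * latExp L m'.2 q.1) *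
          ((g q.2 * g' q.2 : ℝ) : ℂ)),
    integral_prod_mul (fun y => (starRingEnd ℂ) (latExp L m.2 y) * latExp L m'.2 y)
      (fun z => ((g z * g' z : ℝ) : ℂ)), integral_conj_latExp_mul hL, integral_conj_latExp_mul hL,
    integral_complex_ofReal]
  have hL' : (L : ℂ) ≠ 0 := by exact_mod_cast hL.ne'
  by_cases h1 : m.1 = m'.1 <;> by_cases h2 : m.2 = m'.2 <;> simp [h1, h2, Prod.ext_iff]
  field_simp

lemma inner_dirichletMode {L a : ℝ} (hL : 0 < L) (ha : 0 < a) (m m' : ℤ × ℤ) {n n' : ℕ}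
    (hn : 1 ≤ n) : ⟪toL2 a (dirichletMode L a m n), toL2 a (dirichletMode L a m' n')⟫_ℂ =
      if m = m' ∧ n = n' then 1 else 0 := by
  rw [dirichletMode_eq_sep, dirichletMode_eq_sep, inner_sep hL, integral_sinMode_mul ha hn]
  by_cases h1 : m = m' <;> by_cases h2 : n = n' <;> simp [h1, h2]

lemma inner_neumannMode {L a : ℝ} (hL : 0 < L) (ha : 0 < a) (m m' : ℤ × ℤ) (n n' : ℕ) :
    ⟪toL2 a (neumannMode L a m n), toL2 a (neumannMode L a m' n')⟫_ℂ =
      if m = m' ∧ n = n' then 1 else 0 := by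
  rw [neumannMode_eq_sep, neumannMode_eq_sep, inner_sep hL, integral_cosMode_mul ha]
  by_cases h1 : m = m' <;> by_cases h2 : n = n' <;> simp [h1, h2]

/-! ### Completeness of the separated modes -/

/-- The slab measure is a product, so totality in `x`, `y` and `z` combines through two uses of
`IsTotal.prod`. -/
lemma eq_zero_of_inner_sep {L a : ℝ} (hL : 0 < L) {κ : Type} [Countable κ] (g : κ → ℝ → ℝ)
    (hg : ∀ n, ContDiff ℝ ∞ (g n)) {C : ℝ} (hC : ∀ n z, |g n z| ≤ C)
    (ht : IsTotal (volume.restrict (Ioo 0 a)) fun n z => (g n z : ℂ)) (f : L2 L a)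
    (hf : ∀ m n, ⟪toL2 a (sep L m (g n) (hg n)), f⟫_ℂ = 0) : f = 0 := by
  have hme : ∀ j : ℤ, Measurable fun x => (starRingEnd ℂ) (latExp L j x) := fun j =>
    (Complex.continuous_conj.comp (continuous_latExp L j)).measurable
  have hne : ∀ (j : ℤ) x, ‖(starRingEnd ℂ) (latExp L j x)‖ ≤ 1 := fun j x => by
    rw [RCLike.norm_conj, norm_latExp]
  have hmg : ∀ n, Measurable fun z => (g n z : ℂ) := fun n =>
    (Complex.continuous_ofReal.comp (hg n).continuous).measurable
  have hng : ∀ n z, ‖(g n z : ℂ)‖ ≤ C := fun n z => by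
    rw [Complex.norm_real]
    exact hC n z
  have h1 := (isTotal_latExp hL).prod ht hme hmg hne hng
  have h2 := (isTotal_latExp hL).prod h1 hme
    (fun j => ((hme j.1).comp measurable_fst).mul ((hmg j.2).comp measurable_snd)) hne
    (C' := 1 * C) fun j y => by
      rw [norm_mul]
      exact mul_le_mul (hne _ _) (hng _ _) (norm_nonneg _) zero_le_one
  have hint : Integrable f (slabMeasure L a) := (Lp.memLp f).integrable (by norm_num)
  rw [← slabMeasure_eq_prod] at h2
  have hL' : (1 / L : ℂ) ≠ 0 := by
    simpa using hL.ne'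
  refine (Lp.eq_zero_iff_ae_eq_zero).2 (h2 f hint fun p => ?_)
  have h3 := hf (p.1, p.2.1) p.2.2
  rw [inner_toL2_left] at h3
  have h4 : ∀ q : R3, (starRingEnd ℂ) ((sep L (p.1, p.2.1) (g p.2.2) (hg _) : R3 → ℂ) q) * f q =
      (1 / L : ℂ) * ((starRingEnd ℂ) (latExp L p.1 q.1) * ((starRingEnd ℂ) (latExp L p.2.1 q.2.1) *
        (g p.2.2 q.2.2 : ℂ)) * f q) := fun q => by
    simp only [sep_apply, phi_eq, map_mul, map_div₀, map_one, Complex.conj_ofReal]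
    ring
  simp only [h4, integral_const_mul, mul_eq_zero, hL', false_or] at h3
  exact h3

lemma abs_sinMode_le (a : ℝ) (n : ℕ) (z : ℝ) : |sinMode a n z| ≤ Real.sqrt (2 / a) := by
  rw [sinMode, abs_mul, abs_of_nonneg (Real.sqrt_nonneg _)]
  exact mul_le_of_le_one_right (Real.sqrt_nonneg _) (Real.abs_sin_le_one _)

lemma abs_cosMode_le (a : ℝ) (n : ℕ) (z : ℝ) :
    |cosMode a n z| ≤ (Real.sqrt a)⁻¹ + Real.sqrt (2 / a) := by
  have h1 : 0 ≤ (Real.sqrt a)⁻¹ := by positivity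
  have h2 := Real.sqrt_nonneg (2 / a)
  rw [cosMode]
  split_ifs
  · rw [abs_of_nonneg h1]
    linarith
  · rw [abs_mul, abs_of_nonneg h2]
    have := mul_le_of_le_one_right h2 (Real.abs_cos_le_one (nu a n * z))
    linarith

lemma eq_zero_of_inner_dirichletMode {L a : ℝ} (hL : 0 < L) (ha : 0 < a) (f : L2 L a)
    (hf : ∀ m n, 1 ≤ n → ⟪toL2 a (dirichletMode L a m n), f⟫_ℂ = 0) : f = 0 :=
  eq_zero_of_inner_sep hL (fun n : ℕ+ => sinMode a n) (fun n => contDiff_sinMode a n)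
    (fun n z => abs_sinMode_le a n z) (isTotal_sinMode ha) f fun m n => hf m n n.2

lemma eq_zero_of_inner_neumannMode {L a : ℝ} (hL : 0 < L) (ha : 0 < a) (f : L2 L a)
    (hf : ∀ m n, ⟪toL2 a (neumannMode L a m n), f⟫_ℂ = 0) : f = 0 :=
  eq_zero_of_inner_sep hL (fun n : ℕ => cosMode a n) (fun n => contDiff_cosMode a n)
    (fun n z => abs_cosMode_le a n z) (isTotal_cosMode ha) f fun m n => hf m n

/-! ### Partial derivatives -/

lemma pd_apply {L : ℝ} (i : Fin 3) (u : Smooth L) (p : R3) :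
    (pd i u : R3 → ℂ) p = fderiv ℝ (u : R3 → ℂ) p (dir i) := rfl

lemma hasFDerivAt_smooth {L : ℝ} (u : Smooth L) (p : R3) :
    HasFDerivAt (u : R3 → ℂ) (fderiv ℝ (u : R3 → ℂ) p) p :=
  ((u.2.1.differentiable (by simp)) p).hasFDerivAt

lemma hasDerivAt_pd_zero {L : ℝ} (u : Smooth L) (x y z : ℝ) :
    HasDerivAt (fun t => (u : R3 → ℂ) (t, y, z)) ((pd 0 u : R3 → ℂ) (x, y, z)) x :=
  (hasFDerivAt_smooth u (x, y, z)).comp_hasDerivAt x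
    ((hasDerivAt_id x).prodMk ((hasDerivAt_const x y).prodMk (hasDerivAt_const x z)))

lemma hasDerivAt_pd_one {L : ℝ} (u : Smooth L) (x y z : ℝ) :
    HasDerivAt (fun t => (u : R3 → ℂ) (x, t, z)) ((pd 1 u : R3 → ℂ) (x, y, z)) y :=
  (hasFDerivAt_smooth u (x, y, z)).comp_hasDerivAt y
    ((hasDerivAt_const y x).prodMk ((hasDerivAt_id y).prodMk (hasDerivAt_const y z)))

lemma hasDerivAt_pd_two {L : ℝ} (u : Smooth L) (x y z : ℝ) :
    HasDerivAt (fun t => (u : R3 → ℂ) (x, y, t)) ((pd 2 u : R3 → ℂ) (x, y, z)) z :=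
  (hasFDerivAt_smooth u (x, y, z)).comp_hasDerivAt z
    ((hasDerivAt_const z x).prodMk ((hasDerivAt_const z y).prodMk (hasDerivAt_id z)))

lemma hasDerivAt_latExp (L : ℝ) (j : ℤ) (x : ℝ) :
    HasDerivAt (latExp L j) (Complex.I * (2 * Real.pi / L * j : ℝ) * latExp L j x) x := by
  have h := ((((hasDerivAt_id x).ofReal_comp).const_mul
    ((2 * Real.pi / L * j : ℝ) : ℂ)).const_mul Complex.I).cexp
  convert! h using 1
  simp only [latExp, id]
  push_cast
  ring

lemma pd_zero_sep (L : ℝ) (m : ℤ × ℤ) (g : ℝ → ℝ) (hg : ContDiff ℝ ∞ g) :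
    pd 0 (sep L m g hg) = (Complex.I * kx L m) • sep L m g hg := by
  ext ⟨x, y, z⟩
  refine (hasDerivAt_pd_zero (sep L m g hg) x y z).unique ?_
  have h := (((hasDerivAt_latExp L m.1 x).mul_const (latExp L m.2 y)).const_mul
    (1 / L : ℂ)).mul_const (g z : ℂ)
  simp only [sep_apply, phi_eq]
  convert! h using 1
  simp only [Submodule.coe_smul, Pi.smul_apply, sep_apply, phi_eq, kx, smul_eq_mul]
  ring

lemma pd_one_sep (L : ℝ) (m : ℤ × ℤ) (g : ℝ → ℝ) (hg : ContDiff ℝ ∞ g) :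
    pd 1 (sep L m g hg) = (Complex.I * ky L m) • sep L m g hg := by
  ext ⟨x, y, z⟩
  refine (hasDerivAt_pd_one (sep L m g hg) x y z).unique ?_
  have h := (((hasDerivAt_latExp L m.2 y).const_mul (latExp L m.1 x)).const_mul
    (1 / L : ℂ)).mul_const (g z : ℂ)
  simp only [sep_apply, phi_eq]
  convert! h using 1
  simp only [Submodule.coe_smul, Pi.smul_apply, sep_apply, phi_eq, ky, smul_eq_mul]
  ring

lemma pd_two_sep (L : ℝ) (m : ℤ × ℤ) (g g' : ℝ → ℝ) (hg : ContDiff ℝ ∞ g) (hg' : ContDiff ℝ ∞ g')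
    (hd : ∀ z, HasDerivAt g (g' z) z) : pd 2 (sep L m g hg) = sep L m g' hg' := by
  ext ⟨x, y, z⟩
  refine (hasDerivAt_pd_two (sep L m g hg) x y z).unique ?_
  exact ((hd z).ofReal_comp).const_mul (phi L m x y)

lemma smul_sep (L : ℝ) (m : ℤ × ℤ) (c : ℝ) (g : ℝ → ℝ) (hg : ContDiff ℝ ∞ g) :
    sep L m (fun z => c * g z) (contDiff_const.mul hg) = (c : ℂ) • sep L m g hg := by
  ext p
  simp only [Submodule.coe_smul, Pi.smul_apply, sep_apply, smul_eq_mul]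
  push_cast
  ring

/-- The formula includes `n = 0`, where `c_0` has another normalization, because the factor `ν_0` is
zero. -/
lemma hasDerivAt_sinMode (a : ℝ) (n : ℕ) (z : ℝ) :
    HasDerivAt (sinMode a n) (nu a n * cosMode a n z) z := by
  have h := (((hasDerivAt_id z).const_mul (nu a n)).sin).const_mul (Real.sqrt (2 / a))
  convert! h using 1
  rw [cosMode]
  split_ifs with hn
  · simp [hn, nu]
  · simp only [id]
    ring

lemma hasDerivAt_cosMode (a : ℝ) (n : ℕ) (z : ℝ) :
    HasDerivAt (cosMode a n) (-nu a n * sinMode a n z) z := by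
  by_cases hn : n = 0
  · have : cosMode a n = fun _ => (Real.sqrt a)⁻¹ := by
      funext z
      simp [cosMode, hn]
    rw [this]
    simpa [hn, nu] using hasDerivAt_const z (Real.sqrt a)⁻¹
  · have : cosMode a n = fun z => Real.sqrt (2 / a) * Real.cos (nu a n * z) := by
      funext z
      simp [cosMode, hn]
    rw [this]
    have h := (((hasDerivAt_id z).const_mul (nu a n)).cos).const_mul (Real.sqrt (2 / a))
    convert! h using 1
    simp only [id, sinMode]
    ring

lemma pd_two_dirichletMode (L a : ℝ) (m : ℤ × ℤ) (n : ℕ) :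
    pd 2 (dirichletMode L a m n) = (nu a n : ℂ) • neumannMode L a m n := by
  rw [dirichletMode_eq_sep, neumannMode_eq_sep, ← smul_sep]
  exact pd_two_sep _ _ _ _ _ _ (hasDerivAt_sinMode a n)

lemma pd_two_neumannMode (L a : ℝ) (m : ℤ × ℤ) (n : ℕ) :
    pd 2 (neumannMode L a m n) = (-nu a n : ℂ) • dirichletMode L a m n := by
  rw [dirichletMode_eq_sep, neumannMode_eq_sep, ← Complex.ofReal_neg, ← smul_sep]
  exact pd_two_sep _ _ _ _ _ _ (hasDerivAt_cosMode a n)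

lemma pd_zero_dirichletMode (L a : ℝ) (m : ℤ × ℤ) (n : ℕ) :
    pd 0 (dirichletMode L a m n) = (Complex.I * kx L m) • dirichletMode L a m n :=
  pd_zero_sep _ _ _ (contDiff_sinMode a n)

lemma pd_one_dirichletMode (L a : ℝ) (m : ℤ × ℤ) (n : ℕ) :
    pd 1 (dirichletMode L a m n) = (Complex.I * ky L m) • dirichletMode L a m n :=
  pd_one_sep _ _ _ (contDiff_sinMode a n)

lemma pd_zero_neumannMode (L a : ℝ) (m : ℤ × ℤ) (n : ℕ) :
    pd 0 (neumannMode L a m n) = (Complex.I * kx L m) • neumannMode L a m n :=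
  pd_zero_sep _ _ _ (contDiff_cosMode a n)

lemma pd_one_neumannMode (L a : ℝ) (m : ℤ × ℤ) (n : ℕ) :
    pd 1 (neumannMode L a m n) = (Complex.I * ky L m) • neumannMode L a m n :=
  pd_one_sep _ _ _ (contDiff_cosMode a n)

/-! ### Integration by parts -/

lemma integral_Ioo_deriv_eq_zero {b : ℝ} (hb : 0 < b) {f f' : ℝ → ℂ}
    (hd : ∀ t, HasDerivAt f (f' t) t) (hc : Continuous f') (h : f 0 = f b) :
    ∫ t in Ioo 0 b, f' t = 0 := by
  rw [← integral_Ioc_eq_integral_Ioo, ← intervalIntegral.integral_of_le hb.le,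
    intervalIntegral.integral_eq_sub_of_hasDerivAt (fun t _ => hd t)
      (hc.intervalIntegrable _ _), h, sub_self]

lemma integrable_smooth {L : ℝ} (a : ℝ) (u : Smooth L) :
    Integrable (u : R3 → ℂ) (slabMeasure L a) := (memLp_smooth a u).integrable (by norm_num)

lemma integrable_slice {L a : ℝ} {g : ℝ × ℝ → ℂ} (hg : Continuous g) :
    Integrable g ((volume.restrict (Ioo 0 L)).prod (volume.restrict (Ioo 0 a))) := by
  rw [Measure.prod_restrict]
  exact (hg.continuousOn.integrableOn_compact
    ((isCompact_Icc (a := (0 : ℝ)) (b := L)).prod (isCompact_Icc (a := (0 : ℝ)) (b := a)))).mono_set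
    (prod_mono Ioo_subset_Icc_self Ioo_subset_Icc_self)

/-- Fubini makes the differentiated variable the innermost one. Laterally the boundary values cancel
by periodicity, so a condition on the plates is required only for `i = 2`. -/
lemma integral_pd_eq_zero {L a : ℝ} (hL : 0 < L) (ha : 0 < a) (i : Fin 3) (u : Smooth L)
    (hu : i = 2 → ∀ p : R3, (p.2.2 = 0 ∨ p.2.2 = a) → (u : R3 → ℂ) p = 0) :
    ∫ p, (pd i u : R3 → ℂ) p ∂(slabMeasure L a) = 0 := by
  have hint := integrable_smooth a (pd i u)
  have hc : Continuous (pd i u : R3 → ℂ) := (pd i u).2.1.continuous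
  rw [slabMeasure_eq_prod] at hint ⊢
  obtain rfl | rfl | rfl : i = 0 ∨ i = 1 ∨ i = 2 := by fin_cases i <;> simp
  · rw [integral_prod_symm _ hint]
    refine integral_eq_zero_of_ae (Filter.Eventually.of_forall fun q => ?_)
    refine integral_Ioo_deriv_eq_zero hL (fun t => hasDerivAt_pd_zero u t q.1 q.2)
      (hc.comp (by fun_prop)) ?_
    have := u.2.2.1 (0, q.1, q.2)
    simp only [Prod.mk_add_mk, zero_add, add_zero] at this
    exact this.symm
  · rw [integral_prod _ hint]
    refine integral_eq_zero_of_ae (Filter.Eventually.of_forall fun x => ?_)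
    simp only
    rw [integral_prod_symm _ (integrable_slice (g := fun q => (pd 1 u : R3 → ℂ) (x, q))
      (hc.comp (Continuous.prodMk_right x)))]
    refine integral_eq_zero_of_ae (Filter.Eventually.of_forall fun z => ?_)
    refine integral_Ioo_deriv_eq_zero hL (fun t => hasDerivAt_pd_one u x t z)
      (hc.comp (by fun_prop)) ?_
    have := u.2.2.2 (x, 0, z)
    simpa using this.symm
  · rw [integral_prod _ hint]
    refine integral_eq_zero_of_ae (Filter.Eventually.of_forall fun x => ?_)
    simp only
    rw [integral_prod _ (integrable_slice (g := fun q => (pd 2 u : R3 → ℂ) (x, q))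
      (hc.comp (Continuous.prodMk_right x)))]
    refine integral_eq_zero_of_ae (Filter.Eventually.of_forall fun y => ?_)
    refine integral_Ioo_deriv_eq_zero ha (fun t => hasDerivAt_pd_two u x y t)
      (hc.comp (by fun_prop)) ?_
    rw [hu rfl (x, y, 0) (Or.inl rfl), hu rfl (x, y, a) (Or.inr rfl)]

/-- `conj u * v` -/
def conjMul {L : ℝ} (u v : Smooth L) : Smooth L :=
  ⟨fun p => (starRingEnd ℂ) ((u : R3 → ℂ) p) * (v : R3 → ℂ) p,
    (Complex.conjCLE.contDiff.comp u.2.1).mul v.2.1,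
    fun p => by simp only [u.2.2.1, v.2.2.1], fun p => by simp only [u.2.2.2, v.2.2.2]⟩

lemma pd_conjMul {L : ℝ} (i : Fin 3) (u v : Smooth L) :
    pd i (conjMul u v) = conjMul (pd i u) v + conjMul u (pd i v) := by
  ext p
  have h1 : HasFDerivAt (fun p => (starRingEnd ℂ) ((u : R3 → ℂ) p)) _ p :=
    (Complex.conjCLE.hasFDerivAt (x := (u : R3 → ℂ) p)).comp p (hasFDerivAt_smooth u p)
  have h := h1.mul (hasFDerivAt_smooth v p)
  have h2 : fderiv ℝ (conjMul u v : R3 → ℂ) p = _ := h.fderiv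
  rw [pd_apply, h2]
  simp only [conjMul, pd_apply, Submodule.coe_add, Pi.add_apply, add_apply,
    smul_apply, smul_eq_mul, ContinuousLinearMap.comp_apply]
  simp
  ring

/-- Integration by parts on the slab. -/
lemma inner_pd {L a : ℝ} (hL : 0 < L) (ha : 0 < a) (i : Fin 3) (u v : Smooth L)
    (h : i = 2 → ∀ p : R3, (p.2.2 = 0 ∨ p.2.2 = a) →
      (u : R3 → ℂ) p = 0 ∨ (v : R3 → ℂ) p = 0) :
    ⟪toL2 a (pd i u), toL2 a v⟫_ℂ = -⟪toL2 a u, toL2 a (pd i v)⟫_ℂ := by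
  have h0 := integral_pd_eq_zero hL ha i (conjMul u v) fun hi p hp => by
    rcases h hi p hp with h | h <;> simp [conjMul, h]
  rw [pd_conjMul] at h0
  rw [eq_neg_iff_add_eq_zero, inner_toL2, inner_toL2, ← h0]
  exact (integral_add (integrable_smooth a (conjMul (pd i u) v))
    (integrable_smooth a (conjMul u (pd i v)))).symm

lemma test_eq_zero {L a : ℝ} {φ : Smooth L} (hφ : φ ∈ Test L a) {p : R3}
    (hp : p.2.2 = 0 ∨ p.2.2 = a) : (φ : R3 → ℂ) p = 0 := by
  obtain ⟨δ, hδ, h⟩ := hφ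
  refine h p ?_
  rcases hp with hp | hp <;> rw [hp]
  · exact Or.inl hδ
  · exact Or.inr (by linarith)

/-! ### Approximation of separated functions by test functions -/

lemma norm_toL2_sq {L : ℝ} (a : ℝ) (u : Smooth L) :
    ‖toL2 a u‖ ^ 2 = ∫ p, ‖(u : R3 → ℂ) p‖ ^ 2 ∂(slabMeasure L a) := by
  have h := inner_toL2 a u u
  rw [inner_self_eq_ofReal] at h
  have h2 : ∀ p, (starRingEnd ℂ) ((u : R3 → ℂ) p) * (u : R3 → ℂ) p =
      ((‖(u : R3 → ℂ) p‖ ^ 2 : ℝ) : ℂ) := fun p => by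
    rw [Complex.conj_mul', Complex.ofReal_pow]
  simp only [h2, integral_complex_ofReal] at h
  exact_mod_cast h

lemma tendsto_toL2 {L a : ℝ} (u : ℕ → Smooth L) (v : Smooth L) (C : ℝ)
    (hC : ∀ k, ∀ p ∈ cell L a, ‖(u k : R3 → ℂ) p - (v : R3 → ℂ) p‖ ≤ C)
    (hp : ∀ p ∈ cell L a, Filter.Tendsto (fun k => (u k : R3 → ℂ) p) Filter.atTop
      (nhds ((v : R3 → ℂ) p))) :
    Filter.Tendsto (fun k => toL2 a (u k)) Filter.atTop (nhds (toL2 a v)) := by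
  rw [tendsto_iff_norm_sub_tendsto_zero]
  have h : Filter.Tendsto (fun k => ‖toL2 a (u k) - toL2 a v‖ ^ 2) Filter.atTop (nhds 0) := by
    simp only [← map_sub, norm_toL2_sq]
    rw [show (0 : ℝ) = ∫ p : R3, (0 : ℝ) ∂(slabMeasure L a) by simp]
    refine tendsto_integral_of_dominated_convergence (fun _ => C ^ 2) (fun k => ?_)
      (integrable_const _) (fun k => ?_) ?_
    · exact ((u k - v).2.1.continuous.norm.pow 2).aestronglyMeasurable
    · refine (ae_restrict_iff' (measurableSet_cell L a)).2 (Filter.Eventually.of_forall ?_)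
      intro p hpc
      rw [Real.norm_of_nonneg (by positivity)]
      gcongr
      exact hC k p hpc
    · refine (ae_restrict_iff' (measurableSet_cell L a)).2 (Filter.Eventually.of_forall ?_)
      intro p hpc
      have h1 := ((hp p hpc).sub_const ((v : R3 → ℂ) p)).norm.pow 2
      simpa using h1
  have h2 := h.sqrt
  simpa [Real.sqrt_sq (norm_nonneg _)] using h2

lemma tendsto_toL2_sep {L a : ℝ} (hL : 0 < L) (m : ℤ × ℤ) (g : ℕ → ℝ → ℝ) (g₀ : ℝ → ℝ)
    (hg : ∀ k, ContDiff ℝ ∞ (g k)) (hg₀ : ContDiff ℝ ∞ g₀) (C : ℝ)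
    (hC : ∀ k, ∀ z ∈ Ioo 0 a, |g k z - g₀ z| ≤ C)
    (hp : ∀ z ∈ Ioo 0 a, Filter.Tendsto (fun k => g k z) Filter.atTop (nhds (g₀ z))) :
    Filter.Tendsto (fun k => toL2 a (sep L m (g k) (hg k))) Filter.atTop
      (nhds (toL2 a (sep L m g₀ hg₀))) := by
  refine tendsto_toL2 _ _ (1 / L * C) (fun k p hpc => ?_) fun p hpc => ?_
  · rw [sep_apply, sep_apply, ← mul_sub, norm_mul, norm_phi hL, ← Complex.ofReal_sub,
      Complex.norm_real]
    gcongr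
    exact hC k _ hpc.2.2
  · exact ((Complex.continuous_ofReal.tendsto _).comp (hp _ hpc.2.2)).const_mul _

lemma deriv_smoothTransition_of_one_lt {w : ℝ} (hw : 1 < w) : deriv Real.smoothTransition w = 0 := by
  have h1 : Real.smoothTransition =ᶠ[nhds w] fun _ => 1 := by
    filter_upwards [Ioi_mem_nhds hw] with t ht
    exact Real.smoothTransition.one_of_one_le (le_of_lt ht)
  rw [h1.deriv_eq, deriv_const]

lemma exists_bound_deriv_smoothTransition : ∃ M, ∀ w, |deriv Real.smoothTransition w| ≤ M := by
  have hcont : Continuous (deriv Real.smoothTransition) :=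
    (Real.smoothTransition.contDiff (n := 1)).continuous_deriv (by norm_num)
  obtain ⟨M, hM⟩ := (isCompact_Icc (a := (0 : ℝ)) (b := 1)).exists_bound_of_continuousOn
    hcont.continuousOn
  refine ⟨max M 0, fun w => ?_⟩
  by_cases hw : w ∈ Icc (0 : ℝ) 1
  · exact (hM w hw).trans (le_max_left _ _)
  · have : deriv Real.smoothTransition w = 0 := by
      rw [mem_Icc, not_and_or, not_le, not_le] at hw
      rcases hw with hw | hw
      · have h1 : Real.smoothTransition =ᶠ[nhds w] fun _ => 0 := by
          filter_upwards [Iio_mem_nhds hw] with t ht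
          exact Real.smoothTransition.zero_of_nonpos (le_of_lt ht)
        rw [h1.deriv_eq, deriv_const]
      · exact deriv_smoothTransition_of_one_lt hw
    rw [this, abs_zero]
    exact le_max_right _ _

/-- A smooth cut-off that vanishes within `1 / (k + 1)` of the ends of `(0, a)`. -/
def cutoff (a : ℝ) (k : ℕ) (z : ℝ) : ℝ :=
  Real.smoothTransition ((k + 1) * z - 1) * Real.smoothTransition ((k + 1) * (a - z) - 1)

/-- The derivative of the cut-off. -/
def cutoffDeriv (a : ℝ) (k : ℕ) (z : ℝ) : ℝ :=
  (k + 1) * deriv Real.smoothTransition ((k + 1) * z - 1) *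
      Real.smoothTransition ((k + 1) * (a - z) - 1) -
    Real.smoothTransition ((k + 1) * z - 1) *
      ((k + 1) * deriv Real.smoothTransition ((k + 1) * (a - z) - 1))

lemma contDiff_smoothTransition : ContDiff ℝ ∞ Real.smoothTransition :=
  Real.smoothTransition.contDiff

lemma contDiff_deriv_smoothTransition : ContDiff ℝ ∞ (deriv Real.smoothTransition) :=
  (contDiff_infty_iff_deriv.1 contDiff_smoothTransition).2

lemma contDiff_cutoff (a : ℝ) (k : ℕ) : ContDiff ℝ ∞ (cutoff a k) :=
  (contDiff_smoothTransition.comp (by fun_prop)).mul (contDiff_smoothTransition.comp (by fun_prop))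

lemma contDiff_cutoffDeriv (a : ℝ) (k : ℕ) : ContDiff ℝ ∞ (cutoffDeriv a k) :=
  ((contDiff_const.mul (contDiff_deriv_smoothTransition.comp (by fun_prop))).mul
    (contDiff_smoothTransition.comp (by fun_prop))).sub
    ((contDiff_smoothTransition.comp (by fun_prop)).mul
      (contDiff_const.mul (contDiff_deriv_smoothTransition.comp (by fun_prop))))

lemma hasDerivAt_cutoff (a : ℝ) (k : ℕ) (z : ℝ) :
    HasDerivAt (cutoff a k) (cutoffDeriv a k z) z := by
  have hst : ∀ w, HasDerivAt Real.smoothTransition (deriv Real.smoothTransition w) w := fun w =>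
    (contDiff_smoothTransition.differentiable (by simp) w).hasDerivAt
  have h1 : HasDerivAt (fun z : ℝ => (k + 1 : ℝ) * z - 1) ((k + 1 : ℝ) * 1) z :=
    ((hasDerivAt_id z).const_mul _).sub_const _
  have h2 : HasDerivAt (fun z : ℝ => (k + 1 : ℝ) * (a - z) - 1) ((k + 1 : ℝ) * (-1)) z :=
    (((hasDerivAt_id z).const_sub a).const_mul _).sub_const _
  have h := ((hst _).comp z h1).mul ((hst _).comp z h2)
  convert! h using 1
  rw [cutoffDeriv]
  simp only [Function.comp]
  ring

lemma cutoff_nonneg (a : ℝ) (k : ℕ) (z : ℝ) : 0 ≤ cutoff a k z :=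
  mul_nonneg (Real.smoothTransition.nonneg _) (Real.smoothTransition.nonneg _)

lemma cutoff_le_one (a : ℝ) (k : ℕ) (z : ℝ) : cutoff a k z ≤ 1 :=
  mul_le_one₀ (Real.smoothTransition.le_one _) (Real.smoothTransition.nonneg _)
    (Real.smoothTransition.le_one _)

lemma cutoff_eq_zero (a : ℝ) (k : ℕ) {z : ℝ} (hz : z < 1 / (k + 1 : ℝ) ∨ a - 1 / (k + 1 : ℝ) < z) :
    cutoff a k z = 0 := by
  have hk : (0 : ℝ) < k + 1 := by positivity
  rw [cutoff, mul_eq_zero]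
  refine hz.imp (fun h => ?_) fun h => ?_
  · rw [lt_div_iff₀ hk] at h
    exact Real.smoothTransition.zero_of_nonpos (by linarith)
  · have h' : a - z < 1 / (k + 1 : ℝ) := by linarith
    rw [lt_div_iff₀ hk] at h'
    exact Real.smoothTransition.zero_of_nonpos (by linarith)

lemma eventually_cutoff {a z : ℝ} (hz : z ∈ Ioo 0 a) :
    ∀ᶠ k : ℕ in Filter.atTop, cutoff a k z = 1 ∧ cutoffDeriv a k z = 0 := by
  have h : ∀ t : ℝ, 0 < t → ∀ᶠ k : ℕ in Filter.atTop, 1 < ((k : ℝ) + 1) * t - 1 := fun t ht => by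
    filter_upwards [(tendsto_natCast_atTop_atTop (R := ℝ)).eventually_gt_atTop (2 / t)] with k hk
    rw [div_lt_iff₀ ht] at hk
    linarith
  filter_upwards [h z hz.1, h (a - z) (by linarith [hz.2])] with k h1 h2
  rw [cutoff, cutoffDeriv, Real.smoothTransition.one_of_one_le h1.le,
    Real.smoothTransition.one_of_one_le h2.le, deriv_smoothTransition_of_one_lt h1,
    deriv_smoothTransition_of_one_lt h2]
  simp

/-- The derivative is of size `k + 1`, but it lives where the distance to one of the plates is at
most `2 / (k + 1)`. Multiplication by the distance `t` to the plates thus bounds it uniformly in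
`k`. -/
lemma exists_bound_cutoffDeriv (a : ℝ) : ∃ M, ∀ k, ∀ z ∈ Ioo 0 a, ∀ t : ℝ, 0 ≤ t → t ≤ z →
    t ≤ a - z → |cutoffDeriv a k z| * t ≤ M := by
  obtain ⟨M, hM⟩ := exists_bound_deriv_smoothTransition
  have hM0 : 0 ≤ M := (abs_nonneg _).trans (hM 0)
  -- Each of the two factors of the cut-off contributes `2 M`.
  refine ⟨4 * M, fun k z hz t ht0 htz hta => ?_⟩
  have key : ∀ s : ℝ, 0 < s → t ≤ s →
      (k + 1 : ℝ) * |deriv Real.smoothTransition ((k + 1) * s - 1)| * t ≤ 2 * M := fun s hs hts => by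
    by_cases h : 1 < ((k : ℝ) + 1) * s - 1
    · rw [deriv_smoothTransition_of_one_lt h]
      simpa using hM0
    · have h1 : ((k : ℝ) + 1) * t ≤ 2 := by
        have : ((k : ℝ) + 1) * t ≤ (k + 1) * s := by gcongr
        linarith
      calc _ = ((k : ℝ) + 1) * t * |deriv Real.smoothTransition ((k + 1) * s - 1)| := by ring
        _ ≤ 2 * M := by gcongr; exact hM _
  have h1 := key z hz.1 htz
  have h2 := key (a - z) (by linarith [hz.2]) hta
  have hk : (0 : ℝ) ≤ k + 1 := by positivity
  have hst : ∀ w, |Real.smoothTransition w| ≤ 1 := fun w => by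
    rw [abs_of_nonneg (Real.smoothTransition.nonneg w)]
    exact Real.smoothTransition.le_one w
  have h3 : |cutoffDeriv a k z| ≤ (k + 1 : ℝ) * |deriv Real.smoothTransition ((k + 1) * z - 1)| +
      (k + 1 : ℝ) * |deriv Real.smoothTransition ((k + 1) * (a - z) - 1)| := by
    refine (abs_sub _ _).trans (add_le_add ?_ ?_)
    · rw [abs_mul, abs_mul, abs_of_nonneg hk]
      exact mul_le_of_le_one_right (by positivity) (hst _)
    · rw [abs_mul, abs_mul, abs_of_nonneg hk]
      exact mul_le_of_le_one_left (by positivity) (hst _)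
  calc _ ≤ _ := mul_le_mul_of_nonneg_right h3 ht0
    _ ≤ 4 * M := by rw [add_mul]; linarith

/-- The mean value inequality from each endpoint; this linear decay compensates the growth of the
derivative of the cut-off. -/
lemma exists_abs_le_of_vanishing {a : ℝ} {g g' : ℝ → ℝ} (hd : ∀ z, HasDerivAt g (g' z) z)
    (hg' : Continuous g') (h0 : g 0 = 0) (h1 : g a = 0) :
    ∃ S, 0 ≤ S ∧ ∀ z ∈ Ioo 0 a, |g z| ≤ S * min z (a - z) := by
  obtain ⟨S, hS⟩ := (isCompact_Icc (a := (0 : ℝ)) (b := a)).exists_bound_of_continuousOn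
    hg'.continuousOn
  have key : ∀ x ∈ Icc 0 a, ∀ y ∈ Icc 0 a, |g y - g x| ≤ S * |y - x| := fun x hx y hy =>
    (convex_Icc 0 a).norm_image_sub_le_of_norm_hasDerivWithin_le
      (fun z _ => (hd z).hasDerivWithinAt) hS hx hy
  by_cases ha : 0 ≤ a
  · have hS0 : 0 ≤ S := (norm_nonneg _).trans (hS 0 (by simpa using ha))
    refine ⟨S, hS0, fun z hz => ?_⟩
    rw [mul_min_of_nonneg _ _ hS0, le_min_iff]
    have e1 := key 0 (by simpa using ha) z (Ioo_subset_Icc_self hz)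
    have e2 := key a (by simpa using ha) z (Ioo_subset_Icc_self hz)
    rw [h0, sub_zero, sub_zero, abs_of_pos hz.1] at e1
    rw [h1, sub_zero, abs_sub_comm z a, abs_of_pos (sub_pos.2 hz.2)] at e2
    exact ⟨e1, e2⟩
  · exact ⟨0, le_rfl, fun z hz => absurd (hz.1.trans hz.2).le ha⟩

/-- The separated function `φ_m g` cut off near the plates. -/
def cutSep (L a : ℝ) (m : ℤ × ℤ) (g : ℝ → ℝ) (hg : ContDiff ℝ ∞ g) (k : ℕ) : Smooth L :=
  sep L m (fun z => cutoff a k z * g z) ((contDiff_cutoff a k).mul hg)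

lemma cutSep_mem_test (L a : ℝ) (m : ℤ × ℤ) (g : ℝ → ℝ) (hg : ContDiff ℝ ∞ g) (k : ℕ) :
    cutSep L a m g hg k ∈ Test L a :=
  ⟨1 / (k + 1 : ℝ), by positivity, fun p hp => by
    rw [cutSep, sep_apply, cutoff_eq_zero a k hp]
    simp⟩

lemma exists_bound_Ioo {a : ℝ} {g : ℝ → ℝ} (hg : Continuous g) :
    ∃ C, ∀ z ∈ Ioo 0 a, |g z| ≤ C := by
  obtain ⟨C, hC⟩ := (isCompact_Icc (a := (0 : ℝ)) (b := a)).exists_bound_of_continuousOn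
    hg.continuousOn
  exact ⟨C, fun z hz => hC z (Ioo_subset_Icc_self hz)⟩

lemma abs_cutoff_mul_sub_le (a : ℝ) (k : ℕ) (z t : ℝ) : |cutoff a k z * t - t| ≤ |t| := by
  rw [show cutoff a k z * t - t = -((1 - cutoff a k z) * t) by ring, abs_neg, abs_mul,
    abs_of_nonneg (sub_nonneg.2 (cutoff_le_one a k z))]
  exact mul_le_of_le_one_left (abs_nonneg _) (by linarith [cutoff_nonneg a k z])

lemma tendsto_cutSep {L a : ℝ} (hL : 0 < L) (m : ℤ × ℤ) (g : ℝ → ℝ) (hg : ContDiff ℝ ∞ g) :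
    Filter.Tendsto (fun k => toL2 a (cutSep L a m g hg k)) Filter.atTop
      (nhds (toL2 a (sep L m g hg))) := by
  obtain ⟨C, hC⟩ := exists_bound_Ioo (a := a) hg.continuous
  refine tendsto_toL2_sep hL m _ g _ hg C
    (fun k z hz => (abs_cutoff_mul_sub_le a k z _).trans (hC z hz)) fun z hz => ?_
  refine tendsto_const_nhds.congr' ?_
  filter_upwards [eventually_cutoff hz] with k hk
  rw [hk.1, one_mul]

/-- The cut-off depends on `z` only and commutes with lateral derivatives, so `g` need not vanish at
the plates. This is what lets cosine modes be used laterally. -/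
lemma tendsto_pd_cutSep {L a : ℝ} (hL : 0 < L) (m : ℤ × ℤ) (g : ℝ → ℝ) (hg : ContDiff ℝ ∞ g)
    {i : Fin 3} (hi : i ≠ 2) :
    Filter.Tendsto (fun k => toL2 a (pd i (cutSep L a m g hg k))) Filter.atTop
      (nhds (toL2 a (pd i (sep L m g hg)))) := by
  obtain rfl | rfl : i = 0 ∨ i = 1 := by fin_cases i <;> simp_all
  · simp only [cutSep, pd_zero_sep, map_smul]
    exact (tendsto_cutSep hL m g hg).const_smul _
  · simp only [cutSep, pd_one_sep, map_smul]
    exact (tendsto_cutSep hL m g hg).const_smul _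

/-- Besides `χ_k g'` there is the term `χ_k' g`. It is bounded uniformly in `k`, since `g` decays
linearly at the plates, and at each interior point it is eventually zero; dominated convergence
applies. -/
lemma tendsto_pd_two_cutSep {L a : ℝ} (hL : 0 < L) (m : ℤ × ℤ) (g g' : ℝ → ℝ)
    (hg : ContDiff ℝ ∞ g) (hg' : ContDiff ℝ ∞ g') (hd : ∀ z, HasDerivAt g (g' z) z)
    (h0 : g 0 = 0) (h1 : g a = 0) :
    Filter.Tendsto (fun k => toL2 a (pd 2 (cutSep L a m g hg k))) Filter.atTop
      (nhds (toL2 a (pd 2 (sep L m g hg)))) := by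
  rw [pd_two_sep L m g g' hg hg' hd]
  have hk : ∀ k, pd 2 (cutSep L a m g hg k) =
      sep L m (fun z => cutoffDeriv a k z * g z + cutoff a k z * g' z)
        (((contDiff_cutoffDeriv a k).mul hg).add ((contDiff_cutoff a k).mul hg')) := fun k =>
    pd_two_sep L m _ _ _ _ fun z => (hasDerivAt_cutoff a k z).mul (hd z)
  simp only [hk]
  obtain ⟨C, hC⟩ := exists_bound_Ioo (a := a) hg'.continuous
  obtain ⟨M, hM⟩ := exists_bound_cutoffDeriv a
  obtain ⟨S, hS0, hS⟩ := exists_abs_le_of_vanishing hd hg'.continuous h0 h1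
  refine tendsto_toL2_sep hL m _ g' _ hg' (S * M + C) (fun k z hz => ?_) fun z hz => ?_
  · rw [add_sub_assoc]
    refine (abs_add_le _ _).trans (add_le_add ?_
      ((abs_cutoff_mul_sub_le a k z _).trans (hC z hz)))
    rw [abs_mul]
    calc _ ≤ |cutoffDeriv a k z| * (S * min z (a - z)) := by gcongr; exact hS z hz
      _ = S * (|cutoffDeriv a k z| * min z (a - z)) := by ring
      _ ≤ S * M := by
        gcongr
        exact hM k z hz _ (le_min hz.1.le (by linarith [hz.2])) (min_le_left _ _)
          (min_le_right _ _)
  · refine tendsto_const_nhds.congr' ?_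
    filter_upwards [eventually_cutoff hz] with k hk
    rw [hk.1, hk.2]
    ring

lemma sinMode_zero (a : ℝ) (n : ℕ) : sinMode a n 0 = 0 := by simp [sinMode]

lemma sinMode_end {a : ℝ} (ha : 0 < a) (n : ℕ) : sinMode a n a = 0 := by
  rw [sinMode, nu, div_mul_cancel₀ _ ha.ne', mul_comm Real.pi, Real.sin_nat_mul_pi, mul_zero]

lemma dirichletMode_eq_zero {L a : ℝ} (ha : 0 < a) (m : ℤ × ℤ) (n : ℕ) {p : R3}
    (hp : p.2.2 = 0 ∨ p.2.2 = a) : (dirichletMode L a m n : R3 → ℂ) p = 0 := by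
  rw [dirichletMode_eq_sep, sep_apply]
  rcases hp with hp | hp <;> rw [hp]
  · simp [sinMode_zero]
  · simp [sinMode_end ha]

/-- Test functions that approximate `d_{m,n}` in `H¹`. -/
lemma tendsto_pd_cutSep_sinMode {L a : ℝ} (hL : 0 < L) (ha : 0 < a) (m : ℤ × ℤ) (n : ℕ)
    (i : Fin 3) :
    Filter.Tendsto (fun k => toL2 a (pd i (cutSep L a m _ (contDiff_sinMode a n) k))) Filter.atTop
      (nhds (toL2 a (pd i (dirichletMode L a m n)))) := by
  by_cases hi : i = 2
  · subst hi
    exact tendsto_pd_two_cutSep hL m _ _ _ (contDiff_const.mul (contDiff_cosMode a n))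
      (hasDerivAt_sinMode a n) (sinMode_zero a n) (sinMode_end ha n)
  · exact tendsto_pd_cutSep hL m _ _ hi

/-! ### The Dirichlet Laplacian -/

variable {L a : ℝ}

lemma toL2V_apply (F : Fin 3 → Smooth L) (i : Fin 3) : toL2V a F i = toL2 a (F i) := rfl

lemma inner_toL2V_left (F : Fin 3 → Smooth L) (E : L2V L a) :
    ⟪toL2V a F, E⟫_ℂ = ⟪toL2 a (F 0), E 0⟫_ℂ + ⟪toL2 a (F 1), E 1⟫_ℂ + ⟪toL2 a (F 2), E 2⟫_ℂ := by
  rw [PiLp.inner_apply, Fin.sum_univ_three]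
  rfl

lemma tendsto_toL2V (F : ℕ → Fin 3 → Smooth L) (G : Fin 3 → Smooth L)
    (h : ∀ i, Filter.Tendsto (fun k => toL2 a (F k i)) Filter.atTop (nhds (toL2 a (G i)))) :
    Filter.Tendsto (fun k => toL2V a (F k)) Filter.atTop (nhds (toL2V a G)) :=
  ((PiLp.continuous_toLp 2 (fun _ : Fin 3 => L2 L a)).tendsto _).comp (tendsto_pi_nhds.2 h)

/-- The eigenvalues `λ_{m,n}` with `n ≥ 1`. -/
def eigD (L a : ℝ) (p : (ℤ × ℤ) × ℕ+) : ℝ≥0 := kSq L p.1 + nuSq a p.2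

lemma coe_kSq_add_nuSq (L a : ℝ) (m : ℤ × ℤ) (n : ℕ) :
    ((kSq L m + nuSq a n : ℝ≥0) : ℝ) = kx L m ^ 2 + ky L m ^ 2 + nu a n ^ 2 := rfl

/-- Integration by parts moves both derivatives onto the mode; the boundary term vanishes through
`φ`, and the mode satisfies `-Δ d = λ d`. -/
lemma inner_smoothGrad_dirichletMode (hL : 0 < L) (ha : 0 < a) (m : ℤ × ℤ) (n : ℕ) (φ : Smooth L)
    (hφ : ∀ p : R3, (p.2.2 = 0 ∨ p.2.2 = a) → (φ : R3 → ℂ) p = 0) :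
    ⟪toL2V a (smoothGrad (dirichletMode L a m n)), toL2V a (smoothGrad φ)⟫_ℂ =
      (((kSq L m + nuSq a n : ℝ≥0) : ℝ) : ℂ) * ⟪toL2 a (dirichletMode L a m n), toL2 a φ⟫_ℂ := by
  have h : ∀ i, ⟪toL2 a (pd i (dirichletMode L a m n)), toL2 a (pd i φ)⟫_ℂ =
      -⟪toL2 a (pd i (pd i (dirichletMode L a m n))), toL2 a φ⟫_ℂ := fun i => by
    rw [inner_pd hL ha i _ φ fun _ p hp => Or.inr (hφ p hp), neg_neg]
  rw [inner_toL2V_left]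
  simp only [toL2V_apply, smoothGrad, LinearMap.pi_apply, h]
  simp only [pd_zero_dirichletMode, pd_one_dirichletMode, pd_two_dirichletMode, map_smul,
    pd_two_neumannMode, inner_smul_left, map_mul, map_neg, Complex.conj_I, Complex.conj_ofReal,
    coe_kSq_add_nuSq]
  push_cast
  linear_combination (((kx L m : ℂ) ^ 2 + (ky L m : ℂ) ^ 2) *
    ⟪toL2 a (dirichletMode L a m n), toL2 a φ⟫_ℂ) * (-Complex.I_sq)

lemma grad_dirichletMode_mem (hL : 0 < L) (ha : 0 < a) (m : ℤ × ℤ) (n : ℕ) :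
    (toL2 a (dirichletMode L a m n), toL2V a (smoothGrad (dirichletMode L a m n))) ∈
      dirichletGraph L a := by
  refine mem_closure_of_tendsto (f := fun k =>
    (toL2 a (cutSep L a m _ (contDiff_sinMode a n) k),
      toL2V a (smoothGrad (cutSep L a m _ (contDiff_sinMode a n) k)))) (b := Filter.atTop) ?_
    (Filter.Eventually.of_forall fun k => ?_)
  · exact (tendsto_cutSep hL m _ _).prodMk_nhds
      (tendsto_toL2V _ _ fun i => tendsto_pd_cutSep_sinMode hL ha m n i)
  · exact ⟨_, cutSep_mem_test _ _ _ _ _ _, rfl⟩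

lemma orthonormal_dirichletMode (hL : 0 < L) (ha : 0 < a) :
    Orthonormal ℂ fun p : (ℤ × ℤ) × ℕ+ => toL2 a (dirichletMode L a p.1 p.2) := by
  classical
  rw [orthonormal_iff_ite]
  rintro ⟨m, n⟩ ⟨m', n'⟩
  refine (inner_dirichletMode hL ha m m' n.2).trans (if_congr ?_ rfl rfl)
  constructor
  · rintro ⟨rfl, h⟩
    exact Prod.ext rfl (PNat.coe_injective h)
  · intro h
    exact ⟨congrArg Prod.fst h, congrArg (fun p => (p.2 : ℕ)) h⟩

/-- The modes `d_{m,n}` form a Hilbert basis. -/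
def dirichletBasis (hL : 0 < L) (ha : 0 < a) : HilbertBasis ((ℤ × ℤ) × ℕ+) ℂ (L2 L a) :=
  HilbertBasis.mkOfOrthogonalEqBot (orthonormal_dirichletMode hL ha) (by
    rw [Submodule.eq_bot_iff]
    intro x hx
    exact eq_zero_of_inner_dirichletMode hL ha x fun m n hn =>
      hx _ (Submodule.subset_span ⟨(m, ⟨n, hn⟩), rfl⟩))

lemma dirichletBasis_apply (hL : 0 < L) (ha : 0 < a) (p : (ℤ × ℤ) × ℕ+) :
    dirichletBasis hL ha p = toL2 a (dirichletMode L a p.1 p.2) := by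
  rw [dirichletBasis, HilbertBasis.coe_mkOfOrthogonalEqBot]

lemma dirichletLaplacian_isDiagonal (hL : 0 < L) (ha : 0 < a) :
    IsDiagonal (dirichletLaplacian L a) (dirichletBasis hL ha)
      fun p => ((eigD L a p : ℝ) : ℂ) := by
  refine formOperator_isDiagonal _ (Submodule.isClosed_topologicalClosure _) _ _
    (fun p => toL2V a (smoothGrad (dirichletMode L a p.1 p.2))) (fun p => ?_) fun p q hq => ?_
  · rw [dirichletBasis_apply]
    exact grad_dirichletMode_mem hL ha _ _
  · rw [dirichletBasis_apply]
    -- The weak eigenvector equation is a closed condition on pairs, so it suffices to check it on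
    -- test functions.
    refine closure_minimal (t := {q : L2 L a × L2V L a |
      ⟪toL2V a (smoothGrad (dirichletMode L a p.1 p.2)), q.2⟫_ℂ =
      ((eigD L a p : ℝ) : ℂ) * ⟪toL2 a (dirichletMode L a p.1 p.2), q.1⟫_ℂ}) ?_
      (isClosed_eq (by fun_prop) (by fun_prop)) hq
    rintro _ ⟨φ, hφ, rfl⟩
    exact inner_smoothGrad_dirichletMode hL ha _ _ φ fun p hp => test_eq_zero hφ hp

/-! ### The Neumann Laplacian -/

lemma isClosed_neumannGraph : IsClosed (neumannGraph L a : Set (L2 L a × L2V L a)) := by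
  change IsClosed {p : L2 L a × L2V L a | ∀ φ ∈ Test L a, ∀ i : Fin 3,
    ⟪toL2 a φ, p.2 i⟫_ℂ = -⟪toL2 a (pd i φ), p.1⟫_ℂ}
  simp only [Set.ofPred_forall]
  exact isClosed_iInter fun φ => isClosed_iInter fun _ => isClosed_iInter fun i =>
    isClosed_eq (by fun_prop) (by fun_prop)

lemma grad_neumannMode_mem (hL : 0 < L) (ha : 0 < a) (m : ℤ × ℤ) (n : ℕ) :
    (toL2 a (neumannMode L a m n), toL2V a (smoothGrad (neumannMode L a m n))) ∈
      neumannGraph L a := fun φ hφ i => by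
  rw [toL2V_apply]
  simp only [smoothGrad, LinearMap.pi_apply]
  rw [inner_pd hL ha i φ _ fun _ p hp => Or.inl (test_eq_zero hφ hp), neg_neg]

/-- The modes `u_{m,n}` are admissible in the tangential weak derivatives. -/
lemma inner_neumannMode_of_mem (hL : 0 < L) {q : L2 L a × L2V L a} (hq : q ∈ neumannGraph L a)
    (m : ℤ × ℤ) (n : ℕ) {i : Fin 3} (hi : i ≠ 2) :
    ⟪toL2 a (neumannMode L a m n), q.2 i⟫_ℂ = -⟪toL2 a (pd i (neumannMode L a m n)), q.1⟫_ℂ := by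
  have h1 := (tendsto_cutSep (a := a) hL m _ (contDiff_cosMode a n)).inner
    (tendsto_const_nhds (x := q.2 i)) (𝕜 := ℂ)
  have h2 := ((tendsto_pd_cutSep (a := a) hL m _ (contDiff_cosMode a n) hi).inner
    (tendsto_const_nhds (x := q.1)) (𝕜 := ℂ)).neg
  refine tendsto_nhds_unique h1 (h2.congr fun k => ?_)
  exact (hq _ (cutSep_mem_test _ _ _ _ _ _) i).symm

/-- A sine mode is a limit of test functions in all three derivatives, so it may be used as a test
function even for the normal weak derivative. -/
lemma inner_dirichletMode_of_mem (hL : 0 < L) (ha : 0 < a) {q : L2 L a × L2V L a}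
    (hq : q ∈ neumannGraph L a) (m : ℤ × ℤ) (n : ℕ) (i : Fin 3) :
    ⟪toL2 a (dirichletMode L a m n), q.2 i⟫_ℂ =
      -⟪toL2 a (pd i (dirichletMode L a m n)), q.1⟫_ℂ := by
  have h1 := (tendsto_cutSep (a := a) hL m _ (contDiff_sinMode a n)).inner
    (tendsto_const_nhds (x := q.2 i)) (𝕜 := ℂ)
  have h2 := ((tendsto_pd_cutSep_sinMode hL ha m n i).inner
    (tendsto_const_nhds (x := q.1)) (𝕜 := ℂ)).neg
  refine tendsto_nhds_unique h1 (h2.congr fun k => ?_)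
  exact (hq _ (cutSep_mem_test _ _ _ _ _ _) i).symm

lemma orthonormal_neumannMode (hL : 0 < L) (ha : 0 < a) :
    Orthonormal ℂ fun p : (ℤ × ℤ) × ℕ => toL2 a (neumannMode L a p.1 p.2) := by
  classical
  rw [orthonormal_iff_ite]
  rintro ⟨m, n⟩ ⟨m', n'⟩
  rw [inner_neumannMode hL ha]
  simp only [Prod.ext_iff]

/-- The modes `u_{m,n}` form a Hilbert basis. -/
def neumannBasis (hL : 0 < L) (ha : 0 < a) : HilbertBasis ((ℤ × ℤ) × ℕ) ℂ (L2 L a) :=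
  HilbertBasis.mkOfOrthogonalEqBot (orthonormal_neumannMode hL ha) (by
    rw [Submodule.eq_bot_iff]
    intro x hx
    exact eq_zero_of_inner_neumannMode hL ha x fun m n =>
      hx _ (Submodule.subset_span ⟨(m, n), rfl⟩))

lemma neumannBasis_apply (hL : 0 < L) (ha : 0 < a) (p : (ℤ × ℤ) × ℕ) :
    neumannBasis hL ha p = toL2 a (neumannMode L a p.1 p.2) := by
  rw [neumannBasis, HilbertBasis.coe_mkOfOrthogonalEqBot]

/-- The eigenvalues `λ_{m,n}` with `n ≥ 0`. -/
def eigFull (L a : ℝ) (p : (ℤ × ℤ) × ℕ) : ℝ≥0 := kSq L p.1 + nuSq a p.2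

lemma coe_eigFull (p : (ℤ × ℤ) × ℕ) :
    (eigFull L a p : ℝ) = kx L p.1 ^ 2 + ky L p.1 ^ 2 + nu a p.2 ^ 2 := rfl

/-- Membership in the form domain imposes no boundary condition. The equation still holds because
`∂_z u_{m,n} = -ν_n d_{m,n}` is a sine mode, admissible in the normal direction, while the lateral
derivatives of `u_{m,n}` are multiples of `u_{m,n}`, admissible in the lateral ones. -/
lemma neumannLaplacian_isDiagonal (hL : 0 < L) (ha : 0 < a) :
    IsDiagonal (neumannLaplacian L a) (neumannBasis hL ha)
      fun p => ((eigFull L a p : ℝ) : ℂ) := by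
  refine formOperator_isDiagonal (neumannGraph L a) isClosed_neumannGraph _ (eigFull L a)
    (fun p => toL2V a (smoothGrad (neumannMode L a p.1 p.2))) (fun p => ?_) fun p q hq => ?_
  · rw [neumannBasis_apply]
    exact grad_neumannMode_mem hL ha _ _
  · rw [neumannBasis_apply, inner_toL2V_left]
    simp only [smoothGrad, LinearMap.pi_apply, pd_zero_neumannMode, pd_one_neumannMode,
      pd_two_neumannMode, map_smul, inner_smul_left, inner_dirichletMode_of_mem hL ha hq,
      inner_neumannMode_of_mem hL hq p.1 p.2 (show (0 : Fin 3) ≠ 2 by decide),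
      inner_neumannMode_of_mem hL hq p.1 p.2 (show (1 : Fin 3) ≠ 2 by decide),
      pd_two_dirichletMode, map_mul, map_neg, Complex.conj_I, Complex.conj_ofReal,
      coe_eigFull]
    push_cast
    linear_combination (((kx L p.1 : ℂ) ^ 2 + (ky L p.1 : ℂ) ^ 2) *
      ⟪toL2 a (neumannMode L a p.1 p.2), q.1⟫_ℂ) * (-Complex.I_sq)

/-! ### The reduced Neumann Laplacian -/

lemma mem_graph_partOf {H : Type*} [NormedAddCommGroup H] [InnerProductSpace ℂ H]
    (A : H →ₗ.[ℂ] H) (M : Submodule ℂ H) (x y : M) :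
    (x, y) ∈ (partOf A M).graph ↔ ((x : H), (y : H)) ∈ A.graph := by
  rw [partOf, Submodule.toLinearPMap_graph_eq]
  · rfl
  · rintro ⟨x, y⟩ hxy hx
    have hxy' : ((x : H), (y : H)) ∈ A.graph := hxy
    simp only at hx
    exact Subtype.ext (A.graph_fst_eq_zero_snd hxy' (by rw [hx]; rfl))

instance completeSpace_HN' : CompleteSpace (HN' L a) :=
  inferInstanceAs (CompleteSpace (ℂ ∙ toL2 a (neumannMode L a 0 0))ᗮ)

/-- The labels `(m, n) ≠ (0, 0)`. -/
abbrev NIndex : Type := ((ℤ × ℤ) × ℕ+) ⊕ {m : ℤ × ℤ // m ≠ 0}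

/-- The label as a pair `(m, n)`. -/
def NIndex.pos : NIndex → (ℤ × ℤ) × ℕ := Sum.elim (fun p => (p.1, p.2)) fun m => (m, 0)

lemma NIndex.pos_ne_zero (i : NIndex) : i.pos ≠ 0 := by
  rcases i with ⟨m, n⟩ | ⟨m, hm⟩
  · intro h
    exact n.2.ne' (congrArg Prod.snd h)
  · intro h
    exact hm (congrArg Prod.fst h)

lemma NIndex.pos_injective : Function.Injective NIndex.pos := by
  rintro (⟨m, n⟩ | ⟨m, hm⟩) (⟨m', n'⟩ | ⟨m', hm'⟩) h
  · obtain rfl : m = m' := congrArg Prod.fst h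
    obtain rfl : n = n' := PNat.coe_injective (congrArg Prod.snd h)
    rfl
  · exact absurd (congrArg Prod.snd h) n.2.ne'
  · exact absurd (congrArg Prod.snd h).symm n'.2.ne'
  · obtain rfl : m = m' := congrArg Prod.fst h
    rfl

lemma NIndex.exists_pos_eq {p : (ℤ × ℤ) × ℕ} (hp : p ≠ 0) : ∃ i : NIndex, i.pos = p := by
  obtain ⟨m, n⟩ := p
  rcases Nat.eq_zero_or_pos n with rfl | hn
  · exact ⟨Sum.inr ⟨m, fun h => hp (by rw [h]; rfl)⟩, rfl⟩
  · exact ⟨Sum.inl (m, ⟨n, hn⟩), rfl⟩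

/-- The eigenvalues `λ_{m,n}` with `(m, n) ≠ (0, 0)`. -/
def eigN (L a : ℝ) : NIndex → ℝ≥0 := Sum.elim (eigD L a) fun m => kSq L m

lemma nuSq_zero (a : ℝ) : nuSq a 0 = 0 := by
  apply NNReal.coe_injective
  simp [nuSq, nu]
  rfl

lemma eigN_eq (i : NIndex) : eigN L a i = eigFull L a i.pos := by
  rcases i with i | i
  · rfl
  · simp [eigN, eigFull, NIndex.pos, nuSq_zero]

lemma neumannMode_mem_HN' (hL : 0 < L) (ha : 0 < a) (i : NIndex) :
    toL2 a (neumannMode L a i.pos.1 i.pos.2) ∈ HN' L a := by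
  rw [HN', Submodule.mem_orthogonal_singleton_iff_inner_right, inner_neumannMode hL ha, if_neg]
  rintro ⟨h1, h2⟩
  exact i.pos_ne_zero (Prod.ext h1.symm h2.symm)

lemma orthonormal_reducedNeumannMode (hL : 0 < L) (ha : 0 < a) :
    Orthonormal ℂ fun i : NIndex => (⟨_, neumannMode_mem_HN' hL ha i⟩ : HN' L a) := by
  have h := (orthonormal_neumannMode hL ha).comp _ NIndex.pos_injective
  exact ⟨fun i => h.1 i, fun i j hij => h.2 hij⟩

/-- The modes `u_{m,n}` with `(m, n) ≠ (0, 0)` form a Hilbert basis of `u_{0,0}^⊥`. -/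
def reducedNeumannBasis (hL : 0 < L) (ha : 0 < a) : HilbertBasis NIndex ℂ (HN' L a) :=
  HilbertBasis.mkOfOrthogonalEqBot (orthonormal_reducedNeumannMode hL ha) (by
    rw [Submodule.eq_bot_iff]
    intro x hx
    refine Subtype.ext (eq_zero_of_inner_neumannMode hL ha x fun m n => ?_)
    by_cases h : (m, n) = (0 : (ℤ × ℤ) × ℕ)
    · obtain ⟨rfl, rfl⟩ := Prod.ext_iff.1 h
      exact Submodule.mem_orthogonal_singleton_iff_inner_right.1 x.2
    · obtain ⟨i, hi⟩ := NIndex.exists_pos_eq h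
      have := hx _ (Submodule.subset_span (mem_range_self i))
      rw [Submodule.coe_inner] at this
      simpa only [hi] using this)

lemma reducedNeumannBasis_apply (hL : 0 < L) (ha : 0 < a) (i : NIndex) :
    (reducedNeumannBasis hL ha i : L2 L a) = toL2 a (neumannMode L a i.pos.1 i.pos.2) := by
  rw [reducedNeumannBasis, HilbertBasis.coe_mkOfOrthogonalEqBot]

lemma reducedNeumann_isDiagonal (hL : 0 < L) (ha : 0 < a) :
    IsDiagonal (reducedNeumann L a) (reducedNeumannBasis hL ha)
      fun i => ((eigN L a i : ℝ) : ℂ) := by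
  intro x y
  rw [reducedNeumann, mem_graph_partOf, neumannLaplacian_isDiagonal hL ha]
  simp only [Submodule.coe_inner, reducedNeumannBasis_apply, neumannBasis_apply, eigN_eq]
  refine ⟨fun h i => h i.pos, fun h p => ?_⟩
  by_cases hp : p = 0
  · subst hp
    -- The condition at the removed label is `0 = 0`, because both `x` and `y` are orthogonal to
    -- `u_{0,0}`.
    have h0 : ∀ z : HN' L a, ⟪toL2 a (neumannMode L a (0 : (ℤ × ℤ) × ℕ).1 (0 : (ℤ × ℤ) × ℕ).2),
        (z : L2 L a)⟫_ℂ = 0 := fun z =>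
      Submodule.mem_orthogonal_singleton_iff_inner_right.1 z.2
    rw [h0, h0, mul_zero]
  · obtain ⟨i, rfl⟩ := NIndex.exists_pos_eq hp
    exact h i

/-! ### The curl of smooth fields -/

lemma smoothCurl_zero (F : Fin 3 → Smooth L) : smoothCurl F 0 = pd 1 (F 2) - pd 2 (F 1) := rfl

lemma smoothCurl_one (F : Fin 3 → Smooth L) : smoothCurl F 1 = pd 2 (F 0) - pd 0 (F 2) := rfl

lemma smoothCurl_two (F : Fin 3 → Smooth L) : smoothCurl F 2 = pd 0 (F 1) - pd 1 (F 0) := rfl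

/-- Green's formula for the curl; only the second field satisfies the boundary condition. -/
lemma inner_smoothCurl (hL : 0 < L) (ha : 0 < a) (C G : Fin 3 → Smooth L)
    (hG : G ∈ smoothPEC L a) :
    ⟪toL2V a C, toL2V a (smoothCurl G)⟫_ℂ = ⟪toL2V a (smoothCurl C), toL2V a G⟫_ℂ := by
  have h : ∀ (i : Fin 3) (u v : Smooth L), (i = 2 → ∀ p : R3, (p.2.2 = 0 ∨ p.2.2 = a) →
      (v : R3 → ℂ) p = 0) → ⟪toL2 a u, toL2 a (pd i v)⟫_ℂ = -⟪toL2 a (pd i u), toL2 a v⟫_ℂ :=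
    fun i u v hv => by
      rw [inner_pd hL ha i u v fun hi p hp => Or.inr (hv hi p hp), neg_neg]
  simp only [inner_toL2V_left, toL2V_apply, smoothCurl_zero, smoothCurl_one, smoothCurl_two,
    map_sub, inner_sub_left, inner_sub_right]
  rw [h 1 (C 0) (G 2) (by simp), h 2 (C 0) (G 1) fun _ p hp => (hG p hp).2,
    h 2 (C 1) (G 0) fun _ p hp => (hG p hp).1, h 0 (C 1) (G 2) (by simp),
    h 0 (C 2) (G 1) (by simp), h 1 (C 2) (G 0) (by simp)]
  ring

lemma smoothPEC_mem_curlGraph (hL : 0 < L) (ha : 0 < a) {F : Fin 3 → Smooth L}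
    (hF : F ∈ smoothPEC L a) : (toL2V a F, toL2V a (smoothCurl F)) ∈ curlGraph L a := by
  refine ⟨fun φ hφ i => ?_, Submodule.le_topologicalClosure _ ⟨F, hF, rfl⟩⟩
  have h : ∀ (i : Fin 3) (v : Smooth L),
      ⟪toL2 a (pd i φ), toL2 a v⟫_ℂ = -⟪toL2 a φ, toL2 a (pd i v)⟫_ℂ := fun i v =>
    inner_pd hL ha i φ v fun _ p hp => Or.inl (test_eq_zero hφ hp)
  simp only [toL2V_apply, h]
  have h2 : smoothCurl F i = pd (i + 1) (F (i + 2)) - pd (i + 2) (F (i + 1)) := rfl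
  rw [h2, map_sub, inner_sub_right]
  ring

lemma isDivFree_toL2V (hL : 0 < L) (ha : 0 < a) {F : Fin 3 → Smooth L}
    (hF : pd 0 (F 0) + pd 1 (F 1) + pd 2 (F 2) = 0) : IsDivFree (toL2V a F) := by
  intro φ hφ
  have h : ∀ (i : Fin 3) (v : Smooth L),
      ⟪toL2 a (pd i φ), toL2 a v⟫_ℂ = -⟪toL2 a φ, toL2 a (pd i v)⟫_ℂ := fun i v =>
    inner_pd hL ha i φ v fun _ p hp => Or.inl (test_eq_zero hφ hp)
  simp only [toL2V_apply, h, Fin.sum_univ_three]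
  rw [← neg_add, ← neg_add, neg_neg, ← inner_add_right, ← inner_add_right, ← map_add, ← map_add,
    hF, map_zero, inner_zero_right]

lemma smoothPEC_mem_VPEC (hL : 0 < L) (ha : 0 < a) {F : Fin 3 → Smooth L}
    (hF : F ∈ smoothPEC L a) (hdiv : pd 0 (F 0) + pd 1 (F 1) + pd 2 (F 2) = 0) :
    toL2V a F ∈ VPEC L a :=
  ⟨⟨_, smoothPEC_mem_curlGraph hL ha hF, rfl⟩, isDivFree_toL2V hL ha hdiv⟩

lemma isClosed_isDivFree : IsClosed {E : L2V L a | IsDivFree E} := by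
  simp only [IsDivFree, Set.ofPred_forall]
  exact isClosed_iInter fun φ => isClosed_iInter fun _ => isClosed_eq (by fun_prop) (by fun_prop)

lemma isClosed_curlGraph : IsClosed (curlGraph L a : Set (L2V L a × L2V L a)) := by
  refine IsClosed.inter (s₁ := {p : L2V L a × L2V L a | IsWeakCurl p.1 p.2}) ?_
    (Submodule.isClosed_topologicalClosure _)
  simp only [IsWeakCurl, Set.ofPred_forall]
  exact isClosed_iInter fun φ => isClosed_iInter fun _ => isClosed_iInter fun i =>
    isClosed_eq (by fun_prop) (by fun_prop)

lemma mem_maxwellGraph {q : Hphys L a × L2V L a} :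
    q ∈ maxwellGraph L a ↔ ((q.1 : L2V L a), q.2) ∈ curlGraph L a ∧ IsDivFree (q.1 : L2V L a) :=
  ⟨fun h => ⟨h.1, h.2.2⟩, fun h => ⟨h.1, ⟨_, h.1, rfl⟩, h.2⟩⟩

lemma isClosed_maxwellGraph : IsClosed (maxwellGraph L a : Set (Hphys L a × L2V L a)) := by
  have : (maxwellGraph L a : Set (Hphys L a × L2V L a)) =
      (fun q : Hphys L a × L2V L a => ((q.1 : L2V L a), q.2)) ⁻¹' (curlGraph L a) ∩
        (fun q : Hphys L a × L2V L a => (q.1 : L2V L a)) ⁻¹' {E | IsDivFree E} := by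
    ext q
    exact mem_maxwellGraph
  rw [this]
  exact (isClosed_curlGraph.preimage (by fun_prop)).inter (isClosed_isDivFree.preimage (by fun_prop))

/-- The constraint is tested against fixed `L²` functions, so it survives the `L²`-closure of the
form domain. -/
lemma isDivFree_of_mem_Hphys {E : L2V L a} (hE : E ∈ Hphys L a) : IsDivFree E :=
  closure_minimal (s := (VPEC L a : Set (L2V L a))) (fun _ h => h.2) isClosed_isDivFree hE.1

instance completeSpace_Hphys : CompleteSpace (Hphys L a) :=
  (((Submodule.isClosed_topologicalClosure _).inter
    (Submodule.isClosed_orthogonal _) : IsClosed (Hphys L a : Set (L2V L a)))).completeSpace_coe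

/-! ### Separated fields -/

/-- The field `(c₀ d_{m,n}, c₁ d_{m,n}, c₂ u_{m,n})`. -/
def sepField (L a : ℝ) (p : (ℤ × ℤ) × ℕ) (c : Fin 3 → ℂ) : Fin 3 → Smooth L :=
  ![c 0 • dirichletMode L a p.1 p.2, c 1 • dirichletMode L a p.1 p.2, c 2 • neumannMode L a p.1 p.2]

lemma sepField_zero (p : (ℤ × ℤ) × ℕ) (c : Fin 3 → ℂ) :
    sepField L a p c 0 = c 0 • dirichletMode L a p.1 p.2 := rfl

lemma sepField_one (p : (ℤ × ℤ) × ℕ) (c : Fin 3 → ℂ) :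
    sepField L a p c 1 = c 1 • dirichletMode L a p.1 p.2 := rfl

lemma sepField_two (p : (ℤ × ℤ) × ℕ) (c : Fin 3 → ℂ) :
    sepField L a p c 2 = c 2 • neumannMode L a p.1 p.2 := rfl

/-- The symbol of the divergence on separated fields. -/
def IsSolenoidal (L a : ℝ) (p : (ℤ × ℤ) × ℕ) (c : Fin 3 → ℂ) : Prop :=
  Complex.I * kx L p.1 * c 0 + Complex.I * ky L p.1 * c 1 = nu a p.2 * c 2

lemma sepField_mem_smoothPEC (ha : 0 < a) (p : (ℤ × ℤ) × ℕ) (c : Fin 3 → ℂ) :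
    sepField L a p c ∈ smoothPEC L a := fun q hq => by
  simp [sepField_zero, sepField_one, dirichletMode_eq_zero ha p.1 p.2 hq]

lemma div_sepField {p : (ℤ × ℤ) × ℕ} {c : Fin 3 → ℂ} (hc : IsSolenoidal L a p c) :
    pd 0 (sepField L a p c 0) + pd 1 (sepField L a p c 1) + pd 2 (sepField L a p c 2) = 0 := by
  simp only [sepField_zero, sepField_one, sepField_two, map_smul, pd_zero_dirichletMode,
    pd_one_dirichletMode, pd_two_neumannMode, smul_smul, ← add_smul]
  rw [IsSolenoidal] at hc
  rw [show c 0 * (Complex.I * kx L p.1) + c 1 * (Complex.I * ky L p.1) + c 2 * -nu a p.2 = 0 by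
    linear_combination hc, zero_smul]

/-- This is `curl curl = grad div - Δ` at the level of symbols: the multiples of `hc` below are the
gradient of the vanishing divergence. -/
lemma smoothCurl_smoothCurl_sepField {p : (ℤ × ℤ) × ℕ} {c : Fin 3 → ℂ}
    (hc : IsSolenoidal L a p c) :
    smoothCurl (smoothCurl (sepField L a p c)) =
      ((eigFull L a p : ℝ) : ℂ) • sepField L a p c := by
  have hI := Complex.I_sq
  rw [IsSolenoidal] at hc
  rw [coe_eigFull]
  funext i
  obtain rfl | rfl | rfl : i = 0 ∨ i = 1 ∨ i = 2 := by fin_cases i <;> simp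
  all_goals
    simp only [smoothCurl_zero, smoothCurl_one, smoothCurl_two, Pi.smul_apply, sepField_zero,
      sepField_one, sepField_two, map_smul, pd_zero_dirichletMode, pd_one_dirichletMode,
      pd_two_dirichletMode, pd_zero_neumannMode, pd_one_neumannMode, pd_two_neumannMode,
      smul_smul, ← sub_smul]
    congr 1
    push_cast
  · linear_combination (-(ky L p.1 : ℂ) ^ 2 * c 0 - (kx L p.1 : ℂ) ^ 2 * c 0) * hI +
      Complex.I * kx L p.1 * hc
  · linear_combination (-(ky L p.1 : ℂ) ^ 2 * c 1 - (kx L p.1 : ℂ) ^ 2 * c 1) * hI +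
      Complex.I * ky L p.1 * hc
  · linear_combination (-(ky L p.1 : ℂ) ^ 2 * c 2 - (kx L p.1 : ℂ) ^ 2 * c 2) * hI +
      nu a p.2 * hc

lemma inner_sepField_left (p : (ℤ × ℤ) × ℕ) (c : Fin 3 → ℂ) (E : L2V L a) :
    ⟪toL2V a (sepField L a p c), E⟫_ℂ =
      (starRingEnd ℂ) (c 0) * ⟪toL2 a (dirichletMode L a p.1 p.2), E 0⟫_ℂ +
      (starRingEnd ℂ) (c 1) * ⟪toL2 a (dirichletMode L a p.1 p.2), E 1⟫_ℂ +
      (starRingEnd ℂ) (c 2) * ⟪toL2 a (neumannMode L a p.1 p.2), E 2⟫_ℂ := by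
  simp only [inner_toL2V_left, sepField_zero, sepField_one, sepField_two, map_smul,
    inner_smul_left]

/-- The hypothesis on `c` is needed because `d_{m,0} = 0`: at `n = 0` the lateral amplitudes
describe nothing and would spoil the formula. -/
lemma inner_sepField (hL : 0 < L) (ha : 0 < a) (p q : (ℤ × ℤ) × ℕ) (c d : Fin 3 → ℂ)
    (hc : p.2 = 0 → c 0 = 0 ∧ c 1 = 0) :
    ⟪toL2V a (sepField L a p c), toL2V a (sepField L a q d)⟫_ℂ =
      if p = q then (starRingEnd ℂ) (c 0) * d 0 + (starRingEnd ℂ) (c 1) * d 1 +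
        (starRingEnd ℂ) (c 2) * d 2 else 0 := by
  rw [inner_sepField_left]
  simp only [toL2V_apply, sepField_zero, sepField_one, sepField_two, map_smul, inner_smul_right,
    inner_neumannMode hL ha]
  rcases Nat.eq_zero_or_pos p.2 with hp | hp
  · obtain ⟨h0, h1⟩ := hc hp
    rw [h0, h1]
    by_cases h : p = q
    · simp [h]
    · have h' := h
      rw [Prod.ext_iff] at h'
      simp [h, h']
  · rw [inner_dirichletMode hL ha _ _ hp]
    by_cases h : p = q
    · simp [h]
    · have h' := h
      rw [Prod.ext_iff] at h'
      simp [h, h']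

/-- Writing `h₀` as the separated field with label `(0, 0)` makes orthogonality to it a matter of
labels. -/
lemma staticMode_eq (hL : 0 < L) : staticMode L a = toL2V a (sepField L a 0 ![0, 0, 1]) := by
  rw [staticMode]
  congr 1
  funext i
  obtain rfl | rfl | rfl : i = 0 ∨ i = 1 ∨ i = 2 := by fin_cases i <;> simp
  · simp [sepField_zero]
  · simp [sepField_one]
  · ext p
    have h : ((neumannMode L a 0 0 : Smooth L) : R3 → ℂ) p = ((Real.sqrt (L ^ 2 * a))⁻¹ : ℝ) := by
      rw [neumannMode_eq_sep, sep_apply, phi, cosMode, if_pos rfl, Real.sqrt_mul (sq_nonneg L),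
        Real.sqrt_sq hL.le]
      simp [kx, ky]
      ring
    simpa [sepField_two, constS] using h.symm

/-! ### The Maxwell modes -/

/-- The labels of the Maxwell modes. -/
abbrev MIndex : Type := ((ℤ × ℤ) × ℕ+) ⊕ NIndex

/-- The label as a pair `(m, n)`. -/
def MIndex.pos : MIndex → (ℤ × ℤ) × ℕ := Sum.elim (fun p => (p.1, p.2)) NIndex.pos

lemma MIndex.pos_ne_zero (i : MIndex) : i.pos ≠ 0 := by
  rcases i with p | i
  · exact NIndex.pos_ne_zero (Sum.inl p)
  · exact i.pos_ne_zero

/-- The eigenvalues of the Maxwell operator. -/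
def eigM (L a : ℝ) : MIndex → ℝ≥0 := Sum.elim (eigD L a) (eigN L a)

lemma eigM_eq (i : MIndex) : eigM L a i = eigFull L a i.pos := by
  rcases i with i | i
  · rfl
  · exact eigN_eq i

/-- The polarization of the TE modes, and of the mode `E^x` when `m = 0`. -/
def polTE (L : ℝ) (m : ℤ × ℤ) : Fin 3 → ℂ :=
  if m = 0 then ![1, 0, 0] else
    ![((-(ky L m) / kAbs L m : ℝ) : ℂ), ((kx L m / kAbs L m : ℝ) : ℂ), 0]

/-- The polarization of the TM modes, and of the mode `E^y` when `m = 0`. -/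
def polTM (L a : ℝ) (m : ℤ × ℤ) (n : ℕ) : Fin 3 → ℂ :=
  if m = 0 then ![0, 1, 0] else
    ![-Complex.I * ((nu a n / sqrtLam L a m n * (kx L m / kAbs L m) : ℝ) : ℂ),
      -Complex.I * ((nu a n / sqrtLam L a m n * (ky L m / kAbs L m) : ℝ) : ℂ),
      ((kAbs L m / sqrtLam L a m n : ℝ) : ℂ)]

/-- The polarization of the Maxwell modes. -/
def pol (L a : ℝ) : MIndex → Fin 3 → ℂ :=
  Sum.elim (fun p => polTE L p.1) (Sum.elim (fun p => polTM L a p.1 p.2) fun _ => ![0, 0, 1])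

/-- The Maxwell modes. -/
def maxwellMode (L a : ℝ) (i : MIndex) : L2V L a := toL2V a (sepField L a i.pos (pol L a i))

lemma maxwellMode_te {m : ℤ × ℤ} (hm : m ≠ 0) (n : ℕ+) :
    maxwellMode L a (Sum.inl (m, n)) = modeTE L a m n := by
  have h : pol L a (Sum.inl (m, n)) =
      ![((-(ky L m) / kAbs L m : ℝ) : ℂ), ((kx L m / kAbs L m : ℝ) : ℂ), 0] := if_neg hm
  rw [maxwellMode, modeTE, h, sepField]
  simp only [Matrix.cons_val_zero, Matrix.cons_val_one, Matrix.cons_val, zero_smul]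
  rfl

lemma maxwellMode_tm {m : ℤ × ℤ} (hm : m ≠ 0) (n : ℕ+) :
    maxwellMode L a (Sum.inr (Sum.inl (m, n))) = modeTM L a m n := by
  have h : pol L a (Sum.inr (Sum.inl (m, n))) =
      ![-Complex.I * ((nu a n / sqrtLam L a m n * (kx L m / kAbs L m) : ℝ) : ℂ),
      -Complex.I * ((nu a n / sqrtLam L a m n * (ky L m / kAbs L m) : ℝ) : ℂ),
      ((kAbs L m / sqrtLam L a m n : ℝ) : ℂ)] := if_neg hm
  rw [maxwellMode, modeTM, h, sepField]
  rfl

lemma maxwellMode_x (n : ℕ+) : maxwellMode L a (Sum.inl (0, n)) = modeX L a n := by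
  have h : pol L a (Sum.inl (0, n)) = ![1, 0, 0] := by simp [pol, polTE]
  rw [maxwellMode, modeX, h, sepField]
  simp only [Matrix.cons_val_zero, Matrix.cons_val_one, Matrix.cons_val, zero_smul, one_smul]
  rfl

lemma maxwellMode_y (n : ℕ+) : maxwellMode L a (Sum.inr (Sum.inl (0, n))) = modeY L a n := by
  have h : pol L a (Sum.inr (Sum.inl (0, n))) = ![0, 1, 0] := by simp [pol, polTM]
  rw [maxwellMode, modeY, h, sepField]
  simp only [Matrix.cons_val_zero, Matrix.cons_val_one, Matrix.cons_val, zero_smul, one_smul]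
  rfl

lemma maxwellMode_normal (m : {m : ℤ × ℤ // m ≠ 0}) :
    maxwellMode L a (Sum.inr (Sum.inr m)) = modeNormal L a m := by
  have h : pol L a (Sum.inr (Sum.inr m)) = ![0, 0, 1] := rfl
  rw [maxwellMode, modeNormal, h, sepField]
  simp only [Matrix.cons_val_zero, Matrix.cons_val_one, Matrix.cons_val, zero_smul, one_smul]
  rfl

lemma kAbs_sq (L : ℝ) (m : ℤ × ℤ) : kAbs L m ^ 2 = kx L m ^ 2 + ky L m ^ 2 :=
  Real.sq_sqrt (kSq L m).2

lemma kAbs_ne_zero (hL : 0 < L) {m : ℤ × ℤ} (hm : m ≠ 0) : kAbs L m ≠ 0 := by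
  intro h
  have h1 := kAbs_sq L m
  rw [h] at h1
  have hx : kx L m = 0 := by nlinarith [sq_nonneg (kx L m), sq_nonneg (ky L m)]
  have hy : ky L m = 0 := by nlinarith [sq_nonneg (kx L m), sq_nonneg (ky L m)]
  have hc : 2 * Real.pi / L ≠ 0 := by positivity
  simp only [kx, ky, mul_eq_zero, hc, false_or, Int.cast_eq_zero] at hx hy
  exact hm (Prod.ext hx hy)

lemma sqrtLam_sq (L a : ℝ) (m : ℤ × ℤ) (n : ℕ) :
    sqrtLam L a m n ^ 2 = kAbs L m ^ 2 + nu a n ^ 2 := by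
  rw [kAbs_sq]
  exact Real.sq_sqrt (kSq L m + nuSq a n).2

lemma sqrtLam_ne_zero (hL : 0 < L) {m : ℤ × ℤ} (hm : m ≠ 0) (n : ℕ) : sqrtLam L a m n ≠ 0 := by
  intro h
  have h1 := sqrtLam_sq L a m n
  rw [h] at h1
  have h2 : 0 < kAbs L m ^ 2 := by
    have := kAbs_ne_zero hL hm
    positivity
  nlinarith [sq_nonneg (nu a n)]

lemma kx_zero (L : ℝ) : kx L 0 = 0 := by simp [kx]

lemma ky_zero (L : ℝ) : ky L 0 = 0 := by simp [ky]

lemma isSolenoidal_pol (hL : 0 < L) (i : MIndex) : IsSolenoidal L a i.pos (pol L a i) := by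
  rw [IsSolenoidal]
  rcases i with ⟨m, n⟩ | ⟨m, n⟩ | m
  · by_cases hm : m = 0
    · subst hm
      simp [pol, polTE, MIndex.pos, kx_zero, ky_zero]
    · simp only [pol, polTE, MIndex.pos, Sum.elim_inl, if_neg hm, Matrix.cons_val_zero,
        Matrix.cons_val_one, Matrix.cons_val]
      push_cast
      ring
  · by_cases hm : m = 0
    · subst hm
      simp [pol, polTM, MIndex.pos, NIndex.pos, kx_zero, ky_zero]
    · have hk : (kAbs L m : ℂ) ≠ 0 := by exact_mod_cast kAbs_ne_zero hL hm
      have hl : (sqrtLam L a m n : ℂ) ≠ 0 := by exact_mod_cast sqrtLam_ne_zero hL hm n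
      have hk2 : (kAbs L m : ℂ) ^ 2 = kx L m ^ 2 + ky L m ^ 2 := by exact_mod_cast kAbs_sq L m
      simp only [pol, polTM, MIndex.pos, NIndex.pos, Sum.elim_inl, Sum.elim_inr, if_neg hm,
        Matrix.cons_val_zero, Matrix.cons_val_one, Matrix.cons_val]
      push_cast
      field_simp
      rw [hk2]
      linear_combination -nu a n * ((kx L m : ℂ) ^ 2 + ky L m ^ 2) * Complex.I_sq
  · simp [pol, MIndex.pos, NIndex.pos, nu]

lemma pol_eq_zero (i : MIndex) (h : i.pos.2 = 0) : pol L a i 0 = 0 ∧ pol L a i 1 = 0 := by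
  rcases i with ⟨m, n⟩ | ⟨m, n⟩ | m
  · exact absurd h n.2.ne'
  · exact absurd h n.2.ne'
  · exact ⟨rfl, rfl⟩

/-- The Hermitian product of two polarizations. -/
def polInner (c d : Fin 3 → ℂ) : ℂ :=
  (starRingEnd ℂ) (c 0) * d 0 + (starRingEnd ℂ) (c 1) * d 1 + (starRingEnd ℂ) (c 2) * d 2

lemma conj_polInner (c d : Fin 3 → ℂ) : (starRingEnd ℂ) (polInner c d) = polInner d c := by
  simp only [polInner, map_add, map_mul, Complex.conj_conj]
  ring

lemma polInner_polTE (hL : 0 < L) (m : ℤ × ℤ) : polInner (polTE L m) (polTE L m) = 1 := by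
  by_cases hm : m = 0
  · simp [polInner, polTE, hm]
  · have hk : (kAbs L m : ℂ) ≠ 0 := by exact_mod_cast kAbs_ne_zero hL hm
    have hk2 : (kAbs L m : ℂ) ^ 2 = kx L m ^ 2 + ky L m ^ 2 := by exact_mod_cast kAbs_sq L m
    simp only [polInner, polTE, if_neg hm, Matrix.cons_val_zero, Matrix.cons_val_one,
      Matrix.cons_val, Complex.conj_ofReal, map_zero]
    push_cast
    field_simp
    rw [hk2]
    ring

lemma polInner_polTM (hL : 0 < L) (m : ℤ × ℤ) (n : ℕ) :
    polInner (polTM L a m n) (polTM L a m n) = 1 := by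
  by_cases hm : m = 0
  · simp [polInner, polTM, hm]
  · have hk : (kAbs L m : ℂ) ≠ 0 := by exact_mod_cast kAbs_ne_zero hL hm
    have hk2 : (kAbs L m : ℂ) ^ 2 = kx L m ^ 2 + ky L m ^ 2 := by exact_mod_cast kAbs_sq L m
    have hl : (sqrtLam L a m n : ℂ) ≠ 0 := by exact_mod_cast sqrtLam_ne_zero hL hm n
    have hl2 : (sqrtLam L a m n : ℂ) ^ 2 = kAbs L m ^ 2 + nu a n ^ 2 := by
      exact_mod_cast sqrtLam_sq L a m n
    simp only [polInner, polTM, if_neg hm, Matrix.cons_val_zero, Matrix.cons_val_one,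
      Matrix.cons_val, Complex.conj_ofReal, map_mul, map_neg, Complex.conj_I]
    push_cast
    field_simp
    linear_combination (-(nu a n : ℂ) ^ 2 * (kx L m ^ 2 + ky L m ^ 2)) * Complex.I_sq -
      (nu a n : ℂ) ^ 2 * hk2 - (kAbs L m : ℂ) ^ 2 * hl2

lemma polInner_polTE_polTM (m : ℤ × ℤ) (n : ℕ) : polInner (polTE L m) (polTM L a m n) = 0 := by
  by_cases hm : m = 0
  · simp [polInner, polTE, polTM, hm]
  · simp only [polInner, polTE, polTM, if_neg hm, Matrix.cons_val_zero, Matrix.cons_val_one,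
      Matrix.cons_val, Complex.conj_ofReal, map_zero]
    push_cast
    ring

/-- Two Maxwell labels over the same `(m, n)` are either equal or form a TE/TM pair with `n ≥ 1`; `n
= 0` carries a single polarization. -/
lemma polInner_pol (hL : 0 < L) (i j : MIndex) (h : i.pos = j.pos) :
    polInner (pol L a i) (pol L a j) = if i = j then 1 else 0 := by
  rcases i with p | i <;> rcases j with q | j
  · have hpq : p = q := by
      simpa using NIndex.pos_injective (a₁ := Sum.inl p) (a₂ := Sum.inl q) h
    subst hpq
    rw [if_pos rfl]
    exact polInner_polTE hL p.1
  · obtain rfl : Sum.inl p = j := NIndex.pos_injective (a₁ := Sum.inl p) h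
    rw [if_neg Sum.inl_ne_inr]
    exact polInner_polTE_polTM p.1 p.2
  · obtain rfl : i = Sum.inl q := NIndex.pos_injective (a₂ := Sum.inl q) h
    rw [if_neg Sum.inr_ne_inl, ← conj_polInner]
    have : polInner (pol L a (Sum.inl q)) (pol L a (Sum.inr (Sum.inl q))) = 0 :=
      polInner_polTE_polTM q.1 q.2
    rw [this, map_zero]
  · obtain rfl : i = j := NIndex.pos_injective h
    rw [if_pos rfl]
    rcases i with p | m
    · exact polInner_polTM hL p.1 p.2
    · simp [polInner, pol]

lemma maxwellMode_mem_VPEC (hL : 0 < L) (ha : 0 < a) (i : MIndex) :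
    maxwellMode L a i ∈ VPEC L a :=
  smoothPEC_mem_VPEC hL ha (sepField_mem_smoothPEC ha _ _) (div_sepField (isSolenoidal_pol hL i))

lemma maxwellMode_mem_Hphys (hL : 0 < L) (ha : 0 < a) (i : MIndex) :
    maxwellMode L a i ∈ Hphys L a := by
  refine ⟨Submodule.le_topologicalClosure _ (maxwellMode_mem_VPEC hL ha i),
    Submodule.mem_orthogonal_singleton_iff_inner_right.2 ?_⟩
  rw [staticMode_eq hL, maxwellMode,
    inner_sepField hL ha _ _ _ _ (by simp), if_neg i.pos_ne_zero.symm]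

lemma orthonormal_maxwellMode (hL : 0 < L) (ha : 0 < a) :
    Orthonormal ℂ fun i : MIndex => (⟨_, maxwellMode_mem_Hphys hL ha i⟩ : Hphys L a) := by
  classical
  rw [orthonormal_iff_ite]
  intro i j
  rw [Submodule.coe_inner]
  change ⟪maxwellMode L a i, maxwellMode L a j⟫_ℂ = _
  rw [maxwellMode, maxwellMode, inner_sepField hL ha _ _ _ _ (pol_eq_zero i)]
  by_cases h : i.pos = j.pos
  · rw [if_pos h]
    exact polInner_pol hL i j h
  · rw [if_neg h, if_neg fun h' => h (congrArg _ h')]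

/-- The divergence constraint on the coefficients of a field in `H_phys`. -/
lemma coeff_div_eq_zero (hL : 0 < L) (ha : 0 < a) {E : L2V L a} (hE : IsDivFree E) (m : ℤ × ℤ)
    (n : ℕ) :
    -Complex.I * kx L m * ⟪toL2 a (dirichletMode L a m n), E 0⟫_ℂ +
      -Complex.I * ky L m * ⟪toL2 a (dirichletMode L a m n), E 1⟫_ℂ +
      nu a n * ⟪toL2 a (neumannMode L a m n), E 2⟫_ℂ = 0 := by
  -- The constraint is known for test functions only; the cut-off sine modes pass it to `d_{m,n}`.
  have h : ∀ i, Filter.Tendsto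
      (fun k => ⟪toL2 a (pd i (cutSep L a m _ (contDiff_sinMode a n) k)), E i⟫_ℂ) Filter.atTop
      (nhds ⟪toL2 a (pd i (dirichletMode L a m n)), E i⟫_ℂ) := fun i =>
    (tendsto_pd_cutSep_sinMode hL ha m n i).inner tendsto_const_nhds
  have hs : ⟪toL2 a (pd 0 (dirichletMode L a m n)), E 0⟫_ℂ +
      ⟪toL2 a (pd 1 (dirichletMode L a m n)), E 1⟫_ℂ +
      ⟪toL2 a (pd 2 (dirichletMode L a m n)), E 2⟫_ℂ = 0 := by
    refine tendsto_nhds_unique (((h 0).add (h 1)).add (h 2)) (tendsto_const_nhds.congr fun k => ?_)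
    have := hE _ (cutSep_mem_test L a m _ (contDiff_sinMode a n) k)
    rw [neg_eq_zero, Fin.sum_univ_three] at this
    exact this.symm
  simp only [pd_zero_dirichletMode, pd_one_dirichletMode, pd_two_dirichletMode, map_smul,
    inner_smul_left, map_mul, Complex.conj_I, Complex.conj_ofReal] at hs
  exact hs

lemma nu_ne_zero (ha : 0 < a) {n : ℕ} (hn : 1 ≤ n) : nu a n ≠ 0 := by
  have : (0 : ℝ) < n := by exact_mod_cast hn
  have := Real.pi_pos
  rw [nu]
  positivity

/-- Orthogonality to the TE and TM modes and the divergence constraint are three independent linear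
equations for the three amplitudes at `(m, n)`. At `m = 0` they decouple, the last one reading `ν_n
e2 = 0`. -/
lemma coeff_eq_zero (hL : 0 < L) (ha : 0 < a) {E : L2V L a} (hE : E ∈ Hphys L a)
    (h : ∀ i, ⟪maxwellMode L a i, E⟫_ℂ = 0) (m : ℤ × ℤ) {n : ℕ} (hn : 1 ≤ n) :
    ⟪toL2 a (dirichletMode L a m n), E 0⟫_ℂ = 0 ∧ ⟪toL2 a (dirichletMode L a m n), E 1⟫_ℂ = 0 ∧
      ⟪toL2 a (neumannMode L a m n), E 2⟫_ℂ = 0 := by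
  have hd := coeff_div_eq_zero hL ha (isDivFree_of_mem_Hphys hE) m n
  have h1 := h (Sum.inl (m, ⟨n, hn⟩))
  have h2 := h (Sum.inr (Sum.inl (m, ⟨n, hn⟩)))
  rw [maxwellMode, inner_sepField_left] at h1 h2
  simp only [pol, MIndex.pos, NIndex.pos, Sum.elim_inl, Sum.elim_inr, PNat.mk_coe] at h1 h2
  generalize ⟪toL2 a (dirichletMode L a m n), E 0⟫_ℂ = e0 at *
  generalize ⟪toL2 a (dirichletMode L a m n), E 1⟫_ℂ = e1 at *
  generalize ⟪toL2 a (neumannMode L a m n), E 2⟫_ℂ = e2 at *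
  have hnu : (nu a n : ℂ) ≠ 0 := by exact_mod_cast nu_ne_zero ha hn
  by_cases hm : m = 0
  · subst hm
    simp only [polTE, polTM, if_true, kx_zero, ky_zero] at h1 h2 hd
    simp [hnu] at h1 h2 hd
    exact ⟨h1, h2, hd⟩
  · have hk : (kAbs L m : ℂ) ≠ 0 := by exact_mod_cast kAbs_ne_zero hL hm
    have hk2 : (kAbs L m : ℂ) ^ 2 = kx L m ^ 2 + ky L m ^ 2 := by exact_mod_cast kAbs_sq L m
    have hl : (sqrtLam L a m n : ℂ) ≠ 0 := by exact_mod_cast sqrtLam_ne_zero hL hm n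
    have hl2 : (sqrtLam L a m n : ℂ) ^ 2 = kAbs L m ^ 2 + nu a n ^ 2 := by
      exact_mod_cast sqrtLam_sq L a m n
    simp only [polTE, polTM, if_neg hm, Matrix.cons_val_zero, Matrix.cons_val_one,
      Matrix.cons_val, Complex.conj_ofReal, map_mul, map_neg, Complex.conj_I, map_zero] at h1 h2
    push_cast at h1 h2
    field_simp at h1 h2
    have hI := Complex.I_sq
    -- In `h2 + ν hd` the lateral amplitudes cancel and `(|k|² + ν²) e2` remains.
    have he2 : e2 = 0 := by
      have h3 : (sqrtLam L a m n : ℂ) ^ 2 * e2 = 0 := by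
        rw [hl2]
        linear_combination h2 + nu a n * hd
      simpa [hl] using h3
    -- With `e2 = 0` the divergence kills the component along `k`; the TE equation `h1` kills the
    -- perpendicular one.
    have hs : (kx L m : ℂ) * e0 + ky L m * e1 = 0 := by
      have h4 : Complex.I * ((kx L m : ℂ) * e0 + ky L m * e1) = 0 := by
        linear_combination nu a n * he2 - hd
      simpa using h4
    refine ⟨?_, ?_, he2⟩
    · have h5 : (kAbs L m : ℂ) ^ 2 * e0 = 0 := by
        rw [hk2]
        linear_combination kx L m * hs - ky L m * h1
      simpa [hk] using h5
    · have h5 : (kAbs L m : ℂ) ^ 2 * e1 = 0 := by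
        rw [hk2]
        linear_combination ky L m * hs + kx L m * h1
      simpa [hk] using h5

/-- At `n = 0` the amplitude is tested directly: by the normal branch if `m ≠ 0`, by orthogonality
to `h₀` if `m = 0`. -/
lemma coeff_zero_eq_zero (hL : 0 < L) {E : L2V L a} (hE : E ∈ Hphys L a)
    (h : ∀ i, ⟪maxwellMode L a i, E⟫_ℂ = 0) (m : ℤ × ℤ) :
    ⟪toL2 a (neumannMode L a m 0), E 2⟫_ℂ = 0 := by
  by_cases hm : m = 0
  · subst hm
    have h1 := Submodule.mem_orthogonal_singleton_iff_inner_right.1 hE.2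
    rw [staticMode_eq hL, inner_sepField_left] at h1
    simpa using h1
  · have h1 := h (Sum.inr (Sum.inr ⟨m, hm⟩))
    rw [maxwellMode, inner_sepField_left] at h1
    simpa [pol, MIndex.pos, NIndex.pos] using h1

/-- The Maxwell modes form a Hilbert basis of `H_phys`. -/
def maxwellBasis (hL : 0 < L) (ha : 0 < a) : HilbertBasis MIndex ℂ (Hphys L a) :=
  HilbertBasis.mkOfOrthogonalEqBot (orthonormal_maxwellMode hL ha) (by
    rw [Submodule.eq_bot_iff]
    rintro ⟨E, hE⟩ hx
    have h : ∀ i, ⟪maxwellMode L a i, E⟫_ℂ = 0 := fun i => by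
      have := hx _ (Submodule.subset_span (mem_range_self i))
      rwa [Submodule.coe_inner] at this
    have h0 : E 0 = 0 := eq_zero_of_inner_dirichletMode hL ha _ fun m n hn =>
      (coeff_eq_zero hL ha hE h m hn).1
    have h1 : E 1 = 0 := eq_zero_of_inner_dirichletMode hL ha _ fun m n hn =>
      (coeff_eq_zero hL ha hE h m hn).2.1
    have h2 : E 2 = 0 := eq_zero_of_inner_neumannMode hL ha _ fun m n => by
      rcases Nat.eq_zero_or_pos n with rfl | hn
      · exact coeff_zero_eq_zero hL hE h m
      · exact (coeff_eq_zero hL ha hE h m hn).2.2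
    refine Subtype.ext (PiLp.ext fun i => ?_)
    obtain rfl | rfl | rfl : i = 0 ∨ i = 1 ∨ i = 2 := by fin_cases i <;> simp
    exacts [h0, h1, h2])

lemma maxwellBasis_apply (hL : 0 < L) (ha : 0 < a) (i : MIndex) :
    (maxwellBasis hL ha i : L2V L a) = maxwellMode L a i := by
  rw [maxwellBasis, HilbertBasis.coe_mkOfOrthogonalEqBot]

lemma maxwell_isDiagonal (hL : 0 < L) (ha : 0 < a) :
    IsDiagonal (maxwell L a) (maxwellBasis hL ha) fun i => ((eigM L a i : ℝ) : ℂ) := by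
  refine formOperator_isDiagonal (maxwellGraph L a) isClosed_maxwellGraph _ (eigM L a)
    (fun i => toL2V a (smoothCurl (sepField L a i.pos (pol L a i)))) (fun i => ?_) fun i q hq => ?_
  · rw [mem_maxwellGraph, maxwellBasis_apply]
    exact ⟨smoothPEC_mem_curlGraph hL ha (sepField_mem_smoothPEC ha _ _),
      (maxwellMode_mem_VPEC hL ha i).2⟩
  · rw [Submodule.coe_inner, maxwellBasis_apply]
    -- The equation is checked on all smooth fields with the conductor condition, solenoidal or not,
    -- and passes to the closure. Approximation by smooth solenoidal fields is thereby avoided: only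
    -- the mode itself has to be divergence-free.
    refine closure_minimal (t := {r : L2V L a × L2V L a |
      ⟪toL2V a (smoothCurl (sepField L a i.pos (pol L a i))), r.2⟫_ℂ =
      ((eigM L a i : ℝ) : ℂ) * ⟪maxwellMode L a i, r.1⟫_ℂ}) ?_
      (isClosed_eq (by fun_prop) (by fun_prop)) (mem_maxwellGraph.1 hq).1.2
    rintro _ ⟨G, hG, rfl⟩
    change ⟪_, toL2V a (smoothCurl G)⟫_ℂ = _ * ⟪_, toL2V a G⟫_ℂ
    rw [inner_smoothCurl hL ha _ _ hG, smoothCurl_smoothCurl_sepField (isSolenoidal_pol hL i),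
      map_smul, inner_smul_left, Complex.conj_ofReal, eigM_eq]
    rfl

/-! ### The unitary equivalence -/

/-- The Hilbert basis of `L²(Ω) ⊕ u_{0,0}^⊥` formed by the scalar modes. -/
def scalarBasis (hL : 0 < L) (ha : 0 < a) :
    HilbertBasis MIndex ℂ (WithLp 2 (L2 L a × HN' L a)) :=
  sumBasis (dirichletBasis hL ha) (reducedNeumannBasis hL ha)

lemma scalarBasis_isDiagonal (hL : 0 < L) (ha : 0 < a) :
    IsDiagonal (directSum (dirichletLaplacian L a) (reducedNeumann L a)) (scalarBasis hL ha)
      fun i => ((eigM L a i : ℝ) : ℂ) := by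
  have h := directSum_isDiagonal (dirichletLaplacian_isDiagonal hL ha)
    (reducedNeumann_isDiagonal hL ha)
  convert! h using 1
  funext i
  rcases i with i | i <;> rfl

/-- The rules prescribe the unitary on exactly one Hilbert basis and onto another, so this
equivalence yields both existence and uniqueness. -/
lemma modeRules_iff (hL : 0 < L) (ha : 0 < a)
    (U : WithLp 2 (L2 L a × HN' L a) ≃ₗᵢ[ℂ] Hphys L a) :
    ModeRules U ↔ ∀ i, U (scalarBasis hL ha i) = maxwellBasis hL ha i := by
  have hD : ∀ p, scalarBasis hL ha (Sum.inl p) =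
      WithLp.toLp 2 (toL2 a (dirichletMode L a p.1 p.2), 0) := fun p => by
    rw [scalarBasis, sumBasis_inl, dirichletBasis_apply]
  have hN : ∀ i, scalarBasis hL ha (Sum.inr i) =
      WithLp.toLp 2 (0, reducedNeumannBasis hL ha i) := fun i => by
    rw [scalarBasis, sumBasis_inr]
  have hsd : ∀ p, SendsD U (dirichletMode L a p.1 p.2) (maxwellMode L a (Sum.inl p)) ↔
      U (scalarBasis hL ha (Sum.inl p)) = maxwellBasis hL ha (Sum.inl p) := fun p => by
    rw [SendsD, hD, Subtype.ext_iff, maxwellBasis_apply]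
  have hsn : ∀ i, SendsN U (neumannMode L a i.pos.1 i.pos.2) (maxwellMode L a (Sum.inr i)) ↔
      U (scalarBasis hL ha (Sum.inr i)) = maxwellBasis hL ha (Sum.inr i) := fun i => by
    rw [SendsN, hN, Subtype.ext_iff, maxwellBasis_apply]
    constructor
    · rintro ⟨w, hw, h⟩
      obtain rfl : w = reducedNeumannBasis hL ha i :=
        Subtype.ext (hw.trans (reducedNeumannBasis_apply hL ha i).symm)
      exact h
    · exact fun h => ⟨_, reducedNeumannBasis_apply hL ha i, h⟩
  constructor
  · rintro ⟨te, tm, zx, zy, nm⟩ (⟨m, n⟩ | ⟨m, n⟩ | m)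
    · rw [← hsd]
      by_cases hm : m = 0
      · subst hm
        rw [maxwellMode_x]
        exact zx n n.2
      · rw [maxwellMode_te hm]
        exact te m n hm n.2
    · rw [← hsn]
      by_cases hm : m = 0
      · subst hm
        rw [maxwellMode_y]
        exact zy n n.2
      · rw [maxwellMode_tm hm]
        exact tm m n hm n.2
    · rw [← hsn, maxwellMode_normal]
      exact nm m m.2
  · intro h
    refine ⟨fun m n hm hn => ?_, fun m n hm hn => ?_, fun n hn => ?_, fun n hn => ?_,
      fun m hm => ?_⟩
    · lift n to ℕ+ using hn
      have := (hsd (m, n)).2 (h _)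
      rwa [maxwellMode_te hm] at this
    · lift n to ℕ+ using hn
      have := (hsn (Sum.inl (m, n))).2 (h _)
      rwa [maxwellMode_tm hm] at this
    · lift n to ℕ+ using hn
      have := (hsd (0, n)).2 (h _)
      rwa [maxwellMode_x] at this
    · lift n to ℕ+ using hn
      have := (hsn (Sum.inl (0, n))).2 (h _)
      rwa [maxwellMode_y] at this
    · have := (hsn (Sum.inr ⟨m, hm⟩)).2 (h _)
      rwa [maxwellMode_normal] at this

end Slab

end

/-! ### The main theorem -/

theorem theorem5p1 (L a : ℝ) (hL : 0 < L) (ha : 0 < a) :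
    -- the explicit unitary equivalence of the Maxwell operator with `L_D ⊕ L_N'`
    (∃ U : WithLp 2 (Slab.L2 L a × Slab.HN' L a) ≃ₗᵢ[ℂ] Slab.Hphys L a,
      Slab.ModeRules U ∧
      (∀ U' : WithLp 2 (Slab.L2 L a × Slab.HN' L a) ≃ₗᵢ[ℂ] Slab.Hphys L a,
        Slab.ModeRules U' → U' = U) ∧
      Slab.Intertwines U
        (Slab.directSum (Slab.dirichletLaplacian L a) (Slab.reducedNeumann L a))
        (Slab.maxwell L a)) ∧
    -- the trace identity
    ∀ f : NNReal → ℂ, Measurable f →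
      Summable (fun p : (ℤ × ℤ) × ℕ+ => ‖f (Slab.kSq L p.1 + Slab.nuSq a p.2)‖) →
      Summable (fun m : {m : ℤ × ℤ // m ≠ 0} => ‖f (Slab.kSq L m)‖) →
      ∃ tMx tD tN : ℂ,
        Slab.HasFunctionTrace (Slab.maxwell L a) f tMx ∧
        Slab.HasFunctionTrace (Slab.dirichletLaplacian L a) f tD ∧
        Slab.HasFunctionTrace (Slab.reducedNeumann L a) f tN ∧
        tD = ∑' p : (ℤ × ℤ) × ℕ+, f (Slab.kSq L p.1 + Slab.nuSq a p.2) ∧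
        tN = (∑' p : (ℤ × ℤ) × ℕ+, f (Slab.kSq L p.1 + Slab.nuSq a p.2)) +
          ∑' m : {m : ℤ × ℤ // m ≠ 0}, f (Slab.kSq L m) ∧
        tMx = tD + tN ∧
        tMx = 2 * (∑' p : (ℤ × ℤ) × ℕ+, f (Slab.kSq L p.1 + Slab.nuSq a p.2)) +
          ∑' m : {m : ℤ × ℤ // m ≠ 0}, f (Slab.kSq L m) := by
  refine ⟨⟨Slab.basisEquiv (Slab.scalarBasis hL ha) (Slab.maxwellBasis hL ha),
    (Slab.modeRules_iff hL ha _).2 (Slab.basisEquiv_apply _ _), fun U' hU' => ?_,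
    Slab.basisEquiv_intertwines (Slab.scalarBasis_isDiagonal hL ha)
      (Slab.maxwell_isDiagonal hL ha)⟩, fun f hf h1 h2 => ?_⟩
  · refine Slab.isometryEquiv_ext (Slab.scalarBasis hL ha) fun i => ?_
    rw [Slab.basisEquiv_apply, (Slab.modeRules_iff hL ha U').1 hU' i]
  · have hD : Summable fun p => ‖f (Slab.eigD L a p)‖ := h1
    have hN : Summable fun i => ‖f (Slab.eigN L a i)‖ := Summable.sum _ hD h2
    have hM : Summable fun i => ‖f (Slab.eigM L a i)‖ := Summable.sum _ hD hN
    have hN' : Summable fun i => f (Slab.eigN L a i) := hN.of_norm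
    have eN : ∑' i, f (Slab.eigN L a i) =
        (∑' p : (ℤ × ℤ) × ℕ+, f (Slab.kSq L p.1 + Slab.nuSq a p.2)) +
          ∑' m : {m : ℤ × ℤ // m ≠ 0}, f (Slab.kSq L m) :=
      Summable.tsum_sum (f := fun i => f (Slab.eigN L a i)) hD.of_norm h2.of_norm
    have eM : ∑' i, f (Slab.eigM L a i) =
        ∑' p, f (Slab.eigD L a p) + ∑' i, f (Slab.eigN L a i) :=
      Summable.tsum_sum (f := fun i => f (Slab.eigM L a i)) hD.of_norm hN'
    refine ⟨∑' i, f (Slab.eigM L a i), ∑' p, f (Slab.eigD L a p), ∑' i, f (Slab.eigN L a i),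
      Slab.hasFunctionTrace_of_isDiagonal (Slab.maxwell_isDiagonal hL ha) hf hM,
      Slab.hasFunctionTrace_of_isDiagonal (Slab.dirichletLaplacian_isDiagonal hL ha) hf hD,
      Slab.hasFunctionTrace_of_isDiagonal (Slab.reducedNeumann_isDiagonal hL ha) hf hN,
      rfl, eN, eM, ?_⟩
    rw [eM, eN, two_mul, add_assoc]
    rfl
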